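/- Let $\mathfrak g=\mathfrak{gl}(4,\mathbb R)$ with the involution $\sigma(X)=JXJ$, $J=\mathrm{diag}(I_2,-I_2)$, let $H\simeq GL(2,\mathbb R)\times GL(2,\mathbb R)$ be the group of fixed points of $\sigma$ in $GL(4,\mathbb R)$ and $\mathfrak q=\{X\in\mathfrak g:\sigma(X)=-X\}$, on which $H$ acts by conjugation. Put $\omega(X,X')=\tfrac12\operatorname{tr}(XX')$, $Q(X)=\tfrac12\operatorname{tr}(X^2)$, $S(X)=\det X$, $S_0=Q^2-4S$, and let $\delta=\sqrt{S_0}$ where $S_0\ge 0$, $\delta=i\sqrt{|S_0|}$ where $S_0<0$. For a polynomial $p$ on $\mathfrak q$, let $\partial(p)$ be the constant coefficient differential operator on $\mathfrak q$ corresponding to $p$ under the identification of $\mathbb C[\mathfrak q]$ with the symmetric algebra of $\mathfrak q_{\mathbb C}$ given by $\omega$. Let $\mathfrak q^{reg}$ be the set of semisimple elements of $\mathfrak q$ with pairwise distinct eigenvalues. Let $\mathfrak a\subset\mathfrak q$ be a Cartan subspace (an abelian subspace formed of semisimple elements, maximal for these properties), $\mathfrak a^{reg}=\mathfrak a\cap\mathfrak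 q^{reg}$, let $\Delta^+$ be a system of positive roots of $\mathfrak a_{\mathbb C}$ in $\mathfrak g_{\mathbb C}$ and let $m_\alpha$ be the multiplicity of a root $\alpha$. For a root $\alpha$ let $h_\alpha\in\mathfrak a_{\mathbb C}$ be the vector with $\omega(h_\alpha,X)=\alpha(X)$ for all $X\in\mathfrak a$, and let $$L_\alpha=\frac1{4\alpha}\,\partial_{h_\alpha}\circ(\alpha\,\partial_{h_\alpha}).$$ Then exactly two positive roots $\alpha_1,\alpha_2$ have multiplicity one. The radial part $\Delta_{\mathfrak a}(D)$ of $D=\partial(Q)$ or $D=\partial(S)$, that is, the unique differential operator on $\mathfrak a^{reg}$ with smooth coefficients such that $\Delta_{\mathfrak a}(D)(f|_{\mathfrak a^{reg}})=(Df)|_{\mathfrak a^{reg}}$ for every $H$-invariant $f\in C^\infty(\mathfrak q)$, exists and is given by $$\Delta_{\mathfrak a}(\partial(Q))=\delta^{-1}\circ(L_{\alpha_1}+L_{\alpha_2})\circ\delta=I^{-1}\circ(L_{\alpha_1}+L_{\alpha_2})\circ I,$$ $$\Delta_{\mathfrak a}(\partial(S))=\delta^{-1}\circ(L_{\alpha_1}L_{\alpha_2})\circ\delta=I^{-1}\circ(L_{\alpha_1}L_{\alpha_2})\circ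 I,$$ where $I=\prod_{\alpha\in\Delta^+}\alpha^{m_\alpha-1}$. -/

import Mathlib

open scoped ContDiff

attribute [local instance] Matrix.normedAddCommGroup Matrix.normedSpace

noncomputable section

namespace SymPair

/-! ### Smooth functions and constant coefficient differential operators -/

section Operators

variable {E : Type*} [NormedAddCommGroup E] [NormedSpace ℝ E]

/-- The space `C^∞(E)` of smooth complex valued functions on a real normed space. -/
def SmoothFun (E : Type*) [NormedAddCommGroup E] [NormedSpace ℝ E] :
    Submodule ℂ (E → ℂ) where
  carrier := {f | ContDiff ℝ ∞ f}
  add_mem' {f g} hf hg := by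
    rw [Set.mem_ofPred_eq] at *
    exact hf.add hg
  zero_mem' := by
    rw [Set.mem_ofPred_eq]
    exact contDiff_const
  smul_mem' c f hf := by
    rw [Set.mem_ofPred_eq] at *
    exact contDiff_const.smul hf

theorem smoothFun_contDiff (f : SmoothFun E) : ContDiff ℝ ∞ f.1 := f.2

theorem smoothFun_contDiff_fderiv (f : SmoothFun E) : ContDiff ℝ ∞ (fderiv ℝ f.1) :=
  (smoothFun_contDiff f).fderiv_right (m := ∞) (by simp)

theorem smoothFun_differentiable (f : SmoothFun E) : Differentiable ℝ f.1 :=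
  (smoothFun_contDiff f).differentiable (by simp)

/-- The directional derivative `∂_v` as an endomorphism of `C^∞(E)`. -/
def dirOp (v : E) : Module.End ℂ (SmoothFun E) where
  toFun f := ⟨fun x => fderiv ℝ f.1 x v, (smoothFun_contDiff_fderiv f).clm_apply contDiff_const⟩
  map_add' f g := by
    ext x
    change fderiv ℝ (f.1 + g.1) x v = fderiv ℝ f.1 x v + fderiv ℝ g.1 x v
    rw [fderiv_add (smoothFun_differentiable f x) (smoothFun_differentiable g x)]
    rfl
  map_smul' c f := by
    ext x
    change fderiv ℝ (c • f.1) x v = c • fderiv ℝ f.1 x v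
    rw [fderiv_const_smul (smoothFun_differentiable f x)]
    rfl

theorem dirOp_comm (v w : E) : dirOp v * dirOp w = dirOp w * dirOp v := by
  ext f x
  have hd : DifferentiableAt ℝ (fderiv ℝ f.1) x :=
    (smoothFun_contDiff_fderiv f).differentiable (by simp) x
  have hs : IsSymmSndFDerivAt ℝ f.1 x := (smoothFun_contDiff f).contDiffAt.isSymmSndFDerivAt (by
      simp only [minSmoothness_of_isRCLikeNormedField]
      exact WithTop.coe_le_coe.2 le_top)
  change fderiv ℝ (fun y => fderiv ℝ f.1 y w) x v = fderiv ℝ (fun y => fderiv ℝ f.1 y v) x w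
  rw [fderiv_clm_apply hd (differentiableAt_const w),
    fderiv_clm_apply hd (differentiableAt_const v)]
  simpa using hs v w

instance isMulCommutative_adjoin_dirOp {ι : Type*} (v : ι → E) :
    IsMulCommutative (Algebra.adjoin ℂ (Set.range fun i => dirOp (v i))) :=
  Algebra.isMulCommutative_adjoin ℂ (by
    rintro _ ⟨i, rfl⟩ _ ⟨j, rfl⟩
    exact dirOp_comm _ _)

open scoped IsMulCommutative in
/-- For vectors `v i` of `E`, the homomorphism of algebras from polynomials in the variables `X i` to
constant coefficient differential operators on `E` that maps `X i` to `∂_{v i}`. -/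
def constCoeffOp {ι : Type*} (v : ι → E) :
    MvPolynomial ι ℂ →ₐ[ℂ] Module.End ℂ (SmoothFun E) :=
  (Algebra.adjoin ℂ (Set.range fun i => dirOp (v i))).val.comp
    (MvPolynomial.aeval fun i => ⟨dirOp (v i), Algebra.subset_adjoin ⟨i, rfl⟩⟩)

theorem constCoeffOp_X {ι : Type*} (v : ι → E) (i : ι) :
    constCoeffOp v (MvPolynomial.X i) = dirOp (v i) := by
  simp [constCoeffOp]

/-- `T` acts on `C^∞(U)`, for `U` an open subset of `E`, as a linear differential operator with smooth
complex coefficients: `T g = ∑_{n ≤ N} c_n (D^n g)` on `U`, where `c_n x` is a linear form on the space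
that contains the `n`-th derivatives at `x`. Functions on `U` are represented by functions on `E`, the
values of which outside `U` are irrelevant. -/
def IsDiffOp (U : Set E) (T : (E → ℂ) → (E → ℂ)) : Prop :=
  ∃ (N : ℕ) (c : (n : ℕ) → E → ((E [×n]→L[ℝ] ℂ) →L[ℂ] ℂ)),
    (∀ n, ContDiffOn ℝ ∞ (c n) U) ∧
    ∀ g : E → ℂ, ContDiffOn ℝ ∞ g U → ∀ x ∈ U,
      T g x = ∑ n ∈ Finset.range (N + 1), c n x (iteratedFDeriv ℝ n g x)

/-- Equality of two operators on `C^∞(U)`. -/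
def OpEqOn (U : Set E) (T T' : (E → ℂ) → (E → ℂ)) : Prop :=
  ∀ g : E → ℂ, ContDiffOn ℝ ∞ g U → Set.EqOn (T g) (T' g) U

/-- The operator of multiplication by a function. -/
def mulOp (u : E → ℂ) : (E → ℂ) → (E → ℂ) := fun g x => u x * g x

/-- The derivative along the vector `h.1 + i h.2` of the complexification of `E`. -/
def cDeriv (h : E × E) : (E → ℂ) → (E → ℂ) :=
  fun g x => fderiv ℝ g x h.1 + Complex.I * fderiv ℝ g x h.2

end Operators

/-! ### The symmetric pair -/

/-- Indices of `4 × 4` matrices written in `2 × 2` blocks. -/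
abbrev Idx := Fin 2 ⊕ Fin 2

/-- `𝔤𝔩(4, R)`. -/
abbrev gl4 (R : Type*) := Matrix Idx Idx R

/-- The matrix `diag(I₂, -I₂)`. -/
def J : gl4 ℝ := Matrix.fromBlocks 1 0 0 (-1)

theorem J_mul_J : J * J = 1 := by
  simp [J, Matrix.fromBlocks_multiply, Matrix.fromBlocks_one]

/-- The involution of `𝔤𝔩(4, ℝ)`. -/
def sigma (X : gl4 ℝ) : gl4 ℝ := J * X * J

theorem sigma_mul (X Y : gl4 ℝ) : sigma (X * Y) = sigma X * sigma Y := by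
  calc J * (X * Y) * J = J * X * 1 * Y * J := by simp [mul_assoc]
    _ = J * X * (J * J) * Y * J := by rw [J_mul_J]
    _ = J * X * J * (J * Y * J) := by simp only [mul_assoc]

/-- The subgroup `H` of the points of `GL(4, ℝ)` fixed by the involution. -/
def H : Subgroup (GL Idx ℝ) where
  carrier := {g | sigma (g : gl4 ℝ) = g}
  one_mem' := by simp [sigma, J_mul_J]
  mul_mem' {a b} ha hb := by
    change sigma _ = _ at ha
    change sigma _ = _ at hb
    change sigma _ = _
    rw [Units.val_mul, sigma_mul, ha, hb]
  inv_mem' {a} ha := by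
    change sigma _ = _ at ha
    change sigma _ = _
    have h1 : sigma (a⁻¹ : GL Idx ℝ).val * a.val = 1 := by
      conv_lhs => rw [← ha]
      rw [← sigma_mul, ← Units.val_mul]
      simp [sigma, J_mul_J]
    calc sigma (a⁻¹ : GL Idx ℝ).val
        = sigma (a⁻¹ : GL Idx ℝ).val * (a.val * (a⁻¹ : GL Idx ℝ).val) := by
          rw [← Units.val_mul]; simp
      _ = (a⁻¹ : GL Idx ℝ).val := by rw [← mul_assoc, h1, one_mul]

/-- The `-1` eigenspace `𝔮` of the involution. -/
def q : Submodule ℝ (gl4 ℝ) where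
  carrier := {X | sigma X = -X}
  add_mem' {X Y} hX hY := by
    change J * X * J = -X at hX
    change J * Y * J = -Y at hY
    change J * (X + Y) * J = -(X + Y)
    rw [mul_add, add_mul, hX, hY, neg_add]
  zero_mem' := by
    change J * 0 * J = -0
    simp
  smul_mem' c X hX := by
    change J * X * J = -X at hX
    change J * (c • X) * J = -(c • X)
    rw [Matrix.mul_smul, Matrix.smul_mul, hX, smul_neg]

theorem fromBlocks_mem_q (Y Z : Matrix (Fin 2) (Fin 2) ℝ) :
    Matrix.fromBlocks 0 Y Z 0 ∈ q := by
  change J * _ * J = -_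
  simp [J, Matrix.fromBlocks_multiply, Matrix.fromBlocks_neg]

/-- The invariant form `ω(X, X') = tr(X X') / 2`. -/
def omegaForm (X X' : gl4 ℝ) : ℝ := (1 / 2) * Matrix.trace (X * X')

/-- `Q(X) = tr(X²) / 2`, for a matrix `X` with entries in any commutative real algebra. -/
def Q {R : Type*} [CommRing R] [Algebra ℝ R] (X : gl4 R) : R :=
  (1 / 2 : ℝ) • Matrix.trace (X ^ 2)

/-- `S(X) = det X`. -/
def S {R : Type*} [CommRing R] (X : gl4 R) : R := X.det

/-- The coordinates on `𝔮`: the entries of the two off-diagonal blocks. -/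
abbrev Coord := (Fin 2 × Fin 2) ⊕ (Fin 2 × Fin 2)

/-- The coordinate functions on `𝔮`. -/
def coord : Coord → gl4 ℝ → ℝ
  | .inl (i, j), X => X (.inl i) (.inr j)
  | .inr (i, j), X => X (.inr i) (.inl j)

/-- The generic element of `𝔮`; its entries are the variables of the polynomial algebra `ℂ[𝔮]`. -/
def genericX : gl4 (MvPolynomial Coord ℂ) :=
  Matrix.fromBlocks 0 (Matrix.of fun i j => MvPolynomial.X (.inl (i, j)))
    (Matrix.of fun i j => MvPolynomial.X (.inr (i, j))) 0

/-- The elements of `𝔮` that correspond to the coordinate functions under the isomorphism between `𝔮`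
and its dual given by `ω`. -/
def dualVec : Coord → q
  | .inl (i, j) => ⟨Matrix.fromBlocks 0 0 (Matrix.single j i 2) 0, fromBlocks_mem_q _ _⟩
  | .inr (i, j) => ⟨Matrix.fromBlocks 0 (Matrix.single j i 2) 0 0, fromBlocks_mem_q _ _⟩

theorem omegaForm_dualVec (k : Coord) (X : gl4 ℝ) : omegaForm (dualVec k) X = coord k X := by
  rw [← Matrix.fromBlocks_toBlocks X]
  rcases k with ⟨i, j⟩ | ⟨i, j⟩ <;>
    simp [omegaForm, dualVec, coord, Matrix.fromBlocks_multiply, Matrix.trace,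
      Matrix.mul_apply, Matrix.single_apply, ite_and]

/-- The constant coefficient differential operator `∂(p)` on `𝔮` of a polynomial `p` on `𝔮`, where
`ℂ[𝔮]` is identified with the symmetric algebra of the complexification of `𝔮` by means of `ω`. -/
def partialOp : MvPolynomial Coord ℂ →ₐ[ℂ] Module.End ℂ (SmoothFun q) := constCoeffOp dualVec

/-- `S₀ = Q² - 4 S`. -/
def S0 (X : gl4 ℝ) : ℝ := Q X ^ 2 - 4 * S X

/-- The square root `δ` of `S₀`: nonnegative or in `i ℝ₊`. -/
def delta (X : gl4 ℝ) : ℂ := (if S0 X < 0 then Complex.I else 1) * (√|S0 X| : ℝ)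

/-- Semisimple matrices. -/
def IsSS (X : gl4 ℝ) : Prop := Module.End.IsSemisimple (Matrix.toLin' X)

/-- The regular elements of `𝔮`: semisimple with pairwise distinct (complex) eigenvalues. -/
def qReg : Set q :=
  {X | IsSS X ∧ ((X : gl4 ℝ).map Complex.ofReal).charpoly.roots.Nodup}

/-- `H`-invariance of a function on `𝔮`. -/
def IsHInvariant (f : q → ℂ) : Prop :=
  ∀ h ∈ H, ∀ X X' : q,
    (X' : gl4 ℝ) = (h : gl4 ℝ) * (X : gl4 ℝ) * ((h⁻¹ : GL Idx ℝ) : gl4 ℝ) → f X' = f X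

/-- The Cartan subspaces of `𝔮`: abelian subspaces formed of semisimple elements, maximal for these
two properties. -/
def IsCartanSubspace (a : Submodule ℝ q) : Prop :=
  Maximal (fun b : Submodule ℝ q =>
    (∀ X ∈ b, ∀ X' ∈ b, (X : gl4 ℝ) * (X' : gl4 ℝ) = (X' : gl4 ℝ) * (X : gl4 ℝ)) ∧
      ∀ X ∈ b, IsSS X) a

section Cartan

variable (a : Submodule ℝ q)

/-- The regular elements of `𝔞`. -/
def aReg : Set a := {X | (X : q) ∈ qReg}

/-- The space `{Y ∈ 𝔤_ℂ | [X, Y] = α(X) Y for all X ∈ 𝔞}`. Complex linear forms on the complexification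
of `𝔞` are given as real linear maps from `𝔞` to `ℂ`. -/
def rootSpace (α : a →ₗ[ℝ] ℂ) : Submodule ℂ (gl4 ℂ) where
  carrier := {Y | ∀ X : a, ((X : q) : gl4 ℝ).map Complex.ofReal * Y
    - Y * ((X : q) : gl4 ℝ).map Complex.ofReal = α X • Y}
  add_mem' {Y Y'} hY hY' X := by
    rw [mul_add, add_mul, add_sub_add_comm, hY X, hY' X, smul_add]
  zero_mem' X := by simp
  smul_mem' c Y hY X := by
    rw [Matrix.mul_smul, Matrix.smul_mul, ← smul_sub, hY X, smul_comm]

/-- The roots of `𝔞_ℂ` in `𝔤_ℂ`. -/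
def IsRoot (α : a →ₗ[ℝ] ℂ) : Prop := α ≠ 0 ∧ rootSpace a α ≠ ⊥

/-- The multiplicity `m_α`. -/
def mult (α : a →ₗ[ℝ] ℂ) : ℕ := Module.finrank ℂ (rootSpace a α)

/-- Systems of positive roots. -/
structure IsPositiveSystem (P : Finset (a →ₗ[ℝ] ℂ)) : Prop where
  isRoot : ∀ α ∈ P, IsRoot a α
  mem_or_neg_mem : ∀ α, IsRoot a α → α ∈ P ∨ -α ∈ P
  neg_notMem : ∀ α ∈ P, -α ∉ P
  add_mem : ∀ α ∈ P, ∀ β ∈ P, IsRoot a (α + β) → α + β ∈ P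

variable {a}

/-- `h = h.1 + i h.2 ∈ 𝔞_ℂ` represents the linear form `α`, that is `ω(h, X) = α(X)` on `𝔞`. -/
def Represents (h : a × a) (α : a →ₗ[ℝ] ℂ) : Prop :=
  ∀ X : a, (omegaForm (h.1 : q) (X : q) : ℂ) + Complex.I * (omegaForm (h.2 : q) (X : q) : ℂ) = α X

open Classical in
/-- The vector `h_α` of `𝔞_ℂ` that represents `α` (it exists and is unique, as `ω` is nondegenerate on a
Cartan subspace `𝔞`). -/
def hvec (α : a →ₗ[ℝ] ℂ) : a × a :=
  if H : ∃ h : a × a, Represents h α then H.choose else 0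

/-- `L_α = (1 / 4α) ∂_{h_α} ∘ (α ∂_{h_α})`. -/
def L (α : a →ₗ[ℝ] ℂ) : (a → ℂ) → (a → ℂ) :=
  mulOp (fun X => 1 / (4 * α X)) ∘ cDeriv (hvec α) ∘ mulOp (fun X => α X) ∘ cDeriv (hvec α)

/-- `∏_{α ∈ P} α ^ (n_α)`, where `P` is a system of positive roots. -/
def rootPow (P : Finset (a →ₗ[ℝ] ℂ)) (n : (a →ₗ[ℝ] ℂ) → ℤ) (X : a) : ℂ :=
  ∏ α ∈ P, α X ^ n α

variable (a)

/-- `Δ` is a differential operator on `𝔞^reg` with `Δ(f|_{𝔞^reg}) = (D f)|_{𝔞^reg}` for every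
`H`-invariant smooth function `f` on `𝔮`. -/
def IsCompatible (D : Module.End ℂ (SmoothFun q)) (Δ : (a → ℂ) → (a → ℂ)) : Prop :=
  IsDiffOp (aReg a) Δ ∧
    ∀ f : SmoothFun q, IsHInvariant f.1 →
      Set.EqOn (Δ fun X => f.1 (X : q)) (fun X => (D f).1 (X : q)) (aReg a)

/-- `Δ` is the radial part of `D` on `𝔞`: the one differential operator on `𝔞^reg` that is compatible
with `D`. -/
def IsRadialPart (D : Module.End ℂ (SmoothFun q)) (Δ : (a → ℂ) → (a → ℂ)) : Prop :=
  IsCompatible a D Δ ∧ ∀ Δ', IsCompatible a D Δ' → OpEqOn (aReg a) Δ' Δ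

end Cartan

end SymPair

end

open SymPair

/-! An element of `𝔮` is a pair of 2 × 2 blocks `(Y, Z)`, with `Q = tr(YZ)` and `S = det Y det Z`.
On a Cartan subspace the eigenvalues are `±t₁, ±t₂` for two complex linear forms with `ω = t₁t₁' +
t₂t₂'`, so that `Q = t₁² + t₂²`, `S = t₁²t₂²` and `S₀ = v²` with `v = t₁² - t₂²`. The roots are
`±2t₁, ±2t₂`, of multiplicity one, and `±t₁ ± t₂`, of multiplicity two. Hence `I = ±v`, while `δ` is
locally `±v` on `𝔞^reg`. Conjugation ignores constant factors, so both forms of each formula say the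
same thing: conjugate by `v`.

Near a regular point of `𝔞` the pair `(Q, S)` is a local coordinate system on `𝔞`, and regular
elements of `𝔮` with equal `(Q, S)` are `H`-conjugate (`exists_H_conj`). Therefore every smooth
invariant function is locally `F(Q, S)` (`IsCoordPair.exists_pullQ`). Conversely, every smooth
function on `𝔞^reg` is locally the restriction of some invariant `F(Q, S)`, which gives uniqueness
by locality of differential operators (`IsCoordPair.compatible_unique`). Existence is thus reduced
to an identity on functions of two variables.

That identity is a computation in commutative algebra with derivations. On the side of `𝔮`, `∂(Q) =
4 tr(∂_Y ∂_Z)` and `∂(S) = 16 det(∂_Y) det(∂_Z)` up to transposition, and they map functions of `(Q,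
S)` to such functions (`laplace_pull`, `det_dz_pull`, `det_dy_pull`). On the side of `𝔞`, with `u =
t₁²` and `w = t₂²`, the operator `L_{2t₁}` is `4M_u`, where `M_u = u∂_u² + ∂_u`, and similarly for
`w`. It remains to compare with `(M_u + M_w)(vF)` and `M_u M_w (vF)` (`halfRadial_sub`,
`radial_first_halfRadial`).

The forms `t₁, t₂` are found without classifying Cartan subspaces: maximality forces a regular
element `X₀` (`IsCartanSubspace.exists_regular`), its centralizer in `𝔮` is spanned by `X₀` and
`X₀³`, and diagonalizing `X₀` over `ℂ` diagonalizes `𝔞` (`IsCartanSubspace.exists_isCoordPair`). -/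

noncomputable section

namespace SymPair

/-! ### Derivations of the algebra of smooth functions, and the chain rule for `F(u, w)`. -/

section SmoothAlgebra

variable {E : Type*} [NormedAddCommGroup E] [NormedSpace ℝ E]

/-- The algebra of smooth complex valued functions. -/
def smoothAlg (E : Type*) [NormedAddCommGroup E] [NormedSpace ℝ E] : Subalgebra ℂ (E → ℂ) where
  carrier := {f | ContDiff ℝ ∞ f}
  add_mem' {f g} hf hg := by
    rw [Set.mem_ofPred_eq] at *
    exact hf.add hg
  mul_mem' {f g} hf hg := by
    rw [Set.mem_ofPred_eq] at *
    exact hf.mul hg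
  algebraMap_mem' c := by
    rw [Set.mem_ofPred_eq]
    exact contDiff_const

theorem smoothAlg_contDiff (f : smoothAlg E) : ContDiff ℝ ∞ f.1 := f.2

theorem smoothAlg_differentiable (f : smoothAlg E) : Differentiable ℝ f.1 :=
  (smoothAlg_contDiff f).differentiable (by simp)

theorem cDeriv_contDiff (h : E × E) {f : E → ℂ} (hf : ContDiff ℝ ∞ f) :
    ContDiff ℝ ∞ (cDeriv h f) := by
  have h1 : ContDiff ℝ ∞ (fderiv ℝ f) := hf.fderiv_right (m := ∞) (by simp)
  exact (h1.clm_apply contDiff_const).add (contDiff_const.mul (h1.clm_apply contDiff_const))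

/-- The derivation `∂_h` of the algebra of smooth functions, for `h` in the complexification. -/
def dder (h : E × E) : Derivation ℂ (smoothAlg E) (smoothAlg E) :=
  Derivation.mk'
    { toFun := fun f => ⟨cDeriv h f.1, cDeriv_contDiff h (smoothAlg_contDiff f)⟩
      map_add' := fun f g => by
        ext x
        change cDeriv h (f.1 + g.1) x = cDeriv h f.1 x + cDeriv h g.1 x
        simp only [cDeriv]
        rw [fderiv_add (smoothAlg_differentiable f x) (smoothAlg_differentiable g x)]
        simp only [add_apply]
        ring
      map_smul' := fun c f => by
        ext x
        change cDeriv h (c • f.1) x = c * cDeriv h f.1 x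
        simp only [cDeriv]
        rw [fderiv_const_smul (smoothAlg_differentiable f x)]
        simp only [smul_apply, smul_eq_mul]
        ring }
    (fun f g => by
      ext x
      change cDeriv h (f.1 * g.1) x = f.1 x * cDeriv h g.1 x + g.1 x * cDeriv h f.1 x
      simp only [cDeriv]
      rw [fderiv_mul (smoothAlg_differentiable f x) (smoothAlg_differentiable g x)]
      simp only [add_apply, smul_apply, smul_eq_mul]
      ring)

theorem coe_dder (h : E × E) (f : smoothAlg E) : (dder h f).1 = cDeriv h f.1 := rfl

theorem coe_dder_real (v : E) (f : smoothAlg E) (x : E) :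
    (dder (v, 0) f).1 x = fderiv ℝ f.1 x v := by
  simp [coe_dder, cDeriv]

theorem dder_real_comm (v w : E) (f : smoothAlg E) :
    dder (v, 0) (dder (w, 0) f) = dder (w, 0) (dder (v, 0) f) := by
  have key : ∀ (v : E) (f : smoothAlg E), dder (v, 0) f
      = ⟨(dirOp v (⟨f.1, f.2⟩ : SmoothFun E)).1, (dirOp v ⟨f.1, f.2⟩).2⟩ := by
    intro v f
    ext x
    exact coe_dder_real v f x
  have := congrArg (fun T => T ⟨f.1, f.2⟩) (dirOp_comm v w)
  ext x
  rw [key v, key w f, key w, key v f]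
  exact congrArg (fun g : SmoothFun E => g.1 x) this

theorem fderiv_ofReal_comp {u : E → ℝ} {x : E} (hu : DifferentiableAt ℝ u x) (v : E) :
    fderiv ℝ (fun y => (u y : ℂ)) x v = (fderiv ℝ u x v : ℝ) := by
  have : HasFDerivAt (fun y => (u y : ℂ)) (Complex.ofRealCLM.comp (fderiv ℝ u x)) x :=
    Complex.ofRealCLM.hasFDerivAt.comp x hu.hasFDerivAt
  rw [this.fderiv]
  simp

/-- A smooth real function as an element of the algebra of smooth functions. -/
def ofRealFun (u : E → ℝ) (hu : ContDiff ℝ ∞ u) : smoothAlg E :=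
  ⟨fun x => (u x : ℂ), Complex.ofRealCLM.contDiff.comp hu⟩

/-- Composition with the map to the plane with components `u` and `w`. -/
def pull (u w : E → ℝ) (hu : ContDiff ℝ ∞ u) (hw : ContDiff ℝ ∞ w) :
    smoothAlg (ℝ × ℝ) →ₐ[ℂ] smoothAlg E where
  toFun F := ⟨fun x => F.1 (u x, w x), (smoothAlg_contDiff F).comp (hu.prodMk hw)⟩
  map_one' := rfl
  map_mul' _ _ := rfl
  map_zero' := rfl
  map_add' _ _ := rfl
  commutes' _ := rfl

/-- First partial derivative on the plane. -/
def dFst : Derivation ℂ (smoothAlg (ℝ × ℝ)) (smoothAlg (ℝ × ℝ)) := dder ((1, 0), 0)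

/-- Second partial derivative on the plane. -/
def dSnd : Derivation ℂ (smoothAlg (ℝ × ℝ)) (smoothAlg (ℝ × ℝ)) := dder ((0, 1), 0)

theorem dSnd_dFst (F : smoothAlg (ℝ × ℝ)) : dSnd (dFst F) = dFst (dSnd F) :=
  dder_real_comm _ _ _

/-- First coordinate of the plane. -/
def cFst : smoothAlg (ℝ × ℝ) := ofRealFun Prod.fst contDiff_fst

/-- Second coordinate of the plane. -/
def cSnd : smoothAlg (ℝ × ℝ) := ofRealFun Prod.snd contDiff_snd

theorem dder_clm (h : E × E) (l : E →L[ℝ] ℂ) (f : smoothAlg E) (hf : f.1 = l) :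
    dder h f = algebraMap ℂ _ (l h.1 + Complex.I * l h.2) := by
  ext x
  change cDeriv h f.1 x = _
  rw [hf]
  simp [cDeriv, Algebra.algebraMap_eq_smul_one]

theorem dFst_cFst : dFst cFst = 1 := by
  have := dder_clm ((1, 0), 0) (Complex.ofRealCLM.comp (ContinuousLinearMap.fst ℝ ℝ ℝ)) cFst rfl
  simpa [dFst, dSnd] using this

theorem dFst_cSnd : dFst cSnd = 0 := by
  have := dder_clm ((1, 0), 0) (Complex.ofRealCLM.comp (ContinuousLinearMap.snd ℝ ℝ ℝ)) cSnd rfl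
  simpa [dFst, dSnd] using this

theorem dSnd_cFst : dSnd cFst = 0 := by
  have := dder_clm ((0, 1), 0) (Complex.ofRealCLM.comp (ContinuousLinearMap.fst ℝ ℝ ℝ)) cFst rfl
  simpa [dFst, dSnd] using this

theorem dSnd_cSnd : dSnd cSnd = 1 := by
  have := dder_clm ((0, 1), 0) (Complex.ofRealCLM.comp (ContinuousLinearMap.snd ℝ ℝ ℝ)) cSnd rfl
  simpa [dFst, dSnd] using this

/-- The chain rule, with the partial derivatives of `u` and `w` written as derivatives of the pulled
back coordinates. In this form it is the only analytic input of the algebraic computations below. -/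
theorem dder_pull (u w : E → ℝ) (hu : ContDiff ℝ ∞ u) (hw : ContDiff ℝ ∞ w) (h : E × E)
    (F : smoothAlg (ℝ × ℝ)) :
    dder h (pull u w hu hw F) = dder h (pull u w hu hw cFst) * pull u w hu hw (dFst F)
      + dder h (pull u w hu hw cSnd) * pull u w hu hw (dSnd F) := by
  ext x
  have hu' : DifferentiableAt ℝ u x := hu.differentiable (by simp) x
  have hw' : DifferentiableAt ℝ w x := hw.differentiable (by simp) x
  have hF := (smoothAlg_differentiable F (u x, w x)).hasFDerivAt
  have key : ∀ v, fderiv ℝ (pull u w hu hw F).1 x v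
      = (fderiv ℝ u x v : ℝ) * fderiv ℝ F.1 (u x, w x) (1, 0)
        + (fderiv ℝ w x v : ℝ) * fderiv ℝ F.1 (u x, w x) (0, 1) := by
    intro v
    have h1 : HasFDerivAt (pull u w hu hw F).1
        ((fderiv ℝ F.1 (u x, w x)).comp ((fderiv ℝ u x).prod (fderiv ℝ w x))) x :=
      hF.comp x (hu'.hasFDerivAt.prodMk hw'.hasFDerivAt)
    rw [h1.fderiv]
    have h2 : (fderiv ℝ u x v, fderiv ℝ w x v)
        = (fderiv ℝ u x v) • ((1, 0) : ℝ × ℝ) + (fderiv ℝ w x v) • ((0, 1) : ℝ × ℝ) := by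
      ext <;> simp
    simp only [ContinuousLinearMap.comp_apply, ContinuousLinearMap.prod_apply]
    rw [h2, map_add, map_smul, map_smul]
    simp
  have e1 : ∀ v, fderiv ℝ (pull u w hu hw cFst).1 x v = (fderiv ℝ u x v : ℝ) :=
    fderiv_ofReal_comp hu'
  have e2 : ∀ v, fderiv ℝ (pull u w hu hw cSnd).1 x v = (fderiv ℝ w x v : ℝ) :=
    fderiv_ofReal_comp hw'
  change cDeriv h (pull u w hu hw F).1 x = cDeriv h (pull u w hu hw cFst).1 x *
      (dFst F).1 (u x, w x) + cDeriv h (pull u w hu hw cSnd).1 x * (dSnd F).1 (u x, w x)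
  simp only [cDeriv, key, e1, e2, dFst, dSnd, coe_dder_real]
  ring

end SmoothAlgebra

/-! ### The two operators on functions of `(Q, S)`, computed with abstract derivations. -/

section RadialAlgebra

theorem derivation_ofNat {A : Type*} [CommRing A] [Algebra ℂ A] (D : Derivation ℂ A A) (n : ℕ)
    [n.AtLeastTwo] : D (ofNat(n) : A) = 0 :=
  D.map_natCast n

variable {R₀ R : Type*} [CommRing R₀] [Algebra ℂ R₀] [CommRing R] [Algebra ℂ R]
  (p s : Derivation ℂ R₀ R₀) (τ d : R₀) (φ : R₀ →ₐ[ℂ] R)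

/-- The operator induced on functions of `(Q, S)` by the determinant of half of the derivatives. -/
def detOp (F : R₀) : R₀ := p (p F) + τ * p (s F) + 2 * s F + d * s (s F)

/-- The operator on functions of `(Q, S)` that corresponds to multiplication by one determinant
followed by the determinant of derivatives. -/
def codetOp (F : R₀) : R₀ := 2 * F + τ * p F + 2 * d * s F + d * detOp p s τ d F

/-- The operator induced by the Laplacian on functions of `(Q, S)`. -/
def laplaceOp (F : R₀) : R₀ :=
  4 * p F + τ * p (p F) + 4 * d * p (s F) + τ * s F + τ * d * s (s F)

variable {p s τ d φ}

section Blocks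

variable {y z : Fin 2 → Fin 2 → R} {dy dz : Fin 2 → Fin 2 → Derivation ℂ R R}
  (hyy : ∀ i j k l, dy i j (y k l) = if i = l ∧ j = k then 2 else 0)
  (hzz : ∀ i j k l, dz i j (z k l) = if i = l ∧ j = k then 2 else 0)
  (hyz : ∀ i j k l, dy i j (z k l) = 0) (hzy : ∀ i j k l, dz i j (y k l) = 0)
  (hτ : φ τ = y 0 0 * z 0 0 + y 0 1 * z 1 0 + y 1 0 * z 0 1 + y 1 1 * z 1 1)
  (hd : φ d = (y 0 0 * y 1 1 - y 0 1 * y 1 0) * (z 0 0 * z 1 1 - z 0 1 * z 1 0))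
  (hy : ∀ i j F, dy i j (φ F) = dy i j (φ τ) * φ (p F) + dy i j (φ d) * φ (s F))
  (hz : ∀ i j F, dz i j (φ F) = dz i j (φ τ) * φ (p F) + dz i j (φ d) * φ (s F))
  (hps : ∀ F, s (p F) = p (s F))

-- `τ` has gradient `2y` in the `z` variables and `d = det y · det z`, so every term of the
-- determinant carries a factor `det y`. The factor 4 appears because each derivation is twice a
-- partial derivative.
include hzz hzy hτ hd hz hps in
theorem det_dz_pull (F : R₀) :
    dz 0 0 (dz 1 1 (φ F)) - dz 0 1 (dz 1 0 (φ F))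
      = 4 * ((y 0 0 * y 1 1 - y 0 1 * y 1 0) * φ (detOp p s τ d F)) := by
  simp only [detOp, map_add, map_mul, map_ofNat, hz _ _ F, Derivation.leibniz, smul_eq_mul,
    hz _ _ (p F), hz _ _ (s F), hτ, hd, map_sub, hzz, hzy, hps]
  simp [derivation_ofNat]
  ring

-- The argument `det y · φ F` is what `det_dz_pull` leaves behind. The extra factor makes the result
-- a function of `(Q, S)` again; the term `2F` of `codetOp` is Cayley's `det(∂_y) det y = 2`.
include hyy hyz hτ hd hy hps in
theorem det_dy_pull (F : R₀) :
    dy 0 0 (dy 1 1 ((y 0 0 * y 1 1 - y 0 1 * y 1 0) * φ F))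
        - dy 0 1 (dy 1 0 ((y 0 0 * y 1 1 - y 0 1 * y 1 0) * φ F))
      = 4 * φ (codetOp p s τ d F) := by
  simp only [codetOp, detOp, map_add, map_mul, map_ofNat, hy _ _ F, Derivation.leibniz, smul_eq_mul,
    hy _ _ (p F), hy _ _ (s F), hτ, hd, map_sub, hyy, hyz, hps]
  simp [derivation_ofNat]
  ring

-- The term `4 p F` counts the four products of `τ`, each with mixed second derivative 1 before the
-- rescaling by 4.
include hyy hzz hyz hzy hτ hd hy hz hps in
theorem laplace_pull (F : R₀) :
    dy 0 0 (dz 0 0 (φ F)) + dy 0 1 (dz 1 0 (φ F)) + dy 1 0 (dz 0 1 (φ F)) + dy 1 1 (dz 1 1 (φ F))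
      = 4 * φ (laplaceOp p s τ d F) := by
  simp only [laplaceOp, map_add, map_mul, map_ofNat, hz _ _ F, Derivation.leibniz, smul_eq_mul,
    hy _ _ (p F), hy _ _ (s F), hτ, hd, map_sub, hyy, hyz, hzz, hzy, hps]
  simp [derivation_ofNat]
  ring

end Blocks

section Plane

variable {t₁ t₂ : R} {D₁ D₂ : Derivation ℂ R R}
  (h11 : D₁ t₁ = 2) (h12 : D₁ t₂ = 0) (h21 : D₂ t₁ = 0) (h22 : D₂ t₂ = 2)
  (hτ : φ τ = t₁ ^ 2 + t₂ ^ 2) (hd : φ d = t₁ ^ 2 * t₂ ^ 2)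
  (h1 : ∀ F, D₁ (φ F) = D₁ (φ τ) * φ (p F) + D₁ (φ d) * φ (s F))
  (h2 : ∀ F, D₂ (φ F) = D₂ (φ τ) * φ (p F) + D₂ (φ d) * φ (s F))
  (hps : ∀ F, s (p F) = p (s F))

/-- The function `M (v F)`, where `M = u ∂_u² + ∂_u` for `u = t₁²`, `w = t₂²` and `v = u - w`. -/
def halfRadial (p s : Derivation ℂ R₀ R₀) (φ : R₀ →ₐ[ℂ] R) (u w : R) (F : R₀) : R :=
  (u - w) * u * (φ (p (p F)) + 2 * w * φ (p (s F)) + w ^ 2 * φ (s (s F)))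
    + (3 * u - w) * (φ (p F) + w * φ (s F)) + φ F

-- Since `D₁` is `2∂_{t₁}` and `∂_{t₁} = 2t₁∂_u`, the operator `D₁ ∘ t₁ D₁` equals `16 t₁(u∂_u² +
-- ∂_u)`.
include h11 h12 hτ hd h1 hps in
theorem radial_first (F : R₀) :
    D₁ (t₁ * D₁ ((t₁ ^ 2 - t₂ ^ 2) * φ F))
      = t₁ * (16 * halfRadial p s φ (t₁ ^ 2) (t₂ ^ 2) F) := by
  simp only [halfRadial, h1 F, h1 (p F), h1 (s F), Derivation.leibniz, Derivation.leibniz_pow,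
    smul_eq_mul, hτ, hd, map_sub, map_add, h11, h12, hps, nsmul_eq_mul]
  simp [derivation_ofNat]
  ring

-- Exchanging `t₁` and `t₂` changes the sign of `v`, whence the minus sign.
include h21 h22 hτ hd h2 hps in
theorem radial_second (F : R₀) :
    D₂ (t₂ * D₂ ((t₁ ^ 2 - t₂ ^ 2) * φ F))
      = t₂ * (- (16 * halfRadial p s φ (t₂ ^ 2) (t₁ ^ 2) F)) := by
  simp only [halfRadial, h2 F, h2 (p F), h2 (s F), Derivation.leibniz, Derivation.leibniz_pow,
    smul_eq_mul, hτ, hd, map_sub, map_add, h21, h22, hps, nsmul_eq_mul]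
  simp [derivation_ofNat]
  ring

-- `M_u v = 1` and `M_w v = -1` cancel, so `(M_u + M_w)(vF)` has no term of order zero in `F` and is
-- divisible by `v`.
include hτ hd in
theorem halfRadial_sub (F : R₀) :
    16 * halfRadial p s φ (t₁ ^ 2) (t₂ ^ 2) F + -(16 * halfRadial p s φ (t₂ ^ 2) (t₁ ^ 2) F)
      = 16 * ((t₁ ^ 2 - t₂ ^ 2) * φ (laplaceOp p s τ d F)) := by
  simp only [halfRadial, laplaceOp, map_add, map_mul, map_ofNat, hτ, hd]
  ring

-- The identity `M_u M_w (vF) = v · codetOp (detOp F)`, with `M_w (vF)` entered in the form produced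
-- by `radial_second`. The values of `p` and `s` at `τ` and `d` are needed because `codetOp`
-- differentiates the coefficients of `detOp`.
include h11 h12 hτ hd h1 hps in
theorem radial_first_halfRadial (hpτ : p τ = 1) (hpd : p d = 0) (hsτ : s τ = 0) (hsd : s d = 1)
    (F : R₀) :
    D₁ (t₁ * D₁ (- (16 * halfRadial p s φ (t₂ ^ 2) (t₁ ^ 2) F)))
      = t₁ * (256 * ((t₁ ^ 2 - t₂ ^ 2) * φ (codetOp p s τ d (detOp p s τ d F)))) := by
  have hd1 : ∀ F, D₁ (φ F) = 4 * t₁ * φ (p F) + 4 * t₁ * t₂ ^ 2 * φ (s F) := by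
    intro F
    rw [h1 F, hτ, hd]
    simp only [map_add, Derivation.leibniz, Derivation.leibniz_pow, smul_eq_mul, nsmul_eq_mul,
      h11, h12]
    simp
    ring
  simp only [halfRadial, codetOp, detOp, map_add, map_sub, map_neg, map_mul, map_ofNat, hd1,
    Derivation.leibniz, Derivation.leibniz_pow, smul_eq_mul, nsmul_eq_mul, h11, h12, derivation_ofNat,
    hpτ, hpd, hsτ, hsd, hps, hτ, hd, map_one, map_zero, Derivation.map_one_eq_zero]
  simp only [mul_zero, zero_mul, add_zero, zero_add, Nat.cast_ofNat, Nat.add_one_sub_one, pow_one,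
    mul_one, derivation_ofNat]
  ring

end Plane

end RadialAlgebra

/-! ### Block form of `𝔮` and its invariants. -/

section Blocks

open Matrix

theorem det_fromBlocks_antidiag {R : Type*} [CommRing R] (Y Z : Matrix (Fin 2) (Fin 2) R) :
    (fromBlocks 0 Y Z 0).det = Y.det * Z.det := by
  have h : fromBlocks 0 Y Z 0
      = (fromBlocks Y 0 0 Z).submatrix id (Equiv.sumComm (Fin 2) (Fin 2)) := by
    ext i j
    rcases i with i | i <;> rcases j with j | j <;> rfl
  rw [h, det_permute']
  -- Exchanging the two pairs of columns is a product of two transpositions, so no sign appears.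
  have : Equiv.Perm.sign (Equiv.sumComm (Fin 2) (Fin 2)) = 1 := by decide
  rw [this, det_fromBlocks_zero₂₁]
  simp

theorem Q_fromBlocks {R : Type*} [CommRing R] [Algebra ℝ R] (Y Z : Matrix (Fin 2) (Fin 2) R) :
    Q (fromBlocks 0 Y Z 0) = (Y * Z).trace := by
  simp only [Q, pow_two, fromBlocks_multiply]
  have h : (fromBlocks (Y * Z) 0 0 (Z * Y)).trace = (Y * Z).trace + (Z * Y).trace := by
    simp [trace, Fintype.sum_sum_type]
  simp only [zero_mul, mul_zero, zero_add, add_zero]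
  rw [h, trace_mul_comm Z Y, ← two_smul ℝ, smul_smul]
  norm_num

theorem S_fromBlocks {R : Type*} [CommRing R] (Y Z : Matrix (Fin 2) (Fin 2) R) :
    S (fromBlocks 0 Y Z 0) = Y.det * Z.det := det_fromBlocks_antidiag Y Z

theorem mem_q_iff {X : gl4 ℝ} : X ∈ q ↔ ∃ Y Z, X = fromBlocks 0 Y Z 0 := by
  constructor
  · intro h
    refine ⟨X.toBlocks₁₂, X.toBlocks₂₁, ?_⟩
    rw [← fromBlocks_toBlocks X] at h
    change J * _ * J = -_ at h
    simp only [J, fromBlocks_multiply, fromBlocks_neg] at h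
    simp only [one_mul, mul_one, zero_mul, mul_zero, add_zero, zero_add, mul_neg, neg_mul,
      neg_neg, fromBlocks_inj] at h
    conv_lhs => rw [← fromBlocks_toBlocks X]
    have h0 : ∀ M : Matrix (Fin 2) (Fin 2) ℝ, M = -M → M = 0 := by
      intro M hM
      ext i j
      have := congrFun (congrFun hM i) j
      rw [neg_apply] at this
      rw [Matrix.zero_apply]
      linarith
    have h1 : X.toBlocks₁₁ = 0 := h0 _ h.1
    have h2 : X.toBlocks₂₂ = 0 := h0 _ h.2.2.2
    rw [h1, h2]
  · rintro ⟨Y, Z, rfl⟩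
    exact fromBlocks_mem_q Y Z

/-- The characteristic polynomial is even, with coefficients `Q` and `S`. The ring is arbitrary
because the formula serves both at complex numbers and at the polynomial variable. -/
theorem det_smul_one_sub {R : Type*} [CommRing R] (Y Z : Matrix (Fin 2) (Fin 2) R) (t : R) :
    (t • (1 : gl4 R) - fromBlocks 0 Y Z 0).det
      = t ^ 4 - (Y * Z).trace * t ^ 2 + Y.det * Z.det := by
  have h : t • (1 : gl4 R) - fromBlocks 0 Y Z 0 = fromBlocks (t • 1) (-Y) (-Z) (t • 1) := by
    rw [← fromBlocks_one, fromBlocks_smul, sub_eq_add_neg, fromBlocks_neg, fromBlocks_add]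
    simp
  rw [h, ← det_submatrix_equiv_self finSumFinEquiv.symm]
  simp only [det_succ_row_zero, Fin.sum_univ_succ, trace_fin_two]
  simp [fromBlocks, finSumFinEquiv, Fin.succAbove, Matrix.mul_apply, Fin.addCases]
  ring

end Blocks

/-! ### Semisimple matrices. -/

section Semisimple

open Matrix Polynomial

theorem IsSS.add {X Y : gl4 ℝ} (hX : IsSS X) (hY : IsSS Y) (h : X * Y = Y * X) :
    IsSS (X + Y) := by
  unfold IsSS at *
  rw [map_add]
  refine hX.add_of_commute ?_ hY
  change toLin' X ∘ₗ toLin' Y = toLin' Y ∘ₗ toLin' X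
  rw [← toLin'_mul, ← toLin'_mul, h]

theorem IsSS.smul {X : gl4 ℝ} (c : ℝ) (hX : IsSS X) : IsSS (c • X) := by
  unfold IsSS at *
  rw [map_smul]
  exact Module.End.IsSemisimple_smul c hX

theorem IsSS.sub {X Y : gl4 ℝ} (hX : IsSS X) (hY : IsSS Y) (h : X * Y = Y * X) :
    IsSS (X - Y) := by
  have := hX.add (hY.smul (-1)) (by simp [h])
  simpa [sub_eq_add_neg] using this

theorem IsSS.mul {X Y : gl4 ℝ} (hX : IsSS X) (hY : IsSS Y) (h : X * Y = Y * X) :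
    IsSS (X * Y) := by
  unfold IsSS at *
  rw [toLin'_mul]
  refine hX.mul_of_commute ?_ hY
  change toLin' X ∘ₗ toLin' Y = toLin' Y ∘ₗ toLin' X
  rw [← toLin'_mul, ← toLin'_mul, h]

/-- The source of the matrix identities on a Cartan subspace: a semisimple difference that is
nilpotent vanishes. -/
theorem IsSS.eq_zero {X : gl4 ℝ} (hX : IsSS X) (h : IsNilpotent X) : X = 0 := by
  have h1 : IsNilpotent (toLin' X) := h.map (Matrix.toLinAlgEquiv' (R := ℝ) (n := Idx))
  have := Module.End.eq_zero_of_isNilpotent_isSemisimple h1 hX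
  simpa using this

theorem isSS_of_aeval {X : gl4 ℝ} {p : ℝ[X]} (hp : p.Separable) (h : aeval X p = 0) : IsSS X := by
  refine Module.End.isSemisimple_of_squarefree_aeval_eq_zero hp.squarefree ?_
  have h1 := congrArg (Matrix.toLinAlgEquiv' (R := ℝ) (n := Idx)) h
  rw [map_zero, ← AlgEquiv.coe_toAlgHom, ← aeval_algHom_apply] at h1
  exact h1

theorem isSS_of_sq {X : gl4 ℝ} {c : ℝ} (hc : c ≠ 0) (h : X * X = c • 1) : IsSS X := by
  refine isSS_of_aeval (separable_X_pow_sub_C c (n := 2) (by norm_num) hc) ?_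
  simp [pow_two, h, Algebra.algebraMap_eq_smul_one]

theorem isSS_of_cube {X : gl4 ℝ} {c : ℝ} (hc : c ≠ 0) (h : X * X * X = c • X) : IsSS X := by
  have h1 : (Polynomial.X * (Polynomial.X ^ 2 - C c) : ℝ[X]).Separable := by
    refine separable_X.mul (separable_X_pow_sub_C c (n := 2) (by norm_num) hc) ?_
    refine ⟨C c⁻¹ * Polynomial.X, - C c⁻¹, ?_⟩
    have : C c⁻¹ * C c = 1 := by rw [← C_mul, inv_mul_cancel₀ hc, C_1]
    linear_combination this
  refine isSS_of_aeval h1 ?_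
  simp [pow_two, mul_sub, ← mul_assoc, h, Algebra.algebraMap_eq_smul_one]

end Semisimple

/-! ### Polynomial identities for elements of `𝔮`. -/

section Elements

open Matrix

theorem mul_mul_mem_q {X Y Z : gl4 ℝ} (hX : X ∈ q) (hY : Y ∈ q) (hZ : Z ∈ q) :
    X * Y * Z ∈ q := by
  change sigma _ = _
  rw [sigma_mul, sigma_mul, show sigma X = -X from hX, show sigma Y = -Y from hY,
    show sigma Z = -Z from hZ]
  simp

theorem mul_self_fin_two {R : Type*} [CommRing R] (W : Matrix (Fin 2) (Fin 2) R) :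
    W * W = W.trace • W - W.det • 1 := by
  ext i j
  fin_cases i <;> fin_cases j <;>
    simp [mul_apply, trace_fin_two, det_fin_two, Fin.sum_univ_two] <;> ring

/-- Cayley–Hamilton in each diagonal block of `X²`: `YZ` and `ZY` share their trace and determinant.
-/
theorem sq_mul_sq_of_mem_q {X : gl4 ℝ} (hX : X ∈ q) :
    X * X * (X * X) = Q X • (X * X) - S X • 1 := by
  obtain ⟨Y, Z, rfl⟩ := mem_q_iff.1 hX
  rw [Q_fromBlocks, S_fromBlocks, fromBlocks_multiply]
  simp only [zero_mul, mul_zero, zero_add, add_zero]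
  rw [fromBlocks_multiply, ← fromBlocks_one, fromBlocks_smul, fromBlocks_smul, sub_eq_add_neg,
    fromBlocks_neg, fromBlocks_add]
  simp only [zero_mul, mul_zero, zero_add, add_zero, mul_self_fin_two, smul_zero, neg_zero]
  rw [trace_mul_comm Z Y, det_mul, det_mul, mul_comm Z.det]
  simp only [sub_eq_add_neg]

/-- Here `A⁴ = Q(A)A²`, so `A³ - Q(A)A` has square zero; being semisimple, it is zero. -/
theorem IsSS.cube {A : gl4 ℝ} (hs : IsSS A) (hA : A ∈ q) (h : S A = 0) :
    A * A * A = Q A • A := by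
  have h4 := sq_mul_sq_of_mem_q hA
  rw [h, zero_smul, sub_zero] at h4
  have hN : IsSS (A * A * A - Q A • A) :=
    ((hs.mul hs rfl).mul hs (mul_assoc _ _ _)).sub (hs.smul _) (by simp [mul_assoc])
  refine sub_eq_zero.1 (hN.eq_zero ⟨2, ?_⟩)
  have e1 : A * A * A * (A * A * A) = Q A • Q A • (A * A) := by
    calc A * A * A * (A * A * A) = A * A * (A * A) * (A * A) := by simp only [mul_assoc]
      _ = _ := by rw [h4, smul_mul_assoc, h4]
  have e2 : A * A * A * A = Q A • (A * A) := by rw [← h4, mul_assoc (A * A)]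
  have e3 : A * (A * A * A) = Q A • (A * A) := by rw [← h4]; simp only [mul_assoc]
  rw [pow_two, sub_mul, mul_sub, mul_sub, smul_mul_smul_comm, mul_smul_comm, smul_mul_assoc, e1, e2,
    e3, smul_smul]
  abel

/-- The element `(adj Z, adj Y)` of `𝔮` attached to `(Y, Z)`. -/
def adjSwap (X : gl4 ℝ) : gl4 ℝ :=
  fromBlocks 0 X.toBlocks₂₁.adjugate X.toBlocks₁₂.adjugate 0

theorem adjSwap_mem_q (X : gl4 ℝ) : adjSwap X ∈ q := fromBlocks_mem_q _ _

theorem self_add_adjugate_fin_two (W : Matrix (Fin 2) (Fin 2) ℝ) :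
    W + W.adjugate = W.trace • 1 := by
  ext i j
  fin_cases i <;> fin_cases j <;> simp [adjugate_fin_two, trace_fin_two, add_comm]

/-- The blocks of the second square are `adj(YZ)` and `adj(ZY)`, and `W + adj W = tr W` for 2 × 2
matrices. -/
theorem sq_add_adjSwap_sq {X : gl4 ℝ} (hX : X ∈ q) :
    X * X + adjSwap X * adjSwap X = Q X • 1 := by
  obtain ⟨Y, Z, rfl⟩ := mem_q_iff.1 hX
  rw [Q_fromBlocks, adjSwap, fromBlocks_multiply, fromBlocks_multiply, fromBlocks_add,
    ← fromBlocks_one, fromBlocks_smul]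
  simp only [toBlocks_fromBlocks₁₂, toBlocks_fromBlocks₂₁, zero_mul, mul_zero, zero_add, add_zero,
    ← adjugate_mul_distrib, self_add_adjugate_fin_two, smul_zero]
  rw [trace_mul_comm Z Y]

/-- The products are block scalar with entries `det Y` and `det Z`. Taking determinants in `YZY =
cY` and `ZYZ = cZ`, where `det Y det Z = 0` and `c ≠ 0`, shows that both vanish. -/
theorem mul_adjSwap {X : gl4 ℝ} (hX : X ∈ q) (h : S X = 0) (hQ : Q X ≠ 0)
    (h3 : X * X * X = Q X • X) : X * adjSwap X = 0 ∧ adjSwap X * X = 0 := by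
  obtain ⟨Y, Z, rfl⟩ := mem_q_iff.1 hX
  rw [S_fromBlocks] at h
  generalize Q (fromBlocks 0 Y Z 0) = c at *
  simp only [fromBlocks_multiply, fromBlocks_smul, zero_mul, mul_zero, zero_add, add_zero,
    fromBlocks_inj, smul_zero, true_and, and_true] at h3
  have hY := congrArg det h3.1
  have hZ := congrArg det h3.2
  simp only [det_mul, det_smul, Fintype.card_fin] at hY hZ
  have hY0 : Y.det = 0 := by
    have : c ^ 2 * Y.det = 0 := by rw [← hY]; linear_combination Y.det * h
    exact (mul_eq_zero.1 this).resolve_left (pow_ne_zero _ hQ)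
  have hZ0 : Z.det = 0 := by
    have : c ^ 2 * Z.det = 0 := by rw [← hZ]; linear_combination Z.det * h
    exact (mul_eq_zero.1 this).resolve_left (pow_ne_zero _ hQ)
  simp only [adjSwap, toBlocks_fromBlocks₁₂, toBlocks_fromBlocks₂₁, fromBlocks_multiply,
    mul_adjugate, adjugate_mul, hY0, hZ0]
  simp

end Elements

/-! ### Existence of regular elements in a Cartan subspace. -/

section CartanSubspaces

open Matrix

variable {a : Submodule ℝ q}

theorem IsCartanSubspace.comm (ha : IsCartanSubspace a) {X Y : q} (hX : X ∈ a) (hY : Y ∈ a) :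
    (X : gl4 ℝ) * (Y : gl4 ℝ) = (Y : gl4 ℝ) * (X : gl4 ℝ) := ha.prop.1 X hX Y hY

theorem IsCartanSubspace.isSS (ha : IsCartanSubspace a) {X : q} (hX : X ∈ a) :
    IsSS (X : gl4 ℝ) := ha.prop.2 X hX

/-- The working form of maximality: `𝔞 + ℝX` is again abelian, and it is formed of semisimple
elements because sums of commuting semisimple elements are semisimple. -/
theorem IsCartanSubspace.mem_of_commute (ha : IsCartanSubspace a) {X : q} (hX : IsSS (X : gl4 ℝ))
    (h : ∀ A ∈ a, (X : gl4 ℝ) * (A : gl4 ℝ) = (A : gl4 ℝ) * (X : gl4 ℝ)) : X ∈ a := by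
  have hb : (fun b : Submodule ℝ q =>
      (∀ X ∈ b, ∀ X' ∈ b, (X : gl4 ℝ) * (X' : gl4 ℝ) = (X' : gl4 ℝ) * (X : gl4 ℝ)) ∧
      ∀ X ∈ b, IsSS X) (a ⊔ Submodule.span ℝ {X}) := by
    constructor
    · intro U hU V hV
      obtain ⟨A, hA, x, hx, rfl⟩ := Submodule.mem_sup.1 hU
      obtain ⟨B, hB, y, hy, rfl⟩ := Submodule.mem_sup.1 hV
      obtain ⟨r, rfl⟩ := Submodule.mem_span_singleton.1 hx
      obtain ⟨s, rfl⟩ := Submodule.mem_span_singleton.1 hy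
      simp only [Submodule.coe_add, Submodule.coe_smul, add_mul, mul_add, smul_mul_assoc,
        mul_smul_comm, ha.comm hA hB, h A hA, h B hB]
      module
    · intro U hU
      obtain ⟨A, hA, x, hx, rfl⟩ := Submodule.mem_sup.1 hU
      obtain ⟨r, rfl⟩ := Submodule.mem_span_singleton.1 hx
      refine (ha.isSS hA).add (hX.smul r) ?_
      rw [Submodule.coe_smul, smul_mul_assoc, mul_smul_comm, h A hA]
  exact (ha.le_of_ge hb le_sup_left) (Submodule.mem_sup_right (Submodule.mem_span_singleton_self X))

theorem IsCartanSubspace.exists_ne_zero (ha : IsCartanSubspace a) : ∃ X ∈ a, X ≠ 0 := by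
  by_contra! hcon
  have h1 : (fromBlocks 0 1 1 0 : gl4 ℝ) * fromBlocks 0 1 1 0 = (1 : ℝ) • 1 := by
    simp [fromBlocks_multiply]
  have h2 := hcon _ (ha.mem_of_commute (X := ⟨_, fromBlocks_mem_q 1 1⟩)
    (isSS_of_sq one_ne_zero h1) (fun A hA => by simp [hcon A hA]))
  have h3 : (fromBlocks 0 1 1 0 : gl4 ℝ) = 0 := congrArg Subtype.val h2
  have := congrFun (congrFun h3 (.inl 0)) (.inr 0)
  simp at this

/-- If `𝔞` had only singular elements, then `X²` would act on `𝔞` as the scalar `Q(X)` for a nonzero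
`X ∈ 𝔞`. The complementary element `adjSwap X` would annihilate `𝔞` and hence belong to it by
maximality. But `X + adjSwap X` has square `Q(X)`, so it is invertible. -/
theorem IsCartanSubspace.exists_det_ne_zero (ha : IsCartanSubspace a) :
    ∃ X ∈ a, S (X : gl4 ℝ) ≠ 0 := by
  by_contra! hcon
  have hcube : ∀ A ∈ a, (A : gl4 ℝ) * A * A = Q (A : gl4 ℝ) • (A : gl4 ℝ) := fun A hA =>
    (ha.isSS hA).cube A.2 (hcon A hA)
  have hQ : ∀ A ∈ a, A ≠ 0 → Q (A : gl4 ℝ) ≠ 0 := by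
    intro A hA hne h0
    refine hne (Subtype.ext ((ha.isSS hA).eq_zero ⟨3, ?_⟩))
    rw [pow_three', hcube A hA, h0, zero_smul]
  obtain ⟨X, hXa, hX0⟩ := ha.exists_ne_zero
  have hq := hQ X hXa hX0
  have hX3 := hcube X hXa
  obtain ⟨hmul, hmul'⟩ := mul_adjSwap X.2 (hcon X hXa) hq hX3
  have hsq := sq_add_adjSwap_sq X.2
  -- The defect `N = cA - X²A` lies in `𝔞` by maximality and satisfies `XN = 0`.
  have key : ∀ A ∈ a, Q (X : gl4 ℝ) • (A : gl4 ℝ) = (X : gl4 ℝ) * X * A := by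
    intro A hA
    have hXA := ha.comm hXa hA
    set c := Q (X : gl4 ℝ)
    let N : q := ⟨c • (A : gl4 ℝ) - X * X * A,
      q.sub_mem (q.smul_mem _ A.2) (mul_mul_mem_q X.2 X.2 A.2)⟩
    have hXXA : (X : gl4 ℝ) * X * A = A * (X * X) := by
      rw [mul_assoc, hXA, ← mul_assoc, hXA, mul_assoc]
    have hNa : N ∈ a := by
      refine ha.mem_of_commute (((ha.isSS hA).smul c).sub
        (((ha.isSS hXa).mul (ha.isSS hXa) rfl).mul (ha.isSS hA) hXXA) ?_) ?_
      · rw [smul_mul_assoc, mul_smul_comm, hXXA, mul_assoc, ← hXXA]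
      · intro B hB
        have hXB := ha.comm hXa hB
        have hAB := ha.comm hA hB
        change (c • (A : gl4 ℝ) - X * X * A) * B = B * (c • (A : gl4 ℝ) - X * X * A)
        rw [sub_mul, mul_sub, smul_mul_assoc, mul_smul_comm, hAB]
        congr 1
        rw [mul_assoc, hAB, ← mul_assoc, mul_assoc (X : gl4 ℝ) X B, hXB, ← mul_assoc, hXB,
          mul_assoc (B : gl4 ℝ) X X, mul_assoc]
    have hXN : (X : gl4 ℝ) * N = 0 := by
      change (X : gl4 ℝ) * (c • (A : gl4 ℝ) - X * X * A) = 0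
      rw [mul_sub, ← mul_assoc, ← mul_assoc, hX3, mul_smul_comm, smul_mul_assoc, sub_self]
    have hNX : (N : gl4 ℝ) * X = 0 := by rw [ha.comm hNa hXa, hXN]
    have hadd : Q ((X : gl4 ℝ) + (N : gl4 ℝ)) = c + Q (N : gl4 ℝ) := by
      simp only [c, Q, pow_two, mul_add, add_mul, hXN, hNX, add_zero, zero_add, trace_add, smul_add]
    have h3 := hcube _ (a.add_mem hXa hNa)
    rw [Submodule.coe_add, hadd] at h3
    simp only [mul_add, add_mul, mul_assoc (N : gl4 ℝ) N X, mul_assoc (X : gl4 ℝ) X N, hXN, hNX,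
      add_zero, zero_add, mul_zero, hX3, hcube N hNa,
      smul_add, add_smul] at h3
    -- The cross terms left when the cubic identities of `X` and `N` are subtracted from that of `X
    -- + N`. Multiplication by `X` then gives `Q(N) = 0`, so `N = 0`.
    have hsum : Q (N : gl4 ℝ) • (X : gl4 ℝ) + c • (N : gl4 ℝ) = 0 := by
      have h5 : c • (X : gl4 ℝ) + Q (N : gl4 ℝ) • (N : gl4 ℝ)
          = c • (X : gl4 ℝ) + Q (N : gl4 ℝ) • (N : gl4 ℝ)
            + (Q (N : gl4 ℝ) • (X : gl4 ℝ) + c • (N : gl4 ℝ)) := by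
        refine h3.trans ?_
        abel
      exact left_eq_add.1 h5
    have h6 : Q (N : gl4 ℝ) • ((X : gl4 ℝ) * X) = 0 := by
      have := congrArg (fun M => (X : gl4 ℝ) * M) hsum
      simpa only [mul_add, mul_smul_comm, hXN, smul_zero, add_zero, mul_zero] using this
    have h7 : (X : gl4 ℝ) * X ≠ 0 := by
      intro h8
      rw [h8, zero_mul] at hX3
      exact hX0 (Subtype.ext ((smul_eq_zero.1 hX3.symm).resolve_left hq))
    rw [(smul_eq_zero.1 h6).resolve_right h7, zero_smul, zero_add] at hsum
    exact sub_eq_zero.1 ((smul_eq_zero.1 hsum).resolve_left hq)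
  have hzero : ∀ A ∈ a, adjSwap X * A = 0 ∧ (A : gl4 ℝ) * adjSwap X = 0 := by
    intro A hA
    have hXA := ha.comm hXa hA
    have hXXA : (X : gl4 ℝ) * X * A = A * X * X := by
      rw [mul_assoc, hXA, ← mul_assoc, hXA]
    constructor
    · refine (smul_eq_zero_iff_right hq).1 ?_
      rw [← mul_smul_comm, key A hA, mul_assoc, ← mul_assoc, hmul', zero_mul]
    · refine (smul_eq_zero_iff_right hq).1 ?_
      rw [← smul_mul_assoc, key A hA, hXXA, mul_assoc, hmul, mul_zero]
  have hss : IsSS (adjSwap X) := by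
    refine isSS_of_cube hq ?_
    rw [eq_sub_of_add_eq' hsq, sub_mul, mul_assoc, hmul, mul_zero, sub_zero, smul_mul_assoc,
      one_mul]
  have hmem : (⟨adjSwap X, adjSwap_mem_q X⟩ : q) ∈ a :=
    ha.mem_of_commute hss (fun A hA => by rw [(hzero A hA).1, (hzero A hA).2])
  have hdet := hcon _ (a.add_mem hXa hmem)
  have h9 : ((X : gl4 ℝ) + adjSwap X) * ((X : gl4 ℝ) + adjSwap X) = Q (X : gl4 ℝ) • 1 := by
    rw [← hsq]
    simp only [mul_add, add_mul, hmul, hmul', add_zero, zero_add]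
  have h10 := congrArg det h9
  rw [det_mul, show det ((X : gl4 ℝ) + adjSwap X) = 0 from hdet, det_smul, det_one] at h10
  rw [zero_mul, mul_one] at h10
  exact pow_ne_zero _ hq h10.symm

/-- If `S₀` vanished at every invertible element of `𝔞`, each of these would have scalar square.
This forces `𝔞` to be a line `ℝX`, and a line of this kind is not maximal. -/
theorem IsCartanSubspace.exists_regular (ha : IsCartanSubspace a) :
    ∃ X ∈ a, S (X : gl4 ℝ) ≠ 0 ∧ S0 (X : gl4 ℝ) ≠ 0 := by
  by_contra! hcon
  have hsq : ∀ A ∈ a, S (A : gl4 ℝ) ≠ 0 →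
      (A : gl4 ℝ) * A = (Q (A : gl4 ℝ) / 2) • 1 ∧ Q (A : gl4 ℝ) / 2 ≠ 0 := by
    intro A hA hS
    have h0 := hcon A hA hS
    unfold S0 at h0
    have h4 := sq_mul_sq_of_mem_q A.2
    have hss : IsSS ((A : gl4 ℝ) * A - (Q (A : gl4 ℝ) / 2) • 1) := by
      refine ((ha.isSS hA).mul (ha.isSS hA) rfl).sub (IsSS.smul _ ?_) (by simp)
      exact isSS_of_sq one_ne_zero (by simp)
    -- With `S = (Q/2)²` the relation `A⁴ = QA² - S` reads `(A² - Q/2)² = 0`.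
    refine ⟨sub_eq_zero.1 (hss.eq_zero ⟨2, ?_⟩), ?_⟩
    · rw [pow_two, sub_mul, mul_sub, mul_sub, h4, mul_smul_comm, smul_mul_assoc, smul_mul_smul_comm,
        mul_one, one_mul, mul_one,
        show S (A : gl4 ℝ) = Q (A : gl4 ℝ) / 2 * (Q (A : gl4 ℝ) / 2) by linarith]
      module
    · intro h
      have : Q (A : gl4 ℝ) = 0 := by linarith
      rw [this] at h0
      exact hS (by linarith)
  obtain ⟨X, hXa, hS⟩ := ha.exists_det_ne_zero
  obtain ⟨hX2, hc⟩ := hsq X hXa hS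
  set c := Q (X : gl4 ℝ) / 2
  -- For small `s ≠ 0` both `X + sA` and `X - sA` are invertible, so their squares are scalar; the
  -- difference of the squares is `4sXA`, so `XA` is scalar and `A` is proportional to `X`.
  have hline : ∀ A ∈ a, ∃ r : ℝ, (A : gl4 ℝ) = r • (X : gl4 ℝ) := by
    intro A hA
    have hcont : Continuous fun s : ℝ => S ((X : gl4 ℝ) + s • (A : gl4 ℝ))
        * S ((X : gl4 ℝ) - s • (A : gl4 ℝ)) := by
      unfold S
      fun_prop
    have hev : ∀ᶠ s in nhdsWithin (0 : ℝ) {0}ᶜ, S ((X : gl4 ℝ) + s • (A : gl4 ℝ))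
        * S ((X : gl4 ℝ) - s • (A : gl4 ℝ)) ≠ 0 := by
      refine (hcont.continuousAt.eventually_ne ?_).filter_mono nhdsWithin_le_nhds
      simpa using hS
    obtain ⟨s, hs, hs0⟩ := (hev.and self_mem_nhdsWithin).exists
    have h1 := (hsq _ (a.add_mem hXa (a.smul_mem s hA)) (left_ne_zero_of_mul hs)).1
    have h2 := (hsq _ (a.sub_mem hXa (a.smul_mem s hA)) (right_ne_zero_of_mul hs)).1
    simp only [Submodule.coe_add, Submodule.coe_sub, Submodule.coe_smul] at h1 h2
    generalize Q ((X : gl4 ℝ) + s • (A : gl4 ℝ)) / 2 = u at h1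
    generalize Q ((X : gl4 ℝ) - s • (A : gl4 ℝ)) / 2 = w at h2
    have hs0' : s ≠ 0 := hs0
    have h3 : (4 * s) • ((X : gl4 ℝ) * A) = (u - w) • 1 := by
      rw [sub_smul, ← h1, ← h2]
      simp only [add_mul, mul_add, sub_mul, mul_sub, smul_mul_assoc, mul_smul_comm, ← ha.comm hXa hA]
      module
    have h4 : c • (A : gl4 ℝ) = ((4 * s)⁻¹ * (u - w)) • (X : gl4 ℝ) := by
      have h5 : (X : gl4 ℝ) * A = ((4 * s)⁻¹ * (u - w)) • 1 := by
        rw [mul_smul, ← h3, smul_smul, inv_mul_cancel₀ (by positivity), one_smul]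
      have h6 := congrArg (fun M => (X : gl4 ℝ) * M) h5
      simp only [← mul_assoc, hX2, smul_mul_assoc, one_mul, mul_smul_comm, mul_one] at h6
      exact h6
    refine ⟨c⁻¹ * ((4 * s)⁻¹ * (u - w)), ?_⟩
    rw [mul_smul, ← h4, smul_smul, inv_mul_cancel₀ hc, one_smul]
  obtain ⟨Y, Z, hYZ⟩ := mem_q_iff.1 X.2
  -- The pair `(KY, ZK)` commutes with `X` and has the same scalar square, but it is not
  -- proportional to `X` because `K` is not scalar.
  let K : Matrix (Fin 2) (Fin 2) ℝ := diagonal ![1, -1]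
  have hK : K * K = 1 := by
    simp only [K, diagonal_mul_diagonal, ← diagonal_one]
    congr 1
    ext i
    fin_cases i <;> simp
  rw [hYZ, fromBlocks_multiply, ← fromBlocks_one, fromBlocks_smul, fromBlocks_inj] at hX2
  simp only [zero_mul, mul_zero, zero_add, add_zero] at hX2
  have hYZc : Y * Z = c • 1 := hX2.1
  have hZYc : Z * Y = c • 1 := hX2.2.2.2
  have hcomm : (fromBlocks 0 (K * Y) (Z * K) 0 : gl4 ℝ) * X
      = X * fromBlocks 0 (K * Y) (Z * K) 0 := by
    rw [hYZ, fromBlocks_multiply, fromBlocks_multiply]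
    simp only [zero_mul, mul_zero, zero_add, add_zero, fromBlocks_inj, true_and]
    rw [mul_assoc K, ← mul_assoc Y, hYZc]
    simp [mul_assoc]
  have hsq' : (fromBlocks 0 (K * Y) (Z * K) 0 : gl4 ℝ) * fromBlocks 0 (K * Y) (Z * K) 0 = c • 1 := by
    have e1 : K * Y * (Z * K) = c • 1 := by
      rw [mul_assoc K, ← mul_assoc Y, hYZc, smul_mul_assoc, one_mul, mul_smul_comm, hK]
    have e2 : Z * K * (K * Y) = c • 1 := by
      rw [mul_assoc Z, ← mul_assoc K, hK, one_mul, hZYc]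
    rw [fromBlocks_multiply, e1, e2, ← fromBlocks_one, fromBlocks_smul]
    simp
  have hmem := ha.mem_of_commute (X := ⟨_, fromBlocks_mem_q (K * Y) (Z * K)⟩)
    (isSS_of_sq hc hsq') (by
      intro A hA
      obtain ⟨r, hr⟩ := hline A hA
      rw [hr, mul_smul_comm, smul_mul_assoc, hcomm])
  obtain ⟨r, hr⟩ := hline _ hmem
  rw [hYZ, fromBlocks_smul, fromBlocks_inj] at hr
  have h1 : K = r • 1 := by
    have := congrArg (fun M => M * Z) hr.2.1
    simp only [mul_assoc, smul_mul_assoc, hYZc, mul_smul_comm, mul_one] at this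
    rw [smul_comm] at this
    exact (smul_right_injective _ hc) this
  have e0 := congrFun (congrFun h1 0) 0
  have e1 := congrFun (congrFun h1 1) 1
  simp [K] at e0 e1
  linarith

end CartanSubspaces

/-! ### The centralizer of a regular element in `𝔮`. -/

section Centralizer

open Matrix

theorem exists_of_commute_fin_two {W M : Matrix (Fin 2) (Fin 2) ℝ} (h : W * M = M * W)
    (hW : W.trace ^ 2 - 4 * W.det ≠ 0) : ∃ p r : ℝ, M = p • 1 + r • W := by
  have e00 := congrFun (congrFun h 0) 0
  have e01 := congrFun (congrFun h 0) 1
  have e10 := congrFun (congrFun h 1) 0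
  simp only [mul_apply, Fin.sum_univ_two] at e00 e01 e10
  rw [trace_fin_two, det_fin_two] at hW
  -- The coefficient `r` is read off at a nonzero off-diagonal entry of `W`; if there is none, the
  -- two diagonal entries differ and determine it.
  by_cases h01 : W 0 1 = 0
  · by_cases h10 : W 1 0 = 0
    · have hd : W 0 0 - W 1 1 ≠ 0 := by
        intro h0
        apply hW
        rw [h01, h10]
        linear_combination (W 0 0 - W 1 1) * h0
      have m01 : M 0 1 = 0 := by
        refine (mul_eq_zero.1 ?_).resolve_left hd
        rw [h01] at e01
        linear_combination e01
      have m10 : M 1 0 = 0 := by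
        refine (mul_eq_zero.1 ?_).resolve_left hd
        rw [h10] at e10
        linear_combination -e10
      refine ⟨M 0 0 - (M 0 0 - M 1 1) / (W 0 0 - W 1 1) * W 0 0,
        (M 0 0 - M 1 1) / (W 0 0 - W 1 1), ?_⟩
      ext i j
      fin_cases i <;> fin_cases j <;> simp [h01, h10, m01, m10]
      field_simp
      ring
    · refine ⟨M 0 0 - M 1 0 / W 1 0 * W 0 0, M 1 0 / W 1 0, ?_⟩
      ext i j
      fin_cases i <;> fin_cases j <;> simp
      · field_simp
        linear_combination -e00
      · field_simp
      · field_simp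
        linear_combination -e10
  · refine ⟨M 0 0 - M 0 1 / W 0 1 * W 0 0, M 0 1 / W 0 1, ?_⟩
    ext i j
    fin_cases i <;> fin_cases j <;> simp
    · field_simp
    · field_simp
      linear_combination e00
    · field_simp
      linear_combination e01

/-- If `B` is the upper block of `A`, then `BY⁻¹` commutes with `YZ`, whose discriminant is `S₀(X) ≠
0`; so it is a polynomial of degree at most one in `YZ`, and this determines both blocks of `A`. -/
theorem exists_of_commute_of_mem_q {X A : gl4 ℝ} (hX : X ∈ q) (hA : A ∈ q) (hS : S X ≠ 0)
    (hS0 : S0 X ≠ 0) (h : X * A = A * X) : ∃ p r : ℝ, A = p • X + r • (X * X * X) := by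
  obtain ⟨Y, Z, rfl⟩ := mem_q_iff.1 hX
  obtain ⟨B, C, rfl⟩ := mem_q_iff.1 hA
  rw [S0, Q_fromBlocks, S_fromBlocks, ← det_mul] at hS0
  rw [S_fromBlocks] at hS
  have hY : IsUnit Y.det := isUnit_iff_ne_zero.2 (left_ne_zero_of_mul hS)
  have hZ : IsUnit Z.det := isUnit_iff_ne_zero.2 (right_ne_zero_of_mul hS)
  simp only [fromBlocks_multiply, zero_mul, mul_zero, zero_add, add_zero, fromBlocks_inj,
    true_and] at h
  obtain ⟨h1, h2⟩ := h
  obtain ⟨p, r, hpr⟩ := exists_of_commute_fin_two (W := Y * Z) (M := B * Y⁻¹) (by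
    calc Y * Z * (B * Y⁻¹) = Y * (Z * B) * Y⁻¹ := by simp only [mul_assoc]
      _ = Y * C * (Y * Y⁻¹) := by rw [h2]; simp only [mul_assoc]
      _ = B * (Y⁻¹ * Y) * Z := by rw [mul_nonsing_inv _ hY, nonsing_inv_mul _ hY, h1]; simp
      _ = B * Y⁻¹ * (Y * Z) := by simp only [mul_assoc]) hS0
  have hB : B = p • Y + r • (Y * Z * Y) := by
    calc B = B * Y⁻¹ * Y := by rw [mul_assoc, nonsing_inv_mul _ hY, mul_one]
      _ = _ := by rw [hpr, add_mul, smul_mul_assoc, smul_mul_assoc, one_mul]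
  have hC : C = p • Z + r • (Z * Y * Z) := by
    calc C = Y⁻¹ * Y * C := by rw [nonsing_inv_mul _ hY, one_mul]
      _ = Y⁻¹ * (B * Z) := by rw [mul_assoc, h1]
      _ = Y⁻¹ * Y * (p • Z + r • (Z * Y * Z)) := by
        rw [hB]
        simp only [mul_add, add_mul, smul_mul_assoc, mul_smul_comm, mul_assoc]
      _ = _ := by rw [nonsing_inv_mul _ hY, one_mul]
  refine ⟨p, r, ?_⟩
  rw [fromBlocks_multiply, fromBlocks_multiply, fromBlocks_smul, fromBlocks_smul, fromBlocks_add]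
  simp [← hB, ← hC]

end Centralizer

/-! ### Simultaneous diagonalization of a Cartan subspace over `ℂ`. -/

section Coordinates

open Matrix

variable {a : Submodule ℝ q}

/-- The pair of forms `t₁, t₂` on `𝔞` such that the eigenvalues of `X` are `±t₁(X), ±t₂(X)`; together
they give a linear isomorphism from `𝔞_ℂ` to `ℂ²`. -/
structure IsCoordPair (t₁ t₂ : a →ₗ[ℝ] ℂ) : Prop where
  omega : ∀ X X' : a, (omegaForm (X : q) (X' : q) : ℂ) = t₁ X * t₁ X' + t₂ X * t₂ X'
  det : ∀ X : a, ((S ((X : q) : gl4 ℝ) : ℝ) : ℂ) = t₁ X ^ 2 * t₂ X ^ 2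
  surj : ∀ c₁ c₂ : ℂ, ∃ h : a × a, t₁ h.1 + Complex.I * t₁ h.2 = c₁ ∧
    t₂ h.1 + Complex.I * t₂ h.2 = c₂
  inj : ∀ X : a, t₁ X = 0 → t₂ X = 0 → X = 0
  finrank : Module.finrank ℝ a = 2

/-- The complexification of an element of `𝔞`. -/
def cplx (X : a) : gl4 ℂ := ((X : q) : gl4 ℝ).map Complex.ofReal

/-- The weights `t₁, t₂, -t₁, -t₂`. -/
def weight (t₁ t₂ : a →ₗ[ℝ] ℂ) : Idx → (a →ₗ[ℝ] ℂ)
  | .inl 0 => t₁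
  | .inl 1 => t₂
  | .inr 0 => -t₁
  | .inr 1 => -t₂

theorem exists_eigenvalues (Y Z : Matrix (Fin 2) (Fin 2) ℝ) (hS : S (fromBlocks 0 Y Z 0 : gl4 ℝ) ≠ 0)
    (hS0 : S0 (fromBlocks 0 Y Z 0) ≠ 0) :
    ∃ l₁ l₂ : ℂ, l₁ ≠ 0 ∧ l₂ ≠ 0 ∧ l₁ ^ 2 ≠ l₂ ^ 2 ∧ ∀ l : ℂ, l ^ 2 = l₁ ^ 2 ∨ l ^ 2 = l₂ ^ 2 →
      (l • (1 : gl4 ℂ) - (fromBlocks 0 Y Z 0 : gl4 ℝ).map Complex.ofReal).det = 0 := by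
  -- The squares of the eigenvalues are the roots `(Q ± s)/2` of `T² - QT + S`, where `s² = S₀`.
  obtain ⟨s, hs⟩ := IsAlgClosed.exists_pow_nat_eq
    ((S0 (fromBlocks 0 Y Z 0) : ℝ) : ℂ) (n := 2) (by norm_num)
  obtain ⟨l₁, h1⟩ := IsAlgClosed.exists_pow_nat_eq
    (((Q (fromBlocks 0 Y Z 0 : gl4 ℝ) : ℝ) + s) / 2 : ℂ) (n := 2) (by norm_num)
  obtain ⟨l₂, h2⟩ := IsAlgClosed.exists_pow_nat_eq
    (((Q (fromBlocks 0 Y Z 0 : gl4 ℝ) : ℝ) - s) / 2 : ℂ) (n := 2) (by norm_num)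
  have hs0 : s ≠ 0 := by
    rintro rfl
    apply hS0
    have : ((S0 (fromBlocks 0 Y Z 0) : ℝ) : ℂ) = 0 := by rw [← hs]; ring
    exact_mod_cast this
  have hprod : l₁ ^ 2 * l₂ ^ 2 = (S (fromBlocks 0 Y Z 0 : gl4 ℝ) : ℝ) := by
    rw [h1, h2]
    rw [S0] at hs
    push_cast at hs
    linear_combination -hs / 4
  have hS' : ((S (fromBlocks 0 Y Z 0 : gl4 ℝ) : ℝ) : ℂ) ≠ 0 := by exact_mod_cast hS
  refine ⟨l₁, l₂, ?_, ?_, ?_, ?_⟩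
  · rintro rfl
    exact hS' (by rw [← hprod]; ring)
  · rintro rfl
    exact hS' (by rw [← hprod]; ring)
  · rw [h1, h2]
    intro h
    exact hs0 (by linear_combination h)
  · intro l hl
    have hmap : (fromBlocks 0 Y Z 0 : gl4 ℝ).map Complex.ofReal
        = fromBlocks 0 (Y.map Complex.ofReal) (Z.map Complex.ofReal) 0 := by
      rw [fromBlocks_map]
      simp
    have hsum : l₁ ^ 2 + l₂ ^ 2 = ((Y * Z).trace : ℝ) := by
      rw [h1, h2, Q_fromBlocks]
      ring
    have htr : (Y.map Complex.ofReal * Z.map Complex.ofReal).trace = ((Y * Z).trace : ℝ) := by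
      simp [trace_fin_two, mul_apply, Fin.sum_univ_two]
    rw [S_fromBlocks] at hprod
    have hdet : (Y.map Complex.ofReal).det * (Z.map Complex.ofReal).det = (Y.det * Z.det : ℝ) := by
      simp [det_fin_two]
    rw [hmap, det_smul_one_sub, htr, hdet, ← hsum, ← hprod]
    rcases hl with h | h
    · linear_combination (l ^ 2 - l₂ ^ 2) * h
    · linear_combination (l ^ 2 - l₁ ^ 2) * h

theorem exists_diagonalizer (X : gl4 ℂ) (m : Idx → ℂ) (hm : Function.Injective m)
    (h : ∀ k, (m k • (1 : gl4 ℂ) - X).det = 0) :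
    ∃ g : gl4 ℂ, IsUnit g.det ∧ X * g = g * diagonal m := by
  have h1 : ∀ k, ∃ v : Idx → ℂ, v ≠ 0 ∧ X *ᵥ v = m k • v := by
    intro k
    obtain ⟨v, hv, hv'⟩ := exists_mulVec_eq_zero_iff.2 (h k)
    refine ⟨v, hv, ?_⟩
    rw [sub_mulVec, smul_mulVec, one_mulVec] at hv'
    exact (sub_eq_zero.1 hv').symm
  choose v hv0 hv using h1
  have hli : LinearIndependent ℂ v :=
    Module.End.eigenvectors_linearIndependent' (toLin' X) m hm v
      (fun k => ⟨Module.End.mem_eigenspace_iff.2 (hv k), hv0 k⟩)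
  refine ⟨(of v)ᵀ, ?_, ?_⟩
  · rw [← isUnit_iff_isUnit_det, ← linearIndependent_cols_iff_isUnit]
    exact hli
  · ext i k
    have := congrFun (hv k) i
    rw [mul_diagonal]
    simpa [mul_apply, mulVec, dotProduct, mul_comm] using this

theorem finrank_eq_two_of_pair {V : Type*} [AddCommGroup V] [Module ℝ V] (x y : V)
    (hind : ∀ p r : ℝ, p • x + r • y = 0 → p = 0 ∧ r = 0)
    (hspan : ∀ v : V, ∃ p r : ℝ, v = p • x + r • y) : Module.finrank ℝ V = 2 := by
  have hli : LinearIndependent ℝ ![x, y] := LinearIndependent.pair_iff.2 hind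
  have hsp : ⊤ ≤ Submodule.span ℝ (Set.range ![x, y]) := by
    intro v _
    obtain ⟨p, r, rfl⟩ := hspan v
    exact add_mem (Submodule.smul_mem _ _ (Submodule.subset_span ⟨0, rfl⟩))
      (Submodule.smul_mem _ _ (Submodule.subset_span ⟨1, rfl⟩))
  simpa using Module.finrank_eq_card_basis (Module.Basis.mk hli hsp)

/-- With `X₀ ∈ 𝔞` regular, `𝔞` is spanned by `X₀` and `X₀³`, so a matrix `g` that diagonalizes `X₀`
over `ℂ` diagonalizes all of `𝔞`. Since the eigenvalues may be complex, all types of Cartan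
subspaces are covered at once. -/
theorem IsCartanSubspace.exists_isCoordPair (ha : IsCartanSubspace a) :
    ∃ t₁ t₂ : a →ₗ[ℝ] ℂ, IsCoordPair t₁ t₂ ∧ ∃ g : gl4 ℂ, IsUnit g.det ∧
      ∀ X : a, cplx X * g = g * diagonal fun k => weight t₁ t₂ k X := by
  obtain ⟨X₀, hX₀, hS, hS0⟩ := ha.exists_regular
  obtain ⟨Y, Z, hYZ⟩ := mem_q_iff.1 X₀.2
  obtain ⟨l₁, l₂, hl₁, hl₂, hl, hdet⟩ := exists_eigenvalues Y Z (hYZ ▸ hS) (hYZ ▸ hS0)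
  rw [← hYZ] at hdet
  let m : Idx → ℂ := Sum.elim ![l₁, l₂] ![-l₁, -l₂]
  have hne : l₁ ≠ l₂ := fun h => hl (by rw [h])
  have hne' : l₁ ≠ -l₂ := fun h => hl (by rw [h, neg_sq])
  have hm : Function.Injective m := by
    intro i j hij
    rcases i with i | i <;> rcases j with j | j <;> fin_cases i <;> fin_cases j <;>
      simp [m, hne, hne.symm, self_eq_neg, neg_eq_self, hl₁, hl₂, neg_eq_iff_eq_neg] at hij ⊢
    · exact hne' hij
    · exact hne' (by rw [hij, neg_neg])
    · exact hne' hij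
    · exact hne' (by rw [hij, neg_neg])
  obtain ⟨g, hg, hXg⟩ := exists_diagonalizer (((X₀ : q) : gl4 ℝ).map Complex.ofReal) m hm (by
    intro k
    apply hdet
    rcases k with k | k <;> fin_cases k <;> simp [m])
  -- the elements `X₀` and `X₀³` of `𝔞`
  have hX₀3 : (⟨(X₀ : gl4 ℝ) * X₀ * X₀, mul_mul_mem_q X₀.2 X₀.2 X₀.2⟩ : q) ∈ a := by
    refine ha.mem_of_commute (((ha.isSS hX₀).mul (ha.isSS hX₀) rfl).mul (ha.isSS hX₀)
      (mul_assoc _ _ _)) ?_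
    intro A hA
    have hc := ha.comm hX₀ hA
    change (X₀ : gl4 ℝ) * X₀ * X₀ * A = A * (X₀ * X₀ * X₀)
    rw [mul_assoc, hc, ← mul_assoc, mul_assoc (X₀ : gl4 ℝ) X₀, hc, ← mul_assoc, ← mul_assoc, hc]
    simp only [mul_assoc]
  let E₁ : a := ⟨X₀, hX₀⟩
  let E₃ : a := ⟨_, hX₀3⟩
  have hspan : ∀ X : a, ∃ p r : ℝ, X = p • E₁ + r • E₃ := by
    intro X
    obtain ⟨p, r, h⟩ := exists_of_commute_of_mem_q X₀.2 (X : q).2 hS hS0 (ha.comm hX₀ X.2)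
    exact ⟨p, r, Subtype.ext (Subtype.ext h)⟩
  -- Diagonal entries of `g⁻¹Xg`, which are linear in `X` by construction.
  let t : Idx → (a →ₗ[ℝ] ℂ) := fun k =>
    { toFun := fun X => (g⁻¹ * cplx X * g) k k
      map_add' := fun X X' => by
        have : cplx (X + X') = cplx X + cplx X' := by
          ext i j
          simp [cplx]
        rw [this, mul_add, add_mul, Matrix.add_apply]
      map_smul' := fun c X => by
        have : cplx (c • X) = (c : ℂ) • cplx X := by
          ext i j
          simp [cplx]
        rw [this, mul_smul_comm, smul_mul_assoc, Matrix.smul_apply]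
        simp }
  have hE₁ : cplx E₁ * g = g * diagonal m := hXg
  have hE₃ : cplx E₃ * g = g * diagonal fun k => m k ^ 3 := by
    have : cplx E₃ = cplx E₁ * cplx E₁ * cplx E₁ := by
      change ((X₀ : gl4 ℝ) * X₀ * X₀).map Complex.ofRealHom = _
      rw [Matrix.map_mul, Matrix.map_mul]
      rfl
    rw [this, mul_assoc, hE₁, mul_assoc, ← mul_assoc (cplx E₁) g, hE₁, mul_assoc,
      diagonal_mul_diagonal, ← mul_assoc, hE₁, mul_assoc, diagonal_mul_diagonal]
    congr 2
    ext k
    ring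
  have hdiag : ∀ (X : a) (w : Idx → ℂ), cplx X * g = g * diagonal w → ∀ k, t k X = w k := by
    intro X w h k
    change (g⁻¹ * cplx X * g) k k = w k
    rw [mul_assoc, h, ← mul_assoc, nonsing_inv_mul _ hg, one_mul, diagonal_apply_eq]
  have ht : ∀ (p r : ℝ), cplx (p • E₁ + r • E₃) * g = g * diagonal fun k => p * m k + r * m k ^ 3 := by
    intro p r
    have : cplx (p • E₁ + r • E₃) = (p : ℂ) • cplx E₁ + (r : ℂ) • cplx E₃ := by
      ext i j
      simp [cplx]
    rw [this, add_mul, smul_mul_assoc, smul_mul_assoc, hE₁, hE₃, ← mul_smul_comm, ← mul_smul_comm,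
      ← mul_add, ← diagonal_smul, ← diagonal_smul, diagonal_add]
    rfl
  have htk : ∀ (p r : ℝ) k, t k (p • E₁ + r • E₃) = p * m k + r * m k ^ 3 := fun p r k =>
    hdiag _ _ (ht p r) k
  have hw : ∀ X : a, cplx X * g
      = g * diagonal fun k => weight (t (.inl 0)) (t (.inl 1)) k X := by
    intro X
    obtain ⟨p, r, rfl⟩ := hspan X
    rw [ht]
    congr 2
    ext k
    rcases k with k | k <;> fin_cases k <;> simp only [weight, Fin.zero_eta, Fin.mk_one, htk,
      LinearMap.neg_apply] <;> simp [m] <;> ring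
  -- The determinant of `(t₁, t₂)` on the basis `X₀, X₀³`.
  have hD : l₁ * l₂ ^ 3 - l₁ ^ 3 * l₂ ≠ 0 := by
    have : l₁ * l₂ ^ 3 - l₁ ^ 3 * l₂ = -(l₁ * l₂ * (l₁ ^ 2 - l₂ ^ 2)) := by ring
    rw [this]
    exact neg_ne_zero.2 (mul_ne_zero (mul_ne_zero hl₁ hl₂) (sub_ne_zero.2 hl))
  have hsolve : ∀ p r : ℂ, p * l₁ + r * l₁ ^ 3 = 0 → p * l₂ + r * l₂ ^ 3 = 0 → p = 0 ∧ r = 0 := by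
    intro p r h1 h2
    constructor
    · refine (mul_eq_zero.1 ?_).resolve_right hD
      linear_combination l₂ ^ 3 * h1 - l₁ ^ 3 * h2
    · refine (mul_eq_zero.1 ?_).resolve_right hD
      linear_combination -l₂ * h1 + l₁ * h2
  have ht1 : ∀ p r : ℝ, t (.inl 0) (p • E₁ + r • E₃) = p * l₁ + r * l₁ ^ 3 := fun p r => htk p r _
  have ht2 : ∀ p r : ℝ, t (.inl 1) (p • E₁ + r • E₃) = p * l₂ + r * l₂ ^ 3 := fun p r => htk p r _
  have hind : ∀ p r : ℝ, t (.inl 0) (p • E₁ + r • E₃) = 0 → t (.inl 1) (p • E₁ + r • E₃) = 0 →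
      p = 0 ∧ r = 0 := by
    intro p r h1 h2
    rw [ht1] at h1
    rw [ht2] at h2
    obtain ⟨hp, hr⟩ := hsolve p r h1 h2
    exact ⟨by exact_mod_cast hp, by exact_mod_cast hr⟩
  refine ⟨t (.inl 0), t (.inl 1), ⟨?_, ?_, ?_, ?_, ?_⟩, g, hg, hw⟩
  · intro X X'
    have h1 : cplx X * cplx X' = g * diagonal (fun k => weight (t (.inl 0)) (t (.inl 1)) k X
        * weight (t (.inl 0)) (t (.inl 1)) k X') * g⁻¹ := by
      rw [← diagonal_mul_diagonal, ← mul_assoc, ← hw X, mul_assoc (cplx X), ← hw X', ← mul_assoc,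
        mul_assoc _ g, mul_nonsing_inv _ hg, mul_one]
    have h2 : ((((X : q) : gl4 ℝ) * (X' : q)).trace : ℂ) = (cplx X * cplx X').trace := by
      simp [trace, cplx, mul_apply]
    rw [omegaForm]
    push_cast
    rw [h2, h1, trace_mul_comm, ← mul_assoc, nonsing_inv_mul _ hg, one_mul, trace_diagonal]
    simp [Fintype.sum_sum_type, Fin.sum_univ_two, weight]
    ring
  · intro X
    have h2 : ((S ((X : q) : gl4 ℝ) : ℝ) : ℂ) = (cplx X).det :=
      RingHom.map_det Complex.ofRealHom ((X : q) : gl4 ℝ)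
    have h3 := congrArg Matrix.det (hw X)
    rw [det_mul, det_mul, mul_comm g.det, det_diagonal] at h3
    rw [h2, hg.mul_right_cancel h3]
    simp [Fintype.prod_sum_type, Fin.prod_univ_two, weight]
    ring
  · intro c₁ c₂
    let D := l₁ * l₂ ^ 3 - l₁ ^ 3 * l₂
    -- Cramer's rule; the real and imaginary parts of the complex coefficients give the two
    -- components of `h`.
    let p : ℂ := (c₁ * l₂ ^ 3 - c₂ * l₁ ^ 3) / D
    let r : ℂ := (c₂ * l₁ - c₁ * l₂) / D
    refine ⟨(p.re • E₁ + r.re • E₃, p.im • E₁ + r.im • E₃), ?_, ?_⟩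
    · have : (p.re + p.im * Complex.I) * l₁ + (r.re + r.im * Complex.I) * l₁ ^ 3 = c₁ := by
        rw [Complex.re_add_im, Complex.re_add_im]
        simp only [p, r, D]
        field_simp
        ring
      rw [ht1, ht1]
      linear_combination this
    · have : (p.re + p.im * Complex.I) * l₂ + (r.re + r.im * Complex.I) * l₂ ^ 3 = c₂ := by
        rw [Complex.re_add_im, Complex.re_add_im]
        simp only [p, r, D]
        field_simp
        ring
      rw [ht2, ht2]
      linear_combination this
  · intro X h1 h2
    obtain ⟨p, r, rfl⟩ := hspan X
    obtain ⟨rfl, rfl⟩ := hind p r h1 h2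
    simp
  · refine finrank_eq_two_of_pair E₁ E₃ (fun p r h => ?_) hspan
    exact hind p r (by rw [h, map_zero]) (by rw [h, map_zero])

end Coordinates

/-! ### Roots, multiplicities and positive systems. -/

section Roots

open Matrix

variable {a : Submodule ℝ q}

theorem IsCoordPair.swap {t₁ t₂ : a →ₗ[ℝ] ℂ} (h : IsCoordPair t₁ t₂) : IsCoordPair t₂ t₁ where
  omega X X' := by rw [h.omega, add_comm]
  det X := by rw [h.det, mul_comm]
  surj c₁ c₂ := by
    obtain ⟨u, h1, h2⟩ := h.surj c₂ c₁
    exact ⟨u, h2, h1⟩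
  inj X h1 h2 := h.inj X h2 h1
  finrank := h.finrank

theorem IsCoordPair.neg_left {t₁ t₂ : a →ₗ[ℝ] ℂ} (h : IsCoordPair t₁ t₂) :
    IsCoordPair (-t₁) t₂ where
  omega X X' := by simp [h.omega]
  det X := by simp [h.det]
  surj c₁ c₂ := by
    obtain ⟨u, h1, h2⟩ := h.surj (-c₁) c₂
    refine ⟨u, ?_, h2⟩
    simp only [LinearMap.neg_apply]
    linear_combination -h1
  inj X h1 h2 := h.inj X (by simpa using h1) h2
  finrank := h.finrank

theorem IsCoordPair.neg_right {t₁ t₂ : a →ₗ[ℝ] ℂ} (h : IsCoordPair t₁ t₂) :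
    IsCoordPair t₁ (-t₂) := h.swap.neg_left.swap

/-- After conjugation by `g`, `ad X` multiplies the entry `(i, j)` by `w_i(X) - w_j(X)`. Only
entries with `w_i - w_j = α` can survive. -/
theorem mem_rootSpace_iff {g : gl4 ℂ} (hg : IsUnit g.det) {w : Idx → (a →ₗ[ℝ] ℂ)}
    (hw : ∀ X : a, cplx X * g = g * diagonal fun k => w k X) (α : a →ₗ[ℝ] ℂ) (Y : gl4 ℂ) :
    Y ∈ rootSpace a α ↔
      ∀ p : Idx × Idx, w p.1 - w p.2 ≠ α → (g⁻¹ * Y * g) p.1 p.2 = 0 := by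
  have h1 : ∀ X : a, (cplx X * Y - Y * cplx X = α X • Y) ↔
      ∀ p : Idx × Idx, (w p.1 X - w p.2 X - α X) * (g⁻¹ * Y * g) p.1 p.2 = 0 := by
    intro X
    have h2 : g⁻¹ * (cplx X * Y - Y * cplx X) * g
        = diagonal (fun k => w k X) * (g⁻¹ * Y * g) - (g⁻¹ * Y * g) * diagonal fun k => w k X := by
      have h3 : g⁻¹ * cplx X = diagonal (fun k => w k X) * g⁻¹ := by
        calc g⁻¹ * cplx X = g⁻¹ * (cplx X * g) * g⁻¹ := by
              rw [mul_assoc, mul_assoc, mul_nonsing_inv _ hg, mul_one]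
          _ = _ := by rw [hw, ← mul_assoc, nonsing_inv_mul _ hg, one_mul]
      calc g⁻¹ * (cplx X * Y - Y * cplx X) * g
          = (g⁻¹ * cplx X) * Y * g - g⁻¹ * Y * (cplx X * g) := by noncomm_ring
        _ = _ := by
          rw [h3, hw]
          noncomm_ring
    have h4 : (cplx X * Y - Y * cplx X = α X • Y) ↔
        g⁻¹ * (cplx X * Y - Y * cplx X) * g = α X • (g⁻¹ * Y * g) := by
      constructor
      · intro h
        rw [h, mul_smul_comm, smul_mul_assoc]
      · intro h
        have := congrArg (fun M => g * M * g⁻¹) h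
        simp only [mul_smul_comm, smul_mul_assoc] at this
        have e : ∀ M : gl4 ℂ, g * (g⁻¹ * M * g) * g⁻¹ = M := by
          intro M
          calc g * (g⁻¹ * M * g) * g⁻¹ = (g * g⁻¹) * M * (g * g⁻¹) := by noncomm_ring
            _ = M := by rw [mul_nonsing_inv _ hg, one_mul, mul_one]
        rwa [e, e] at this
    rw [h4, h2, ← Matrix.ext_iff, Prod.forall]
    refine forall_congr' fun i => forall_congr' fun j => ?_
    rw [Matrix.sub_apply, diagonal_mul, mul_diagonal, Matrix.smul_apply, smul_eq_mul,
      ← sub_eq_zero]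
    ring_nf
  change (∀ X : a, cplx X * Y - Y * cplx X = α X • Y) ↔ _
  simp only [h1]
  constructor
  · intro h p hp
    by_contra hne
    apply hp
    ext X
    have := (mul_eq_zero.1 (h X p)).resolve_right hne
    exact sub_eq_zero.1 this
  · intro h X p
    by_cases hp : w p.1 - w p.2 = α
    · rw [← hp]
      simp
    · rw [h p hp, mul_zero]

theorem finrank_eq_card_of_conj {n : Type*} [Fintype n] [DecidableEq n] {g : Matrix n n ℂ}
    (hg : IsUnit g.det) (r : n × n → Prop) [DecidablePred r] (W : Submodule ℂ (Matrix n n ℂ))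
    (hW : ∀ Y, Y ∈ W ↔ ∀ p : n × n, ¬ r p → (g⁻¹ * Y * g) p.1 p.2 = 0) :
    Module.finrank ℂ W = Nat.card {p // r p} := by
  have hinv : ∀ M : Matrix n n ℂ, g⁻¹ * (g * M * g⁻¹) * g = M := by
    intro M
    calc g⁻¹ * (g * M * g⁻¹) * g = (g⁻¹ * g) * M * (g⁻¹ * g) := by noncomm_ring
      _ = M := by rw [nonsing_inv_mul _ hg, one_mul, mul_one]
  have hinv' : ∀ M : Matrix n n ℂ, g * (g⁻¹ * M * g) * g⁻¹ = M := by
    intro M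
    calc g * (g⁻¹ * M * g) * g⁻¹ = (g * g⁻¹) * M * (g * g⁻¹) := by noncomm_ring
      _ = M := by rw [mul_nonsing_inv _ hg, one_mul, mul_one]
  let e : ({p // r p} → ℂ) →ₗ[ℂ] Matrix n n ℂ :=
    { toFun := fun c => of fun i j => if h : r (i, j) then c ⟨(i, j), h⟩ else 0
      map_add' := fun c c' => by
        ext i j
        by_cases h : r (i, j) <;> simp [h]
      map_smul' := fun c c' => by
        ext i j
        by_cases h : r (i, j) <;> simp [h] }
  let L : ({p // r p} → ℂ) →ₗ[ℂ] Matrix n n ℂ :=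
    LinearMap.mulRight ℂ g⁻¹ ∘ₗ LinearMap.mulLeft ℂ g ∘ₗ e
  have hL : ∀ c, L c = g * e c * g⁻¹ := fun c => rfl
  have hinj : Function.Injective L := by
    intro c c' h
    rw [hL, hL] at h
    have h1 : e c = e c' := by rw [← hinv (e c), h, hinv]
    ext p
    have := congrFun (congrFun h1 p.1.1) p.1.2
    simpa [e, p.2] using this
  have hrange : LinearMap.range L = W := by
    ext Y
    rw [hW, LinearMap.mem_range]
    constructor
    · rintro ⟨c, rfl⟩ p hp
      rw [hL, hinv]
      simp [e, hp]
    · intro h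
      refine ⟨fun p => (g⁻¹ * Y * g) p.1.1 p.1.2, ?_⟩
      rw [hL]
      conv_rhs => rw [← hinv' Y]
      congr 2
      ext i j
      by_cases hp : r (i, j)
      · simp [e, hp]
      · rw [h (i, j) hp]
        simp [e, hp]
  rw [← hrange, LinearMap.finrank_range_of_inj hinj, Module.finrank_pi, Nat.card_eq_fintype_card]

theorem mult_eq_card {g : gl4 ℂ} (hg : IsUnit g.det) {w : Idx → (a →ₗ[ℝ] ℂ)}
    (hw : ∀ X : a, cplx X * g = g * diagonal fun k => w k X) (α : a →ₗ[ℝ] ℂ) :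
    mult a α = Nat.card {p : Idx × Idx // w p.1 - w p.2 = α} := by
  classical
  exact finrank_eq_card_of_conj hg (fun p => w p.1 - w p.2 = α) _ (mem_rootSpace_iff hg hw α)

/-- The form `m t₁ + n t₂`. -/
def intForm (t₁ t₂ : a →ₗ[ℝ] ℂ) (k : ℤ × ℤ) : a →ₗ[ℝ] ℂ := k.1 • t₁ + k.2 • t₂

theorem intForm_apply (t₁ t₂ : a →ₗ[ℝ] ℂ) (k : ℤ × ℤ) (X : a) :
    intForm t₁ t₂ k X = k.1 * t₁ X + k.2 * t₂ X := by
  simp [intForm]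

theorem intForm_sub (t₁ t₂ : a →ₗ[ℝ] ℂ) (k l : ℤ × ℤ) :
    intForm t₁ t₂ k - intForm t₁ t₂ l = intForm t₁ t₂ (k - l) := by
  simp only [intForm, Prod.fst_sub, Prod.snd_sub]
  module

theorem intForm_neg (t₁ t₂ : a →ₗ[ℝ] ℂ) (k : ℤ × ℤ) :
    -intForm t₁ t₂ k = intForm t₁ t₂ (-k) := by
  simp only [intForm, Prod.fst_neg, Prod.snd_neg]
  module

theorem intForm_zero (t₁ t₂ : a →ₗ[ℝ] ℂ) : intForm t₁ t₂ 0 = 0 := by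
  simp [intForm]

/-- Vectors of `𝔞_ℂ` dual to `t₁, t₂` recover the coefficients. Questions on roots thereby become
finite questions in `ℤ × ℤ`, settled by `decide`. -/
theorem IsCoordPair.intForm_injective {t₁ t₂ : a →ₗ[ℝ] ℂ} (h : IsCoordPair t₁ t₂) :
    Function.Injective (intForm t₁ t₂) := by
  have key : ∀ k : ℤ × ℤ, intForm t₁ t₂ k = 0 → k = 0 := by
    intro k hk
    have hk' : ∀ X, (k.1 : ℂ) * t₁ X + k.2 * t₂ X = 0 := fun X => by
      rw [← intForm_apply, hk, LinearMap.zero_apply]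
    obtain ⟨u, h1, h2⟩ := h.surj 1 0
    obtain ⟨v, h3, h4⟩ := h.surj 0 1
    have e1 : (k.1 : ℂ) = 0 := by
      linear_combination hk' u.1 + Complex.I * hk' u.2 - k.1 * h1 - k.2 * h2
    have e2 : (k.2 : ℂ) = 0 := by
      linear_combination hk' v.1 + Complex.I * hk' v.2 - k.1 * h3 - k.2 * h4
    ext
    · exact_mod_cast e1
    · exact_mod_cast e2
  intro k l hkl
  exact sub_eq_zero.1 (key _ (by rw [← intForm_sub, hkl, sub_self]))

/-- The coefficients of the weights. -/
def weightCoeff : Idx → ℤ × ℤ := Sum.elim ![(1, 0), (0, 1)] ![(-1, 0), (0, -1)]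

theorem weight_eq (t₁ t₂ : a →ₗ[ℝ] ℂ) (k : Idx) :
    weight t₁ t₂ k = intForm t₁ t₂ (weightCoeff k) := by
  rcases k with k | k <;> fin_cases k <;> simp [weight, intForm, weightCoeff]

section

variable {t₁ t₂ : a →ₗ[ℝ] ℂ} (h : IsCoordPair t₁ t₂) {g : gl4 ℂ} (hg : IsUnit g.det)
  (hw : ∀ X : a, cplx X * g = g * diagonal fun k => weight t₁ t₂ k X)

include h hg hw

theorem mult_intForm (k : ℤ × ℤ) : mult a (intForm t₁ t₂ k)
    = (Finset.univ.filter fun p : Idx × Idx => weightCoeff p.1 - weightCoeff p.2 = k).card := by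
  classical
  rw [mult_eq_card hg hw, Nat.card_eq_fintype_card, Fintype.card_subtype]
  congr 1
  ext p
  simp only [Finset.mem_filter, Finset.mem_univ, true_and, weight_eq, intForm_sub]
  exact h.intForm_injective.eq_iff

/-- The coefficients of the roots, up to sign. -/
def rootCoeff : Fin 4 → ℤ × ℤ := ![(2, 0), (0, 2), (1, 1), (1, -1)]

theorem isRoot_iff (α : a →ₗ[ℝ] ℂ) : IsRoot a α ↔
    ∃ i, α = intForm t₁ t₂ (rootCoeff i) ∨ α = -intForm t₁ t₂ (rootCoeff i) := by
  have hne : ∀ α : a →ₗ[ℝ] ℂ, rootSpace a α ≠ ⊥ ↔ mult a α ≠ 0 := by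
    intro α
    rw [mult, Ne, Ne, Submodule.finrank_eq_zero]
  rw [IsRoot, hne]
  constructor
  · rintro ⟨h0, h1⟩
    rw [mult_eq_card hg hw] at h1
    obtain ⟨⟨⟨i, j⟩, hp⟩⟩ := (Nat.card_ne_zero.1 h1).1
    simp only [weight_eq, intForm_sub] at hp
    subst hp
    have hk : weightCoeff i - weightCoeff j ≠ 0 := by
      intro hk
      rw [hk, intForm_zero] at h0
      exact h0 rfl
    have : ∀ i j, weightCoeff i - weightCoeff j ≠ 0 →
      ∃ l, weightCoeff i - weightCoeff j = rootCoeff l ∨ weightCoeff i - weightCoeff j = -rootCoeff l := by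
      decide
    obtain ⟨l, hl | hl⟩ := this i j hk
    · exact ⟨l, Or.inl (by rw [hl])⟩
    · exact ⟨l, Or.inr (by rw [hl, intForm_neg])⟩
  · rintro ⟨i, rfl | rfl⟩
    · refine ⟨?_, ?_⟩
      · rw [← intForm_zero t₁ t₂, h.intForm_injective.ne_iff]
        revert i
        decide
      · rw [mult_intForm h hg hw]
        revert i
        decide
    · rw [intForm_neg]
      refine ⟨?_, ?_⟩
      · rw [← intForm_zero t₁ t₂, h.intForm_injective.ne_iff]
        revert i
        decide
      · rw [mult_intForm h hg hw]
        revert i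
        decide

/-- A positive system is obtained by a choice of signs. -/
theorem exists_signs {P : Finset (a →ₗ[ℝ] ℂ)} (hP : IsPositiveSystem a P) :
    ∃ s : Fin 4 → ℤ, (∀ i, s i = 1 ∨ s i = -1) ∧
      ∀ α, α ∈ P ↔ ∃ i, α = intForm t₁ t₂ (s i • rootCoeff i) := by
  have hroot : ∀ i, IsRoot a (intForm t₁ t₂ (rootCoeff i)) := fun i =>
    (isRoot_iff h hg hw _).2 ⟨i, Or.inl rfl⟩
  have h1 : ∀ i, ∃ s : ℤ, (s = 1 ∨ s = -1) ∧ intForm t₁ t₂ (s • rootCoeff i) ∈ P := by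
    intro i
    rcases hP.mem_or_neg_mem _ (hroot i) with hi | hi
    · exact ⟨1, Or.inl rfl, by rwa [one_smul]⟩
    · exact ⟨-1, Or.inr rfl, by rwa [neg_one_smul, ← intForm_neg]⟩
  choose s hs hsP using h1
  refine ⟨s, hs, fun α => ⟨fun hα => ?_, ?_⟩⟩
  · obtain ⟨i, hi⟩ := (isRoot_iff h hg hw α).1 (hP.isRoot α hα)
    refine ⟨i, ?_⟩
    have h2 := hP.neg_notMem _ (hsP i)
    have h3 := hsP i
    -- In the two mixed cases `P` would contain the negative of one of its elements.
    rcases hs i with e | e <;> rcases hi with hi | hi <;> rw [e] at h2 h3 ⊢ <;>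
      simp only [one_smul, neg_one_smul, ← intForm_neg, neg_neg] at h2 h3 ⊢
    · exact hi
    · exact absurd (hi ▸ hα) h2
    · exact absurd (hi ▸ hα) h2
    · exact hi
  · rintro ⟨i, rfl⟩
    exact hsP i

omit h hg hw in
theorem sign_smul_rootCoeff_injective {s : Fin 4 → ℤ} (hs : ∀ i, s i = 1 ∨ s i = -1) :
    Function.Injective fun i => s i • rootCoeff i := by
  have key : ∀ i j : Fin 4, ∀ x ∈ ({1, -1} : Finset ℤ), ∀ y ∈ ({1, -1} : Finset ℤ),
      x • rootCoeff i = y • rootCoeff j → i = j := by decide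
  intro i j hij
  exact key i j _ (by simpa using hs i) _ (by simpa using hs j) hij

/-- `2t₁` is a difference of weights only as `t₁ - (-t₁)`, whereas `t₁ + t₂` is both `t₁ - (-t₂)`
and `t₂ - (-t₁)`; the others are similar. -/
theorem mult_sign_smul {s : Fin 4 → ℤ} (hs : ∀ i, s i = 1 ∨ s i = -1) (i : Fin 4) :
    mult a (intForm t₁ t₂ (s i • rootCoeff i)) = ![1, 1, 2, 2] i := by
  have key : ∀ i : Fin 4, ∀ x ∈ ({1, -1} : Finset ℤ), (Finset.univ.filter fun p : Idx × Idx =>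
      weightCoeff p.1 - weightCoeff p.2 = x • rootCoeff i).card = ![1, 1, 2, 2] i := by decide
  rw [mult_intForm h hg hw]
  exact key i _ (by simpa using hs i)

/-- The exponent is any function of the multiplicity, so that `I` and `I⁻¹` are both covered. -/
theorem prod_rootPow {P : Finset (a →ₗ[ℝ] ℂ)} {s : Fin 4 → ℤ} (hs : ∀ i, s i = 1 ∨ s i = -1)
    (hP : ∀ α, α ∈ P ↔ ∃ i, α = intForm t₁ t₂ (s i • rootCoeff i)) (f : ℕ → ℤ) (X : a) :
    rootPow P (fun α => f (mult a α)) X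
      = ∏ i, (intForm t₁ t₂ (s i • rootCoeff i) X) ^ f (![1, 1, 2, 2] i) := by
  rw [rootPow]
  symm
  refine Finset.prod_nbij (fun i => intForm t₁ t₂ (s i • rootCoeff i)) ?_ ?_ ?_ ?_
  · exact fun i _ => (hP _).2 ⟨i, rfl⟩
  · exact (h.intForm_injective.comp (sign_smul_rootCoeff_injective hs)).injOn
  · intro α hα
    obtain ⟨i, hi⟩ := (hP α).1 hα
    exact ⟨i, Finset.mem_coe.2 (Finset.mem_univ i), hi.symm⟩
  · intro i _
    rw [mult_sign_smul h hg hw hs]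

theorem mem_and_mult_eq_one_iff {P : Finset (a →ₗ[ℝ] ℂ)} {s : Fin 4 → ℤ}
    (hs : ∀ i, s i = 1 ∨ s i = -1)
    (hP : ∀ α, α ∈ P ↔ ∃ i, α = intForm t₁ t₂ (s i • rootCoeff i)) (α : a →ₗ[ℝ] ℂ) :
    α ∈ P ∧ mult a α = 1 ↔
      α = intForm t₁ t₂ (s 0 • rootCoeff 0) ∨ α = intForm t₁ t₂ (s 1 • rootCoeff 1) := by
  constructor
  · rintro ⟨h1, h2⟩
    obtain ⟨i, rfl⟩ := (hP α).1 h1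
    rw [mult_sign_smul h hg hw hs] at h2
    fin_cases i <;> simp at h2 ⊢
  · rintro (rfl | rfl)
    · exact ⟨(hP _).2 ⟨0, rfl⟩, mult_sign_smul h hg hw hs 0⟩
    · exact ⟨(hP _).2 ⟨1, rfl⟩, mult_sign_smul h hg hw hs 1⟩

end

/-- The positive roots of multiplicity one, and the function `I`. -/
theorem IsCartanSubspace.simple_roots (ha : IsCartanSubspace a) {P : Finset (a →ₗ[ℝ] ℂ)}
    (hP : IsPositiveSystem a P) :
    {α | α ∈ P ∧ mult a α = 1}.ncard = 2 ∧
    ∀ α₁ ∈ P, ∀ α₂ ∈ P, mult a α₁ = 1 → mult a α₂ = 1 → α₁ ≠ α₂ →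
      ∃ t₁ t₂ : a →ₗ[ℝ] ℂ, α₁ = (2 : ℂ) • t₁ ∧ α₂ = (2 : ℂ) • t₂ ∧ IsCoordPair t₁ t₂ ∧
        ∃ ε : ℂ, ε ^ 2 = 1 ∧
          (∀ X, rootPow P (fun α => (mult a α : ℤ) - 1) X = ε * (t₁ X ^ 2 - t₂ X ^ 2)) ∧
          (∀ X, rootPow P (fun α => 1 - (mult a α : ℤ)) X = ε * (t₁ X ^ 2 - t₂ X ^ 2)⁻¹) := by
  obtain ⟨t₁, t₂, h, g, hg, hw⟩ := ha.exists_isCoordPair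
  obtain ⟨s, hs, hPs⟩ := exists_signs h hg hw hP
  have hmem := mem_and_mult_eq_one_iff h hg hw hs hPs
  have hs2 : ∀ i, ((s i : ℤ) : ℂ) ^ 2 = 1 := by
    intro i
    rcases hs i with e | e <;> simp [e]
  have hs1 : ∀ i, ((s i : ℤ) : ℂ)⁻¹ = s i := by
    intro i
    rcases hs i with e | e <;> simp [e]
  have hI : ∀ X, rootPow P (fun α => (mult a α : ℤ) - 1) X
      = (s 2 * s 3 : ℂ) * (t₁ X ^ 2 - t₂ X ^ 2) := by
    intro X
    rw [prod_rootPow h hg hw hs hPs (fun n => (n : ℤ) - 1), Fin.prod_univ_four]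
    simp [intForm_apply, rootCoeff]
    ring
  have hI' : ∀ X, rootPow P (fun α => 1 - (mult a α : ℤ)) X
      = (s 2 * s 3 : ℂ) * (t₁ X ^ 2 - t₂ X ^ 2)⁻¹ := by
    intro X
    rw [prod_rootPow h hg hw hs hPs (fun n => 1 - (n : ℤ)), Fin.prod_univ_four]
    have e1 : (s 2 * t₁ X + s 2 * t₂ X : ℂ)⁻¹ = s 2 * (t₁ X + t₂ X)⁻¹ := by
      rw [← mul_add, mul_inv, hs1]
    have e2 : (s 3 * t₁ X + -(s 3 * t₂ X) : ℂ)⁻¹ = s 3 * (t₁ X - t₂ X)⁻¹ := by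
      rw [← sub_eq_add_neg, ← mul_sub, mul_inv, hs1]
    simp [intForm_apply, rootCoeff, e1, e2]
    rw [show t₁ X ^ 2 - t₂ X ^ 2 = (t₁ X + t₂ X) * (t₁ X - t₂ X) by ring, mul_inv]
    ring
  -- Sign changes preserve coordinate pairs, so the halves of the positive simple-multiplicity roots
  -- serve as coordinates whatever the positive system.
  have hpair : IsCoordPair (s 0 • t₁) (s 1 • t₂) := by
    rcases hs 0 with e | e <;> rcases hs 1 with e' | e' <;> rw [e, e'] <;>
      simp only [one_smul, neg_smul]
    exacts [h, h.neg_right, h.neg_left, h.neg_left.neg_right]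
  have hsq : ∀ X, (s 0 • t₁) X ^ 2 = t₁ X ^ 2 ∧ (s 1 • t₂) X ^ 2 = t₂ X ^ 2 := by
    intro X
    simp [mul_pow, hs2]
  have hβ₀ : intForm t₁ t₂ (s 0 • rootCoeff 0) = (2 : ℂ) • (s 0 • t₁) := by
    ext X
    simp [intForm_apply, rootCoeff]
    ring
  have hβ₁ : intForm t₁ t₂ (s 1 • rootCoeff 1) = (2 : ℂ) • (s 1 • t₂) := by
    ext X
    simp [intForm_apply, rootCoeff]
    ring
  have hε : (s 2 * s 3 : ℂ) ^ 2 = 1 := by rw [mul_pow, hs2, hs2, one_mul]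
  constructor
  · have : {α | α ∈ P ∧ mult a α = 1}
        = {intForm t₁ t₂ (s 0 • rootCoeff 0), intForm t₁ t₂ (s 1 • rootCoeff 1)} := by
      ext α
      exact hmem α
    rw [this, Set.ncard_pair]
    intro h01
    exact absurd (sign_smul_rootCoeff_injective hs (h.intForm_injective h01)) (by decide)
  · intro α₁ h1 α₂ h2 hm1 hm2 hne
    rcases (hmem α₁).1 ⟨h1, hm1⟩ with rfl | rfl <;> rcases (hmem α₂).1 ⟨h2, hm2⟩ with rfl | rfl
    · exact absurd rfl hne
    · refine ⟨_, _, hβ₀, hβ₁, hpair, _, hε, fun X => ?_, fun X => ?_⟩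
      · rw [hI, (hsq X).1, (hsq X).2]
      · rw [hI', (hsq X).1, (hsq X).2]
    -- In the other order of the two roots `t₁² - t₂²` changes sign, and `ε` absorbs it.
    · refine ⟨_, _, hβ₁, hβ₀, hpair.swap, -(s 2 * s 3 : ℂ), by rw [neg_sq, hε], fun X => ?_,
        fun X => ?_⟩
      · rw [hI, (hsq X).1, (hsq X).2]
        ring
      · rw [hI', (hsq X).1, (hsq X).2, ← neg_sub (t₁ X ^ 2), inv_neg]
        ring
    · exact absurd rfl hne

end Roots

/-! ### Stability and locality of differential operators. -/

section DifferentialOperators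

open Filter Topology

variable {E : Type*} [NormedAddCommGroup E] [NormedSpace ℝ E] {U : Set E}

theorem IsDiffOp.congr {T T' : (E → ℂ) → (E → ℂ)} (hT : IsDiffOp U T)
    (h : ∀ g : E → ℂ, ContDiffOn ℝ ∞ g U → Set.EqOn (T' g) (T g) U) : IsDiffOp U T' := by
  obtain ⟨N, c, hc, hTc⟩ := hT
  exact ⟨N, c, hc, fun g hg x hx => (h g hg hx).trans (hTc g hg x hx)⟩

theorem IsDiffOp.add {T T' : (E → ℂ) → (E → ℂ)} (hT : IsDiffOp U T) (hT' : IsDiffOp U T') :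
    IsDiffOp U (fun g => T g + T' g) := by
  obtain ⟨N, c, hc, hTc⟩ := hT
  obtain ⟨N', c', hc', hTc'⟩ := hT'
  -- Coefficients beyond the order of each operator are replaced by zero, since nothing is known
  -- about their values there.
  refine ⟨max N N', fun n => (if n < N + 1 then c n else 0) + if n < N' + 1 then c' n else 0,
    fun n => ?_, fun g hg x hx => ?_⟩
  · refine ContDiffOn.add ?_ ?_ <;> split_ifs
    exacts [hc n, contDiffOn_const, hc' n, contDiffOn_const]
  · change T g x + T' g x = _
    rw [hTc g hg x hx, hTc' g hg x hx]
    simp only [Pi.add_apply, add_apply, Finset.sum_add_distrib]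
    have key : ∀ (M K : ℕ) (hMK : M ≤ K) (b : (n : ℕ) → E → ((E [×n]→L[ℝ] ℂ) →L[ℂ] ℂ)),
        ∑ n ∈ Finset.range (M + 1), b n x (iteratedFDeriv ℝ n g x)
          = ∑ n ∈ Finset.range (K + 1),
            (if n < M + 1 then b n else 0) x (iteratedFDeriv ℝ n g x) := by
      intro M K hMK b
      rw [← Finset.sum_subset (Finset.range_mono (Nat.succ_le_succ hMK))]
      · refine Finset.sum_congr rfl fun n hn => ?_
        rw [if_pos (Finset.mem_range.1 hn)]
      · intro n _ hn
        rw [if_neg (fun h => hn (Finset.mem_range.2 h))]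
        rfl
    rw [key N _ (le_max_left _ _) c, key N' _ (le_max_right _ _) c']

theorem IsDiffOp.single (n : ℕ) {c : E → ((E [×n]→L[ℝ] ℂ) →L[ℂ] ℂ)} (hc : ContDiffOn ℝ ∞ c U) :
    IsDiffOp U (fun g x => c x (iteratedFDeriv ℝ n g x)) := by
  classical
  refine ⟨n, fun m => if h : m = n then h ▸ c else 0, fun m => ?_, fun g _ x _ => ?_⟩
  · by_cases h : m = n
    · subst h
      simpa using hc
    · simp only [dif_neg h]
      exact contDiffOn_const
  · rw [Finset.sum_eq_single n]
    · simp
    · intro m _ hm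
      simp only [dif_neg hm]
      rfl
    · simp

theorem IsDiffOp.zero : IsDiffOp U (fun _ => 0 : (E → ℂ) → (E → ℂ)) :=
  ⟨0, fun _ _ => 0, fun _ => contDiffOn_const, fun _ _ _ _ => by simp⟩

theorem IsDiffOp.sum {ι : Type*} (s : Finset ι) {T : ι → (E → ℂ) → (E → ℂ)}
    (hT : ∀ i ∈ s, IsDiffOp U (T i)) : IsDiffOp U (fun g => ∑ i ∈ s, T i g) := by
  classical
  induction s using Finset.induction_on with
  | empty => simpa using IsDiffOp.zero
  | insert i s hi ih =>
    simp only [Finset.sum_insert hi]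
    exact (hT i (Finset.mem_insert_self _ _)).add
      (ih fun j hj => hT j (Finset.mem_insert_of_mem hj))

section Forms

variable {M M' : Type*} [NormedAddCommGroup M] [NormedSpace ℂ M] [NormedAddCommGroup M']
  [NormedSpace ℂ M']

theorem contDiffOn_smul_form {u : E → ℂ} (hu : ContDiffOn ℝ ∞ u U) {c : E → (M →L[ℂ] ℂ)}
    (hc : ContDiffOn ℝ ∞ c U) : ContDiffOn ℝ ∞ (fun x => u x • c x) U := hu.smul hc

/-- The derivative of a family of linear forms along a vector of the complexification. -/
def formDeriv (h : E × E) (c : E → (M →L[ℂ] ℂ)) : E → (M →L[ℂ] ℂ) :=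
  fun x => fderiv ℝ c x h.1 + Complex.I • fderiv ℝ c x h.2

theorem contDiffOn_formDeriv (hU : IsOpen U) (h : E × E) {c : E → (M →L[ℂ] ℂ)}
    (hc : ContDiffOn ℝ ∞ c U) : ContDiffOn ℝ ∞ (formDeriv h c) U := by
  have h1 : ContDiffOn ℝ ∞ (fderiv ℝ c) U := hc.fderiv_of_isOpen hU (by simp)
  have h2 : ContDiffOn ℝ ∞ (fun x => Complex.I • fderiv ℝ c x h.2) U :=
    (h1.clm_apply contDiffOn_const).const_smul Complex.I
  exact (h1.clm_apply contDiffOn_const).add h2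

theorem contDiffOn_form_comp {c : E → (M →L[ℂ] ℂ)} (hc : ContDiffOn ℝ ∞ c U) (k : M' →L[ℂ] M) :
    ContDiffOn ℝ ∞ (fun x => (c x).comp k) U :=
  (((ContinuousLinearMap.compL ℂ M' M ℂ).flip k).restrictScalars ℝ).contDiff.comp_contDiffOn hc

theorem cDeriv_form_apply [NormedSpace ℝ M] [IsScalarTower ℝ ℂ M] (h : E × E) {c : E → (M →L[ℂ] ℂ)} {u : E → M} {x : E}
    (hc : DifferentiableAt ℝ c x) (hu : DifferentiableAt ℝ u x) :
    DifferentiableAt ℝ (fun y => c y (u y)) x ∧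
      cDeriv h (fun y => c y (u y)) x
        = formDeriv h c x (u x) + c x (fderiv ℝ u x h.1 + Complex.I • fderiv ℝ u x h.2) := by
  have hb : IsBoundedBilinearMap ℝ fun p : (M →L[ℂ] ℂ) × M => p.1 p.2 :=
    { add_left := fun _ _ _ => rfl
      smul_left := fun _ _ _ => rfl
      add_right := fun f _ _ => map_add f _ _
      smul_right := fun r f y => f.map_smul_of_tower r y
      bound := ⟨1, one_pos, fun f y => by simpa using f.le_opNorm y⟩ }
  have hder : HasFDerivAt (fun y => c y (u y))
      ((hb.deriv (c x, u x)).comp ((fderiv ℝ c x).prod (fderiv ℝ u x))) x :=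
    HasFDerivAt.comp (g := fun p : (M →L[ℂ] ℂ) × M => p.1 p.2) x (hb.hasFDerivAt (c x, u x))
      (hc.hasFDerivAt.prodMk hu.hasFDerivAt)
  have hf : ∀ v, fderiv ℝ (fun y => c y (u y)) x v
      = c x (fderiv ℝ u x v) + (fderiv ℝ c x v) (u x) := by
    intro v
    rw [hder.fderiv]
    rfl
  refine ⟨hder.differentiableAt, ?_⟩
  rw [cDeriv, hf, hf, map_add, map_smul, formDeriv]
  simp only [add_apply, smul_apply, smul_eq_mul]
  ring

theorem differentiableAt_form (hU : IsOpen U) {c : E → (M →L[ℂ] ℂ)} (hc : ContDiffOn ℝ ∞ c U)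
    {x : E} (hx : x ∈ U) : DifferentiableAt ℝ c x :=
  (hc.contDiffAt (hU.mem_nhds hx)).differentiableAt (by simp)

end Forms

theorem IsDiffOp.mul {T : (E → ℂ) → (E → ℂ)} (hT : IsDiffOp U T) {u : E → ℂ}
    (hu : ContDiffOn ℝ ∞ u U) : IsDiffOp U (mulOp u ∘ T) := by
  obtain ⟨N, c, hc, hTc⟩ := hT
  refine ⟨N, fun n x => u x • c n x, fun n => contDiffOn_smul_form hu (hc n), fun g hg x hx => ?_⟩
  simp only [Function.comp_apply, mulOp, hTc g hg x hx, Finset.mul_sum]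
  rfl

/-- A real continuous linear map that commutes with complex scalars, as a complex one. -/
def clmOfReal {M M' : Type*} [NormedAddCommGroup M] [NormedSpace ℝ M] [NormedSpace ℂ M]
    [NormedAddCommGroup M'] [NormedSpace ℝ M'] [NormedSpace ℂ M'] (f : M →L[ℝ] M')
    (hf : ∀ (c : ℂ) x, f (c • x) = c • f x) : M →L[ℂ] M' where
  toFun := f
  map_add' := map_add f
  map_smul' := hf
  cont := f.cont

/-- Evaluation of `0`-forms. -/
def evalZero (E : Type*) [NormedAddCommGroup E] [NormedSpace ℝ E] : (E [×0]→L[ℝ] ℂ) →L[ℂ] ℂ :=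
  clmOfReal (ContinuousMultilinearMap.apply ℝ (fun _ : Fin 0 => E) ℂ 0) (fun _ _ => rfl)

/-- Insertion of a vector of the complexification in the first variable. -/
def insertVec (n : ℕ) (h : E × E) : (E [×(n + 1)]→L[ℝ] ℂ) →L[ℂ] (E [×n]→L[ℝ] ℂ) :=
  clmOfReal ((ContinuousLinearMap.apply ℝ (E [×n]→L[ℝ] ℂ) h.1).comp
      (continuousMultilinearCurryLeftEquiv ℝ (fun _ : Fin (n + 1) => E) ℂ :
        (E [×(n + 1)]→L[ℝ] ℂ) →L[ℝ] (E →L[ℝ] (E [×n]→L[ℝ] ℂ)))) (fun _ _ => rfl)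
    + Complex.I • clmOfReal ((ContinuousLinearMap.apply ℝ (E [×n]→L[ℝ] ℂ) h.2).comp
      (continuousMultilinearCurryLeftEquiv ℝ (fun _ : Fin (n + 1) => E) ℂ :
        (E [×(n + 1)]→L[ℝ] ℂ) →L[ℝ] (E →L[ℝ] (E [×n]→L[ℝ] ℂ)))) (fun _ _ => rfl)

theorem insertVec_iteratedFDeriv (n : ℕ) (h : E × E) (g : E → ℂ) (x : E) :
    insertVec n h (iteratedFDeriv ℝ (n + 1) g x)
      = fderiv ℝ (iteratedFDeriv ℝ n g) x h.1
        + Complex.I • fderiv ℝ (iteratedFDeriv ℝ n g) x h.2 := by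
  rw [fderiv_iteratedFDeriv]
  rfl

theorem isDiffOp_id : IsDiffOp U (id : (E → ℂ) → (E → ℂ)) :=
  (IsDiffOp.single (c := fun _ => evalZero E) 0 contDiffOn_const).congr fun _ _ _ _ => rfl

theorem cDeriv_congr {h : E × E} {g g' : E → ℂ} {x : E} (hg : g =ᶠ[𝓝 x] g') :
    cDeriv h g x = cDeriv h g' x := by
  simp only [cDeriv, hg.fderiv_eq]

theorem cDeriv_eventuallyEq {h : E × E} {g g' : E → ℂ} {x : E} (hg : g =ᶠ[𝓝 x] g') :
    cDeriv h g =ᶠ[𝓝 x] cDeriv h g' := by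
  filter_upwards [hg.eventuallyEq_nhds] with y hy using cDeriv_congr hy

/-- The product rule: `∂_h` either differentiates the coefficient, at order `n`, or the jet of `g`,
at order `n + 1` with `h` inserted in the new slot. -/
theorem cDeriv_single (hU : IsOpen U) (h : E × E) (n : ℕ)
    {c : E → ((E [×n]→L[ℝ] ℂ) →L[ℂ] ℂ)} (hc : ContDiffOn ℝ ∞ c U) {g : E → ℂ}
    (hg : ContDiffOn ℝ ∞ g U) {x : E} (hx : x ∈ U) :
    DifferentiableAt ℝ (fun y => c y (iteratedFDeriv ℝ n g y)) x ∧
    cDeriv h (fun y => c y (iteratedFDeriv ℝ n g y)) x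
      = formDeriv h c x (iteratedFDeriv ℝ n g x)
        + ((c x).comp (insertVec n h)) (iteratedFDeriv ℝ (n + 1) g x) := by
  have hg' : ContDiffAt ℝ ∞ g x := hg.contDiffAt (hU.mem_nhds hx)
  have hd : DifferentiableAt ℝ (iteratedFDeriv ℝ n g) x := by
    have : ContDiffAt ℝ 1 (iteratedFDeriv ℝ n g) x := hg'.iteratedFDeriv_right (by
      exact_mod_cast (le_top : ((1 + n : ℕ) : ℕ∞) ≤ ⊤))
    exact this.differentiableAt (by simp)
  rw [ContinuousLinearMap.comp_apply, insertVec_iteratedFDeriv]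
  exact cDeriv_form_apply h (differentiableAt_form hU hc hx) hd

theorem IsDiffOp.cDeriv {T : (E → ℂ) → (E → ℂ)} (hU : IsOpen U) (hT : IsDiffOp U T) (h : E × E) :
    IsDiffOp U (SymPair.cDeriv h ∘ T) := by
  obtain ⟨N, c, hc, hTc⟩ := hT
  refine IsDiffOp.congr (IsDiffOp.sum (Finset.range (N + 1)) fun n _ =>
    (IsDiffOp.single n (contDiffOn_formDeriv hU h (hc n))).add
      (IsDiffOp.single (n + 1) (contDiffOn_form_comp (hc n) (insertVec n h))))
    fun g hg x hx => ?_
  have heq : T g =ᶠ[𝓝 x] fun y => ∑ n ∈ Finset.range (N + 1), c n y (iteratedFDeriv ℝ n g y) := by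
    filter_upwards [hU.mem_nhds hx] with y hy using hTc g hg y hy
  rw [Function.comp_apply, cDeriv_congr heq]
  simp only [SymPair.cDeriv]
  rw [fderiv_fun_sum fun n _ => (cDeriv_single hU h n (hc n) hg hx).1]
  simp only [sum_apply, Finset.sum_apply, Finset.mul_sum,
    ← Finset.sum_add_distrib]
  refine Finset.sum_congr rfl fun n _ => ?_
  exact (cDeriv_single hU h n (hc n) hg hx).2

/-- A differential operator is local. -/
theorem IsDiffOp.eq_of_eventuallyEq {T : (E → ℂ) → (E → ℂ)} (hT : IsDiffOp U T) {g g' : E → ℂ}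
    (hg : ContDiffOn ℝ ∞ g U) (hg' : ContDiffOn ℝ ∞ g' U) {x : E} (hx : x ∈ U)
    (h : g =ᶠ[𝓝 x] g') : T g x = T g' x := by
  obtain ⟨N, c, hc, hTc⟩ := hT
  rw [hTc g hg x hx, hTc g' hg' x hx]
  refine Finset.sum_congr rfl fun n _ => ?_
  rw [(h.iteratedFDeriv ℝ n).eq_of_nhds]

/-- Invariant functions agree with functions of `(Q, S)` only near a point. Equality is kept on a
neighbourhood, not just at `x`, so that the induction on `p` can pass through derivatives. -/
theorem constCoeffOp_eventuallyEq {ι : Type*} (v : ι → E) (p : MvPolynomial ι ℂ) {x : E} :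
    ∀ f g : SmoothFun E, f.1 =ᶠ[𝓝 x] g.1 →
      (constCoeffOp v p f).1 =ᶠ[𝓝 x] (constCoeffOp v p g).1 := by
  induction p using MvPolynomial.induction_on with
  | C c =>
    intro f g h
    have : ∀ f : SmoothFun E, (constCoeffOp v (MvPolynomial.C c) f).1 = c • f.1 := by
      intro f
      rw [← MvPolynomial.algebraMap_eq, AlgHom.commutes]
      rfl
    rw [this, this]
    exact h.const_smul c
  | add p r hp hr =>
    intro f g h
    rw [map_add]
    exact (hp f g h).add (hr f g h)
  | mul_X p i hp =>
    intro f g h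
    rw [map_mul, constCoeffOp_X]
    refine hp _ _ ?_
    filter_upwards [h.eventuallyEq_nhds] with y hy
    change fderiv ℝ f.1 y (v i) = fderiv ℝ g.1 y (v i)
    rw [hy.fderiv_eq]

end DifferentialOperators

/-! ### Local diffeomorphisms and smooth factorization. -/

section LocalInverse

open Filter Topology

variable {E F : Type*} [NormedAddCommGroup E] [NormedSpace ℝ E] [FiniteDimensional ℝ E]
  [NormedAddCommGroup F] [NormedSpace ℝ F] [FiniteDimensional ℝ F] {U : Set E} {φ : E → F}

theorem exists_fderiv_equiv (hdim : Module.finrank ℝ E = Module.finrank ℝ F) {x : E}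
    (hφ : ContDiff ℝ ∞ φ) (hinj : Function.Injective (fderiv ℝ φ x)) :
    ∃ e : E ≃L[ℝ] F, HasFDerivAt φ (e : E →L[ℝ] F) x := by
  let e := ((fderiv ℝ φ x : E →ₗ[ℝ] F).linearEquivOfInjective hinj hdim).toContinuousLinearEquiv
  refine ⟨e, ?_⟩
  have : (e : E →L[ℝ] F) = fderiv ℝ φ x := by
    ext v
    rfl
  rw [this]
  exact (hφ.differentiable (by simp) x).hasFDerivAt

theorem map_nhds_of_injective_fderiv (hdim : Module.finrank ℝ E = Module.finrank ℝ F)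
    (hφ : ContDiff ℝ ∞ φ) {x : E} (hinj : Function.Injective (fderiv ℝ φ x)) :
    map φ (𝓝 x) = 𝓝 (φ x) := by
  have : CompleteSpace E := FiniteDimensional.complete ℝ E
  obtain ⟨e, he⟩ := exists_fderiv_equiv hdim hφ hinj
  exact (hφ.contDiffAt.hasStrictFDerivAt' he (by simp)).map_nhds_eq_of_equiv

/-- Where `φ` is a local diffeomorphism, a smooth function is locally the pullback of a smooth
function. -/
theorem exists_contDiff_comp_eq (hdim : Module.finrank ℝ E = Module.finrank ℝ F)
    (hφ : ContDiff ℝ ∞ φ) (hU : IsOpen U)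
    (hinj : ∀ x ∈ U, Function.Injective (fderiv ℝ φ x)) {g : E → ℂ} (hg : ContDiffOn ℝ ∞ g U)
    {x : E} (hx : x ∈ U) :
    ∃ G : F → ℂ, ContDiff ℝ ∞ G ∧ g =ᶠ[𝓝 x] G ∘ φ := by
  have : CompleteSpace E := FiniteDimensional.complete ℝ E
  obtain ⟨e, he⟩ := exists_fderiv_equiv hdim hφ (hinj x hx)
  let Φ := hφ.contDiffAt.toOpenPartialHomeomorph φ he (n := ∞) (by simp)
  have hΦ : ∀ y, Φ y = φ y := fun _ => rfl
  have hxs : x ∈ Φ.source := hφ.contDiffAt.mem_toOpenPartialHomeomorph_source he (by simp)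
  have hxt : φ x ∈ Φ.target := Φ.map_source hxs
  have hsymm : Φ.symm (φ x) = x := Φ.left_inv hxs
  -- On `V` the derivative of `φ` is invertible at the preimages, so the inverse is smooth there and
  -- not only at `φ x`.
  let V := Φ.target ∩ Φ.symm ⁻¹' U
  have hV : IsOpen V := Φ.symm.isOpen_inter_preimage hU
  have hxV : φ x ∈ V := ⟨hxt, by rw [Set.mem_preimage, hsymm]; exact hx⟩
  have hsm : ∀ y ∈ V, ContDiffAt ℝ ∞ (g ∘ Φ.symm) y := by
    intro y hy
    obtain ⟨e', he'⟩ := exists_fderiv_equiv hdim hφ (hinj _ hy.2)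
    exact ContDiffAt.comp y (hg.contDiffAt (hU.mem_nhds hy.2))
      (Φ.contDiffAt_symm hy.1 he' hφ.contDiffAt)
  obtain ⟨r, hr, hrV⟩ := Metric.isOpen_iff.1 hV _ hxV
  -- The cutoff is supported in a ball whose closure lies in `V`, which makes `G` smooth on all of
  -- `F` without changing it near `φ x`.
  let χ : ContDiffBump (φ x) := ⟨r / 4, r / 2, by positivity, by linarith⟩
  refine ⟨fun y => χ y • (g ∘ Φ.symm) y, ?_, ?_⟩
  · refine contDiff_iff_contDiffAt.2 fun y => ?_
    by_cases hy : y ∈ tsupport fun y => χ y • (g ∘ Φ.symm) y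
    swap
    · exact contDiffAt_const.congr_of_eventuallyEq (notMem_tsupport_iff_eventuallyEq.1 hy)
    have hy' : y ∈ Metric.closedBall (φ x) (r / 2) := by
      rw [← χ.tsupport_eq]
      exact closure_mono (Function.support_smul_subset_left _ _) hy
    exact χ.contDiff.contDiffAt.smul
      (hsm y (hrV (Metric.closedBall_subset_ball (by linarith) hy')))
  · have h1 : ∀ᶠ y in 𝓝 x, χ (φ y) = 1 :=
      (hφ.continuous.tendsto x).eventually χ.eventuallyEq_one
    filter_upwards [h1, Φ.open_source.mem_nhds hxs] with y hy hys
    simp only [Function.comp_apply, hy, one_smul]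
    rw [← hΦ, Φ.left_inv hys]

end LocalInverse

/-! ### Conjugacy under `H` of elements with the same regular invariants. -/

section Conjugacy

open Matrix

/-- A matrix with nonzero discriminant has a real cyclic vector `e`, and in the basis `(e, We)` it
is the companion matrix, which depends only on trace and determinant. Conjugacy is thus obtained
over `ℝ` even when the eigenvalues are not real. -/
theorem exists_cyclic_basis {W : Matrix (Fin 2) (Fin 2) ℝ} (hW : W.trace ^ 2 - 4 * W.det ≠ 0) :
    ∃ P : Matrix (Fin 2) (Fin 2) ℝ, IsUnit P.det ∧ W * P = P * !![0, -W.det; 1, W.trace] := by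
  -- The quadratic form is the determinant of `(e, We)` for `e = (x, y)`.
  have key : ∀ x y : ℝ, W 1 0 * x ^ 2 + (W 1 1 - W 0 0) * (x * y) - W 0 1 * y ^ 2 ≠ 0 →
      ∃ P : Matrix (Fin 2) (Fin 2) ℝ, IsUnit P.det ∧ W * P = P * !![0, -W.det; 1, W.trace] := by
    intro x y h
    refine ⟨!![x, W 0 0 * x + W 0 1 * y; y, W 1 0 * x + W 1 1 * y], ?_, ?_⟩
    · rw [isUnit_iff_ne_zero, det_fin_two_of]
      intro h0
      exact h (by linear_combination h0)
    · ext i j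
      fin_cases i <;> fin_cases j <;>
        simp [mul_apply, Fin.sum_univ_two, det_fin_two, trace_fin_two] <;> ring
  by_cases h10 : W 1 0 = 0
  · by_cases h01 : W 0 1 = 0
    · refine key 1 1 fun h => hW ?_
      rw [h10, h01] at h
      rw [trace_fin_two, det_fin_two, h10, h01]
      linear_combination (W 1 1 - W 0 0) * h
    · refine key 0 1 fun h => h01 ?_
      linear_combination -h
  · refine key 1 0 fun h => h10 ?_
    linear_combination h

theorem exists_conj_fin_two {W W' : Matrix (Fin 2) (Fin 2) ℝ} (ht : W.trace = W'.trace)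
    (hd : W.det = W'.det) (hW : W.trace ^ 2 - 4 * W.det ≠ 0) :
    ∃ g : Matrix (Fin 2) (Fin 2) ℝ, IsUnit g.det ∧ g * W = W' * g := by
  obtain ⟨P, hP, hWP⟩ := exists_cyclic_basis hW
  obtain ⟨P', hP', hWP'⟩ := exists_cyclic_basis (W := W') (by rwa [← ht, ← hd])
  rw [← ht, ← hd] at hWP'
  refine ⟨P' * P⁻¹, ?_, ?_⟩
  · rw [det_mul]
    exact hP'.mul (isUnit_nonsing_inv_det P hP)
  · have h1 : P⁻¹ * W = !![0, -W.det; 1, W.trace] * P⁻¹ := by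
      calc P⁻¹ * W = P⁻¹ * (W * P) * P⁻¹ := by
            rw [mul_assoc, mul_assoc, mul_nonsing_inv _ hP, mul_one]
        _ = _ := by rw [hWP, ← mul_assoc, nonsing_inv_mul _ hP, one_mul]
    rw [mul_assoc, h1, ← mul_assoc, ← hWP', mul_assoc]

theorem mem_H_of_fromBlocks (g : GL Idx ℝ) (A B : Matrix (Fin 2) (Fin 2) ℝ)
    (h : (g : gl4 ℝ) = fromBlocks A 0 0 B) : g ∈ H := by
  change J * _ * J = _
  rw [h]
  simp [J, fromBlocks_multiply]

/-- Two elements of `𝔮` with the same regular invariants are conjugate under `H`. -/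
theorem exists_H_conj {X X' : gl4 ℝ} (hX : X ∈ q) (hX' : X' ∈ q) (hQ : Q X = Q X')
    (hS : S X = S X') (hS1 : S X ≠ 0) (hS0 : S0 X ≠ 0) :
    ∃ h ∈ H, X' = (h : gl4 ℝ) * X * ((h⁻¹ : GL Idx ℝ) : gl4 ℝ) := by
  obtain ⟨Y, Z, rfl⟩ := mem_q_iff.1 hX
  obtain ⟨Y', Z', rfl⟩ := mem_q_iff.1 hX'
  rw [S0, Q_fromBlocks, S_fromBlocks, ← det_mul] at hS0
  rw [Q_fromBlocks, Q_fromBlocks] at hQ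
  rw [S_fromBlocks] at hS1
  rw [S_fromBlocks, S_fromBlocks, ← det_mul, ← det_mul] at hS
  have hY : IsUnit Y.det := isUnit_iff_ne_zero.2 (left_ne_zero_of_mul hS1)
  have hY' : IsUnit Y'.det := by
    rw [isUnit_iff_ne_zero]
    rw [← det_mul, hS, det_mul] at hS1
    exact left_ne_zero_of_mul hS1
  obtain ⟨g, hg, hgW⟩ := exists_conj_fin_two hQ hS hS0
  -- The element `(g, k)` of `H` maps `(Y, Z)` to `(gYk⁻¹, kZg⁻¹)`. The first block prescribes `k`,
  -- and the second then agrees because `g` conjugates `YZ` to `Y'Z'`.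
  let k := Y'⁻¹ * g * Y
  have hk1 : Y' * k = g * Y := by
    simp only [k, ← mul_assoc]
    rw [mul_nonsing_inv _ hY', one_mul]
  have hk2 : Z' * g = k * Z := by
    calc Z' * g = Y'⁻¹ * Y' * Z' * g := by rw [nonsing_inv_mul _ hY', one_mul]
      _ = Y'⁻¹ * (Y' * Z' * g) := by simp only [mul_assoc]
      _ = k * Z := by rw [← hgW]; simp only [k, mul_assoc]
  have hkd : IsUnit k.det := by
    simp only [k, det_mul]
    exact ((isUnit_nonsing_inv_det Y' hY').mul hg).mul hY
  have hdet : (fromBlocks g 0 0 k).det ≠ 0 := by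
    rw [det_fromBlocks_zero₂₁]
    exact mul_ne_zero hg.ne_zero hkd.ne_zero
  let h : GL Idx ℝ := GeneralLinearGroup.mkOfDetNeZero _ hdet
  have hh : (h : gl4 ℝ) = fromBlocks g 0 0 k := rfl
  refine ⟨h, mem_H_of_fromBlocks h g k hh, ?_⟩
  have h1 : fromBlocks 0 Y' Z' 0 * (h : gl4 ℝ) = (h : gl4 ℝ) * fromBlocks 0 Y Z 0 := by
    rw [hh, fromBlocks_multiply, fromBlocks_multiply]
    simp [hk1, hk2]
  rw [← h1, mul_assoc, ← Units.val_mul, mul_inv_cancel, Units.val_one, mul_one]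

theorem Q_conj (h : GL Idx ℝ) (X : gl4 ℝ) :
    Q ((h : gl4 ℝ) * X * ((h⁻¹ : GL Idx ℝ) : gl4 ℝ)) = Q X := by
  have h1 : ((h⁻¹ : GL Idx ℝ) : gl4 ℝ) * (h : gl4 ℝ) = 1 := by
    rw [← Units.val_mul, inv_mul_cancel, Units.val_one]
  have h2 : ((h : gl4 ℝ) * X * ((h⁻¹ : GL Idx ℝ) : gl4 ℝ)) ^ 2
      = (h : gl4 ℝ) * (X ^ 2 * ((h⁻¹ : GL Idx ℝ) : gl4 ℝ)) := by
    calc _ = (h : gl4 ℝ) * X * (((h⁻¹ : GL Idx ℝ) : gl4 ℝ) * (h : gl4 ℝ)) * X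
          * ((h⁻¹ : GL Idx ℝ) : gl4 ℝ) := by noncomm_ring
      _ = _ := by
        rw [h1]
        noncomm_ring
  rw [Q, Q, h2, trace_mul_comm, mul_assoc, h1, mul_one]

theorem S_conj (h : GL Idx ℝ) (X : gl4 ℝ) :
    S ((h : gl4 ℝ) * X * ((h⁻¹ : GL Idx ℝ) : gl4 ℝ)) = S X := by
  have h1 : ((h⁻¹ : GL Idx ℝ) : gl4 ℝ) * (h : gl4 ℝ) = 1 := by
    rw [← Units.val_mul, inv_mul_cancel, Units.val_one]
  rw [S, mul_assoc, det_mul_comm, mul_assoc, h1, mul_one, S]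

end Conjugacy

/-! ### The action of `∂(Q)` and `∂(S)` on functions of `(Q, S)`. -/

section Invariants

open Matrix Filter Topology

/-- The coordinates as continuous linear forms. -/
def coordL (k : Coord) : q →L[ℝ] ℝ :=
  LinearMap.toContinuousLinearMap
    { toFun := fun X => coord k X
      map_add' := fun X X' => by rcases k with ⟨i, j⟩ | ⟨i, j⟩ <;> rfl
      map_smul' := fun c X => by rcases k with ⟨i, j⟩ | ⟨i, j⟩ <;> rfl }

theorem coordL_apply (k : Coord) (X : q) : coordL k X = coord k X := rfl

theorem Q_eq_coordL (X : q) : Q (X : gl4 ℝ) =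
    coordL (.inl (0, 0)) X * coordL (.inr (0, 0)) X + coordL (.inl (0, 1)) X * coordL (.inr (1, 0)) X
    + coordL (.inl (1, 0)) X * coordL (.inr (0, 1)) X
    + coordL (.inl (1, 1)) X * coordL (.inr (1, 1)) X := by
  obtain ⟨Y, Z, h⟩ := mem_q_iff.1 X.2
  simp only [coordL_apply, coord, h, Q_fromBlocks]
  simp [trace_fin_two, mul_apply, Fin.sum_univ_two]
  ring

theorem S_eq_coordL (X : q) : S (X : gl4 ℝ) =
    (coordL (.inl (0, 0)) X * coordL (.inl (1, 1)) X
      - coordL (.inl (0, 1)) X * coordL (.inl (1, 0)) X)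
    * (coordL (.inr (0, 0)) X * coordL (.inr (1, 1)) X
      - coordL (.inr (0, 1)) X * coordL (.inr (1, 0)) X) := by
  obtain ⟨Y, Z, h⟩ := mem_q_iff.1 X.2
  simp only [coordL_apply, coord, h, S_fromBlocks]
  simp [det_fin_two]

theorem contDiff_Q : ContDiff ℝ ∞ fun X : q => Q (X : gl4 ℝ) := by
  simp only [Q_eq_coordL]
  fun_prop

theorem contDiff_S : ContDiff ℝ ∞ fun X : q => S (X : gl4 ℝ) := by
  simp only [S_eq_coordL]
  fun_prop

/-- Composition with `(Q, S)` on `𝔮`. -/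
def pullQ : smoothAlg (ℝ × ℝ) →ₐ[ℂ] smoothAlg q := pull _ _ contDiff_Q contDiff_S

/-- The coordinates as elements of the algebra of smooth functions. -/
def coordFun (k : Coord) : smoothAlg q := ofRealFun (coordL k) (coordL k).contDiff

/-- The derivations attached to the coordinates. -/
def coordDer (k : Coord) : Derivation ℂ (smoothAlg q) (smoothAlg q) := dder (dualVec k, 0)

theorem coordDer_coordFun (k l : Coord) :
    coordDer k (coordFun l) = algebraMap ℂ _ (coord l (dualVec k) : ℝ) := by
  have := dder_clm (dualVec k, 0) (Complex.ofRealCLM.comp (coordL l)) (coordFun l) rfl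
  refine this.trans (congrArg _ ?_)
  rw [map_zero, mul_zero, add_zero]
  rfl

theorem pullQ_cFst : pullQ cFst = coordFun (.inl (0, 0)) * coordFun (.inr (0, 0))
    + coordFun (.inl (0, 1)) * coordFun (.inr (1, 0))
    + coordFun (.inl (1, 0)) * coordFun (.inr (0, 1))
    + coordFun (.inl (1, 1)) * coordFun (.inr (1, 1)) := by
  ext X
  change ((Q (X : gl4 ℝ) : ℝ) : ℂ) = _
  rw [Q_eq_coordL]
  push_cast
  rfl

theorem pullQ_cSnd : pullQ cSnd = (coordFun (.inl (0, 0)) * coordFun (.inl (1, 1))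
      - coordFun (.inl (0, 1)) * coordFun (.inl (1, 0)))
    * (coordFun (.inr (0, 0)) * coordFun (.inr (1, 1))
      - coordFun (.inr (0, 1)) * coordFun (.inr (1, 0))) := by
  ext X
  change ((S (X : gl4 ℝ) : ℝ) : ℂ) = _
  rw [S_eq_coordL]
  push_cast
  rfl

theorem Q_genericX : (Q genericX : MvPolynomial Coord ℂ) =
    .X (.inr (0, 0)) * .X (.inl (0, 0)) + .X (.inr (0, 1)) * .X (.inl (1, 0))
    + .X (.inr (1, 0)) * .X (.inl (0, 1)) + .X (.inr (1, 1)) * .X (.inl (1, 1)) := by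
  rw [genericX, Q_fromBlocks]
  simp [trace_fin_two, mul_apply, Fin.sum_univ_two]
  ring

theorem S_genericX : (S genericX : MvPolynomial Coord ℂ) =
    (.X (.inr (0, 0)) * .X (.inr (1, 1)) - .X (.inr (0, 1)) * .X (.inr (1, 0)))
    * (.X (.inl (0, 0)) * .X (.inl (1, 1)) - .X (.inl (0, 1)) * .X (.inl (1, 0))) := by
  rw [genericX, S_fromBlocks]
  simp [det_fin_two]
  ring

/-- A smooth function as an element of the algebra. -/
def toAlg : SmoothFun q ≃ₗ[ℂ] smoothAlg q where
  toFun f := ⟨f.1, f.2⟩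
  map_add' _ _ := rfl
  map_smul' _ _ := rfl
  invFun f := ⟨f.1, f.2⟩
  left_inv _ := rfl
  right_inv _ := rfl

theorem toAlg_partialOp_X (k : Coord) (f : SmoothFun q) :
    toAlg (partialOp (.X k) f) = coordDer k (toAlg f) := by
  rw [partialOp, constCoeffOp_X]
  ext x
  exact (coe_dder_real (dualVec k) (toAlg f) x).symm

/-- The operator on functions of `(Q, S)` induced by `∂(Q)`. -/
def radialQ (F : smoothAlg (ℝ × ℝ)) : smoothAlg (ℝ × ℝ) := laplaceOp dFst dSnd cFst cSnd F

/-- The operator on functions of `(Q, S)` induced by `∂(S)`. -/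
def radialS (F : smoothAlg (ℝ × ℝ)) : smoothAlg (ℝ × ℝ) :=
  codetOp dFst dSnd cFst cSnd (detOp dFst dSnd cFst cSnd F)

theorem coordDer_pullQ (k : Coord) (F : smoothAlg (ℝ × ℝ)) : coordDer k (pullQ F)
    = coordDer k (pullQ cFst) * pullQ (dFst F) + coordDer k (pullQ cSnd) * pullQ (dSnd F) :=
  dder_pull _ _ _ _ _ F

theorem coordDer_inr_inl (i j k l : Fin 2) :
    coordDer (.inr (i, j)) (coordFun (.inl (k, l))) = if i = l ∧ j = k then 2 else 0 := by
  rw [coordDer_coordFun]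
  simp only [dualVec, coord, fromBlocks_apply₁₂, single_apply]
  split_ifs with h1 h2 h2
  · rw [Complex.ofReal_ofNat, map_ofNat]
  · exact absurd ⟨h1.2, h1.1⟩ h2
  · exact absurd ⟨h2.2, h2.1⟩ h1
  · simp

theorem coordDer_inl_inr (i j k l : Fin 2) :
    coordDer (.inl (i, j)) (coordFun (.inr (k, l))) = if i = l ∧ j = k then 2 else 0 := by
  rw [coordDer_coordFun]
  simp only [dualVec, coord, fromBlocks_apply₂₁, single_apply]
  split_ifs with h1 h2 h2
  · rw [Complex.ofReal_ofNat, map_ofNat]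
  · exact absurd ⟨h1.2, h1.1⟩ h2
  · exact absurd ⟨h2.2, h2.1⟩ h1
  · simp

theorem coordDer_inr_inr (i j k l : Fin 2) :
    coordDer (.inr (i, j)) (coordFun (.inr (k, l))) = 0 := by
  rw [coordDer_coordFun]
  simp [dualVec, coord]

theorem coordDer_inl_inl (i j k l : Fin 2) :
    coordDer (.inl (i, j)) (coordFun (.inl (k, l))) = 0 := by
  rw [coordDer_coordFun]
  simp [dualVec, coord]

theorem partialOp_Q_pullQ (F : smoothAlg (ℝ × ℝ)) :
    toAlg (partialOp (Q genericX) (toAlg.symm (pullQ F))) = 4 * pullQ (radialQ F) := by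
  -- The form `ω` pairs the two blocks, so the derivation attached to a coordinate of `Z`
  -- differentiates in `Y`, and conversely.
  have := laplace_pull (y := fun i j => coordFun (.inl (i, j)))
    (z := fun i j => coordFun (.inr (i, j))) (dy := fun i j => coordDer (.inr (i, j)))
    (dz := fun i j => coordDer (.inl (i, j))) (φ := pullQ) coordDer_inr_inl coordDer_inl_inr
    coordDer_inr_inr coordDer_inl_inl pullQ_cFst pullQ_cSnd (fun _ _ => coordDer_pullQ _)
    (fun _ _ => coordDer_pullQ _) dSnd_dFst F
  rw [radialQ, ← this, Q_genericX]
  simp only [map_add, map_mul, LinearMap.add_apply, Module.End.mul_apply, toAlg_partialOp_X,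
    LinearEquiv.apply_symm_apply]

theorem partialOp_S_pullQ (F : smoothAlg (ℝ × ℝ)) :
    toAlg (partialOp (S genericX) (toAlg.symm (pullQ F))) = 16 * pullQ (radialS F) := by
  have h1 := det_dz_pull (y := fun i j => coordFun (.inl (i, j)))
    (z := fun i j => coordFun (.inr (i, j))) (dz := fun i j => coordDer (.inl (i, j)))
    (φ := pullQ) coordDer_inl_inr coordDer_inl_inl pullQ_cFst pullQ_cSnd
    (fun _ _ => coordDer_pullQ _) dSnd_dFst F
  have h2 := det_dy_pull (y := fun i j => coordFun (.inl (i, j)))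
    (z := fun i j => coordFun (.inr (i, j))) (dy := fun i j => coordDer (.inr (i, j)))
    (φ := pullQ) coordDer_inr_inl coordDer_inr_inr pullQ_cFst pullQ_cSnd
    (fun _ _ => coordDer_pullQ _) dSnd_dFst (detOp dFst dSnd cFst cSnd F)
  have h4 : ∀ (D : Derivation ℂ (smoothAlg q) (smoothAlg q)) (f : smoothAlg q),
      D (4 * f) = 4 * D f := by
    intro D f
    rw [D.leibniz, derivation_ofNat, smul_zero, add_zero, smul_eq_mul]
  rw [radialS, S_genericX]
  simp only [map_sub, map_mul, LinearMap.sub_apply, Module.End.mul_apply, toAlg_partialOp_X,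
    LinearEquiv.apply_symm_apply]
  beta_reduce at h1 h2
  rw [sub_eq_iff_eq_add.1 h1]
  simp only [map_add, h4]
  linear_combination 4 * h2

end Invariants

/-! ### The regular set of `𝔞` and the map `(Q, S)` on it. -/

section RegularSet

open Filter Topology Matrix

variable {a : Submodule ℝ q} {t₁ t₂ : a →ₗ[ℝ] ℂ}

theorem omegaForm_self (X : gl4 ℝ) : omegaForm X X = Q X := by
  rw [omegaForm, Q, sq, smul_eq_mul]

theorem IsCoordPair.Q_eq (h : IsCoordPair t₁ t₂) (X : a) :
    ((Q ((X : q) : gl4 ℝ) : ℝ) : ℂ) = t₁ X ^ 2 + t₂ X ^ 2 := by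
  rw [← omegaForm_self, h.omega]
  ring

theorem IsCoordPair.S0_eq (h : IsCoordPair t₁ t₂) (X : a) :
    ((S0 ((X : q) : gl4 ℝ) : ℝ) : ℂ) = (t₁ X ^ 2 - t₂ X ^ 2) ^ 2 := by
  rw [S0]
  push_cast
  rw [h.Q_eq, h.det]
  ring

theorem IsCoordPair.charpoly_eq (h : IsCoordPair t₁ t₂) (X : a) :
    (((X : q) : gl4 ℝ).map Complex.ofReal).charpoly
      = (({t₁ X, -t₁ X, t₂ X, -t₂ X} : Multiset ℂ).map fun c => .X - .C c).prod := by
  obtain ⟨Y, Z, hX⟩ := mem_q_iff.1 (X : q).2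
  have hQ := h.Q_eq X
  have hS := h.det X
  rw [hX, Q_fromBlocks] at hQ
  rw [hX, S_fromBlocks] at hS
  rw [hX, charpoly, charmatrix]
  have h1 : scalar Idx (Polynomial.X : Polynomial ℂ)
      - Polynomial.C.mapMatrix ((fromBlocks 0 Y Z 0 : gl4 ℝ).map Complex.ofReal)
      = (Polynomial.X : Polynomial ℂ) • (1 : gl4 (Polynomial ℂ))
        - fromBlocks 0 ((Y.map Complex.ofReal).map Polynomial.C)
          ((Z.map Complex.ofReal).map Polynomial.C) 0 := by
    congr 1
    · rw [scalar_apply, smul_one_eq_diagonal]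
    · rw [RingHom.mapMatrix_apply, fromBlocks_map, fromBlocks_map]
      simp
  rw [h1, det_smul_one_sub]
  have h2 : (((Y.map Complex.ofReal).map Polynomial.C)
      * ((Z.map Complex.ofReal).map Polynomial.C)).trace
      = Polynomial.C (t₁ X) ^ 2 + Polynomial.C (t₂ X) ^ 2 := by
    rw [← Polynomial.C_pow, ← Polynomial.C_pow, ← Polynomial.C_add, ← hQ]
    simp [trace_fin_two, mul_apply, Fin.sum_univ_two]
  have h3 : ((Y.map Complex.ofReal).map Polynomial.C).det
      * ((Z.map Complex.ofReal).map Polynomial.C).det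
      = Polynomial.C (t₁ X) ^ 2 * Polynomial.C (t₂ X) ^ 2 := by
    rw [← Polynomial.C_pow, ← Polynomial.C_pow, ← Polynomial.C_mul, ← hS]
    simp [det_fin_two]
  rw [h2, h3]
  simp only [Multiset.insert_eq_cons, Multiset.map_cons, Multiset.map_singleton,
    Multiset.prod_cons, Multiset.prod_singleton, Polynomial.C_neg]
  ring

/-- Semisimplicity is automatic on `𝔞`; what remains is that `±t₁(X), ±t₂(X)` are distinct. -/
theorem IsCoordPair.mem_aReg_iff (h : IsCoordPair t₁ t₂) (ha : IsCartanSubspace a) (X : a) :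
    X ∈ aReg a ↔ t₁ X ≠ 0 ∧ t₂ X ≠ 0 ∧ t₁ X ^ 2 ≠ t₂ X ^ 2 := by
  have h1 : X ∈ aReg a ↔ IsSS ((X : q) : gl4 ℝ) ∧
      (((X : q) : gl4 ℝ).map Complex.ofReal).charpoly.roots.Nodup := Iff.rfl
  have h2 : IsSS ((X : q) : gl4 ℝ) := ha.isSS X.2
  rw [h1, h.charpoly_eq, Polynomial.roots_multiset_prod_X_sub_C, and_iff_right h2]
  simp only [Multiset.insert_eq_cons, Multiset.nodup_cons, Multiset.mem_cons,
    Multiset.mem_singleton, Multiset.nodup_singleton, and_true, not_or, self_eq_neg, sq_eq_sq_iff_eq_or_eq_neg,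
    neg_inj, ne_eq]
  constructor
  · tauto
  · rintro ⟨h3, h4, h5, h6⟩
    refine ⟨⟨h3, h5, h6⟩, ⟨fun h => h6 ?_, fun h => h5 ?_⟩, h4⟩
    · rw [← h, neg_neg]
    · exact h

theorem IsCoordPair.S_ne_zero (h : IsCoordPair t₁ t₂) (ha : IsCartanSubspace a) {X : a}
    (hX : X ∈ aReg a) : S ((X : q) : gl4 ℝ) ≠ 0 := by
  obtain ⟨h1, h2, -⟩ := (h.mem_aReg_iff ha X).1 hX
  have : ((S ((X : q) : gl4 ℝ) : ℝ) : ℂ) ≠ 0 := by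
    rw [h.det]
    exact mul_ne_zero (pow_ne_zero 2 h1) (pow_ne_zero 2 h2)
  exact_mod_cast this

theorem IsCoordPair.S0_ne_zero (h : IsCoordPair t₁ t₂) (ha : IsCartanSubspace a) {X : a}
    (hX : X ∈ aReg a) : S0 ((X : q) : gl4 ℝ) ≠ 0 := by
  obtain ⟨-, -, h3⟩ := (h.mem_aReg_iff ha X).1 hX
  have : ((S0 ((X : q) : gl4 ℝ) : ℝ) : ℂ) ≠ 0 := by
    rw [h.S0_eq]
    exact pow_ne_zero 2 (sub_ne_zero.2 h3)
  exact_mod_cast this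

/-- A linear form on `𝔞` as a continuous linear form. -/
def linClm (t : a →ₗ[ℝ] ℂ) : a →L[ℝ] ℂ :=
  LinearMap.toContinuousLinearMap (𝕜 := ℝ) (E := a) (F' := ℂ) t

theorem linFun_contDiff (t : a →ₗ[ℝ] ℂ) : ContDiff ℝ ∞ t :=
  ContinuousLinearMap.contDiff (𝕜 := ℝ) (E := a) (F := ℂ) (linClm t)

/-- A linear form on `𝔞` as an element of the algebra of smooth functions. -/
def linFun (t : a →ₗ[ℝ] ℂ) : smoothAlg a := ⟨t, linFun_contDiff t⟩

theorem dder_linFun (h : a × a) (t : a →ₗ[ℝ] ℂ) :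
    dder h (linFun t) = algebraMap ℂ _ (t h.1 + Complex.I * t h.2) :=
  dder_clm h (linClm t) _ rfl

theorem IsCoordPair.isOpen_aReg (h : IsCoordPair t₁ t₂) (ha : IsCartanSubspace a) :
    IsOpen (aReg a) := by
  have h1 := (linFun_contDiff t₁).continuous
  have h2 := (linFun_contDiff t₂).continuous
  have : aReg a = {X | t₁ X ≠ 0} ∩ ({X | t₂ X ≠ 0} ∩ {X | t₁ X ^ 2 ≠ t₂ X ^ 2}) :=
    Set.ext (h.mem_aReg_iff ha)
  rw [this]
  exact (isOpen_ne_fun h1 continuous_const).inter ((isOpen_ne_fun h2 continuous_const).inter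
    (isOpen_ne_fun (h1.pow 2) (h2.pow 2)))

/-- The map `(Q, S)` on `𝔮`. -/
def invMap (X : q) : ℝ × ℝ := (Q (X : gl4 ℝ), S (X : gl4 ℝ))

theorem contDiff_invMap : ContDiff ℝ ∞ invMap := contDiff_Q.prodMk contDiff_S

theorem contDiff_subtype (a : Submodule ℝ q) : ContDiff ℝ ∞ (fun X : a => (X : q)) :=
  ContinuousLinearMap.contDiff (𝕜 := ℝ) (E := a) (F := q) a.subtypeL

theorem contDiff_Q_sub (a : Submodule ℝ q) : ContDiff ℝ ∞ fun X : a => Q ((X : q) : gl4 ℝ) :=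
  contDiff_Q.comp (contDiff_subtype a)

theorem contDiff_S_sub (a : Submodule ℝ q) : ContDiff ℝ ∞ fun X : a => S ((X : q) : gl4 ℝ) :=
  contDiff_S.comp (contDiff_subtype a)

theorem contDiff_invMap_sub (a : Submodule ℝ q) : ContDiff ℝ ∞ fun X : a => invMap (X : q) :=
  contDiff_invMap.comp (contDiff_subtype a)

/-- Composition with `(Q, S)` on `𝔞`. -/
def pullA (a : Submodule ℝ q) : smoothAlg (ℝ × ℝ) →ₐ[ℂ] smoothAlg a :=
  pull _ _ (contDiff_Q_sub a) (contDiff_S_sub a)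

theorem pullA_cFst (h : IsCoordPair t₁ t₂) :
    pullA a cFst = linFun t₁ ^ 2 + linFun t₂ ^ 2 := by
  ext X
  exact h.Q_eq X

theorem pullA_cSnd (h : IsCoordPair t₁ t₂) :
    pullA a cSnd = linFun t₁ ^ 2 * linFun t₂ ^ 2 := by
  ext X
  exact h.det X

/-- The Jacobian of `(t₁² + t₂², t₁²t₂²)` in `(t₁, t₂)` is `4t₁t₂(t₁² - t₂²)`, nonzero at regular
points. -/
theorem IsCoordPair.injective_fderiv (h : IsCoordPair t₁ t₂) (ha : IsCartanSubspace a) {X : a}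
    (hX : X ∈ aReg a) :
    Function.Injective (fderiv ℝ (fun X : a => invMap (X : q)) X) := by
  obtain ⟨h1, h2, h3⟩ := (h.mem_aReg_iff ha X).1 hX
  rw [injective_iff_map_eq_zero]
  intro v hv
  have hQ := (contDiff_Q_sub a).differentiable (by simp) X
  have hS := (contDiff_S_sub a).differentiable (by simp) X
  have hd : fderiv ℝ (fun X : a => invMap (X : q)) X
      = (fderiv ℝ (fun X : a => Q ((X : q) : gl4 ℝ)) X).prod
        (fderiv ℝ (fun X : a => S ((X : q) : gl4 ℝ)) X) :=
    (hQ.hasFDerivAt.prodMk hS.hasFDerivAt).fderiv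
  rw [hd] at hv
  have hvQ : fderiv ℝ (fun X : a => Q ((X : q) : gl4 ℝ)) X v = 0 := congrArg Prod.fst hv
  have hvS : fderiv ℝ (fun X : a => S ((X : q) : gl4 ℝ)) X v = 0 := congrArg Prod.snd hv
  have e : ∀ t : a →ₗ[ℝ] ℂ, dder (v, 0) (linFun t) = algebraMap ℂ _ (t v) := by
    intro t
    rw [dder_linFun, map_zero, mul_zero, add_zero]
  have eQ : (dder (v, 0) (pullA a cFst)).1 X = 0 := by
    rw [coe_dder_real]
    exact (fderiv_ofReal_comp hQ v).trans (congrArg Complex.ofReal hvQ)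
  have eS : (dder (v, 0) (pullA a cSnd)).1 X = 0 := by
    rw [coe_dder_real]
    exact (fderiv_ofReal_comp hS v).trans (congrArg Complex.ofReal hvS)
  rw [pullA_cFst h, map_add, Derivation.leibniz_pow, Derivation.leibniz_pow, e, e] at eQ
  rw [pullA_cSnd h, Derivation.leibniz, Derivation.leibniz_pow, Derivation.leibniz_pow, e, e] at eS
  have two : ((2 : smoothAlg a) : a → ℂ) X = 2 := rfl
  have eQ' : 2 * (t₁ X * t₁ v) + 2 * (t₂ X * t₂ v) = 0 := by
    simp [linFun, Algebra.algebraMap_eq_smul_one, two] at eQ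
    linear_combination eQ
  have eS' : t₁ X ^ 2 * (2 * (t₂ X * t₂ v)) + t₂ X ^ 2 * (2 * (t₁ X * t₁ v)) = 0 := by
    simp [linFun, Algebra.algebraMap_eq_smul_one, two] at eS
    linear_combination eS
  have h3' := sub_ne_zero.2 h3
  refine h.inj v ?_ ?_
  · have : (t₁ X ^ 2 - t₂ X ^ 2) * t₁ X * t₁ v = 0 := by
      linear_combination t₁ X ^ 2 / 2 * eQ' - eS' / 2
    simpa [h1, h3'] using this
  · have : (t₁ X ^ 2 - t₂ X ^ 2) * t₂ X * t₂ v = 0 := by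
      linear_combination eS' / 2 - t₂ X ^ 2 / 2 * eQ'
    simpa [h2, h3'] using this

theorem IsCoordPair.finrank_eq (h : IsCoordPair t₁ t₂) :
    Module.finrank ℝ a = Module.finrank ℝ (ℝ × ℝ) := by
  rw [h.finrank]
  simp

end RegularSet

/-! ### Radial parts on `𝔞^reg`. -/

section RadialOperators

open Filter Topology

variable {a : Submodule ℝ q} {t₁ t₂ : a →ₗ[ℝ] ℂ}

/-- As `ω = t₁t₁' + t₂t₂'`, the coordinates of `h_α` are the coefficients of `α`. In particular the
choice made in `hvec` does not matter. -/
theorem IsCoordPair.hvec_spec (h : IsCoordPair t₁ t₂) {α : a →ₗ[ℝ] ℂ} {c₁ c₂ : ℂ}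
    (hα : ∀ X, α X = c₁ * t₁ X + c₂ * t₂ X) :
    t₁ (hvec α).1 + Complex.I * t₁ (hvec α).2 = c₁ ∧
      t₂ (hvec α).1 + Complex.I * t₂ (hvec α).2 = c₂ := by
  have hrep : ∃ k : a × a, Represents k α := by
    obtain ⟨k, hk1, hk2⟩ := h.surj c₁ c₂
    refine ⟨k, fun X => ?_⟩
    rw [h.omega, h.omega, hα, ← hk1, ← hk2]
    ring
  have hspec : Represents (hvec α) α := by
    rw [hvec, dif_pos hrep]
    exact hrep.choose_spec
  have key : ∀ X, (t₁ (hvec α).1 + Complex.I * t₁ (hvec α).2 - c₁) * t₁ X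
      + (t₂ (hvec α).1 + Complex.I * t₂ (hvec α).2 - c₂) * t₂ X = 0 := by
    intro X
    have := hspec X
    rw [h.omega, h.omega, hα] at this
    linear_combination this
  constructor
  · obtain ⟨k, hk1, hk2⟩ := h.surj 1 0
    linear_combination key k.1 + Complex.I * key k.2
      - (t₁ (hvec α).1 + Complex.I * t₁ (hvec α).2 - c₁) * hk1
      - (t₂ (hvec α).1 + Complex.I * t₂ (hvec α).2 - c₂) * hk2
  · obtain ⟨k, hk1, hk2⟩ := h.surj 0 1
    linear_combination key k.1 + Complex.I * key k.2
      - (t₁ (hvec α).1 + Complex.I * t₁ (hvec α).2 - c₁) * hk1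
      - (t₂ (hvec α).1 + Complex.I * t₂ (hvec α).2 - c₂) * hk2

theorem L_eventuallyEq {α : a →ₗ[ℝ] ℂ} {g g' : a → ℂ} {x : a} (hg : g =ᶠ[𝓝 x] g') :
    L α g =ᶠ[𝓝 x] L α g' := by
  have h0 : cDeriv (hvec α) g =ᶠ[𝓝 x] cDeriv (hvec α) g' := cDeriv_eventuallyEq hg
  have h1 : mulOp (fun X => α X) (cDeriv (hvec α) g)
      =ᶠ[𝓝 x] mulOp (fun X => α X) (cDeriv (hvec α) g') := by
    filter_upwards [h0] with y hy
    simp only [mulOp, hy]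
  have h2 : cDeriv (hvec α) (mulOp (fun X => α X) (cDeriv (hvec α) g))
      =ᶠ[𝓝 x] cDeriv (hvec α) (mulOp (fun X => α X) (cDeriv (hvec α) g')) :=
    cDeriv_eventuallyEq h1
  filter_upwards [h2] with y hy
  simp only [L, Function.comp_apply]
  rw [mulOp, hy]
  rfl

theorem dder_smul (k : a × a) (c : ℂ) (f : smoothAlg a) : dder k (c • f) = c • dder k f :=
  (dder k).toLinearMap.map_smul c f

/-- For `α = 2t` the operator `L_α` is `(1/4t) ∂_{h_α} ∘ t ∂_{h_α}`. The division by `t`, which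
leaves the algebra of smooth functions, is performed only here. -/
theorem L_eventuallyEq_of_dder {t : a →ₗ[ℝ] ℂ} {G K : smoothAlg a}
    (hGK : dder (hvec ((2 : ℂ) • t)) (linFun t * dder (hvec ((2 : ℂ) • t)) G) = linFun t * K)
    (c : ℂ) {x : a} (hx : t x ≠ 0) : L ((2 : ℂ) • t) (c • G).1 =ᶠ[𝓝 x] ((c / 4) • K).1 := by
  have h1 : mulOp (fun X => ((2 : ℂ) • t) X) (cDeriv (hvec ((2 : ℂ) • t)) (c • G).1)
      = ((2 * c) • (linFun t * dder (hvec ((2 : ℂ) • t)) G)).1 := by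
    rw [← coe_dder, dder_smul]
    ext X
    change 2 * t X * (c * (dder _ G).1 X) = 2 * c * (t X * (dder _ G).1 X)
    ring
  filter_upwards [(linFun_contDiff t).continuous.continuousAt.eventually_ne hx] with y hy
  simp only [L, Function.comp_apply]
  rw [h1, ← coe_dder, dder_smul, hGK]
  change 1 / (4 * (2 * t y)) * (2 * c * (t y * K.1 y)) = c / 4 * K.1 y
  field_simp

theorem IsDiffOp.comp_L {α : a →ₗ[ℝ] ℂ} {T : (a → ℂ) → (a → ℂ)} (hU : IsOpen (aReg a))
    (hT : IsDiffOp (aReg a) T) (hα : ∀ X ∈ aReg a, α X ≠ 0) : IsDiffOp (aReg a) (L α ∘ T) := by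
  have h1 : ContDiffOn ℝ ∞ (fun X : a => α X) (aReg a) := (linFun_contDiff α).contDiffOn
  have h4 : ∀ X ∈ aReg a, (4 : ℂ) * α X ≠ 0 := fun X hX => mul_ne_zero (by norm_num) (hα X hX)
  have h2 : ContDiffOn ℝ ∞ (fun X : a => 1 / (4 * α X)) (aReg a) := by
    simp only [one_div]
    exact ContDiffOn.inv (contDiffOn_const.mul h1) h4
  exact (((hT.cDeriv hU _).mul h1).cDeriv hU _).mul h2

/-- The function `t₁² - t₂²`. -/
def discFun (t₁ t₂ : a →ₗ[ℝ] ℂ) : smoothAlg a := linFun t₁ ^ 2 - linFun t₂ ^ 2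

theorem discFun_apply (X : a) : (discFun t₁ t₂).1 X = t₁ X ^ 2 - t₂ X ^ 2 := rfl

section Coordinates

variable (h : IsCoordPair t₁ t₂)

include h

theorem IsCoordPair.dder_hvec_left : dder (hvec ((2 : ℂ) • t₁)) (linFun t₁) = 2 ∧
    dder (hvec ((2 : ℂ) • t₁)) (linFun t₂) = 0 := by
  obtain ⟨h1, h2⟩ := h.hvec_spec (α := (2 : ℂ) • t₁) (c₁ := 2) (c₂ := 0) fun X => by
    rw [zero_mul, add_zero]
    rfl
  rw [dder_linFun, dder_linFun, h1, h2, map_zero, map_ofNat]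
  exact ⟨rfl, rfl⟩

theorem IsCoordPair.dder_hvec_right : dder (hvec ((2 : ℂ) • t₂)) (linFun t₁) = 0 ∧
    dder (hvec ((2 : ℂ) • t₂)) (linFun t₂) = 2 := h.swap.dder_hvec_left.symm

omit h in
theorem dder_pullA (k : a × a) (F : smoothAlg (ℝ × ℝ)) : dder k (pullA a F)
    = dder k (pullA a cFst) * pullA a (dFst F) + dder k (pullA a cSnd) * pullA a (dSnd F) :=
  dder_pull _ _ _ _ _ F

theorem IsCoordPair.L_left (F : smoothAlg (ℝ × ℝ)) (ε : ℂ) {x : a} (hx : t₁ x ≠ 0) :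
    L ((2 : ℂ) • t₁) (ε • (discFun t₁ t₂ * pullA a F)).1 =ᶠ[𝓝 x]
      ((ε / 4) • (16 * halfRadial dFst dSnd (pullA a) (linFun t₁ ^ 2) (linFun t₂ ^ 2) F)).1 :=
  L_eventuallyEq_of_dder (radial_first h.dder_hvec_left.1 h.dder_hvec_left.2 (pullA_cFst h)
    (pullA_cSnd h) (dder_pullA _) dSnd_dFst F) ε hx

theorem IsCoordPair.L_right (F : smoothAlg (ℝ × ℝ)) (ε : ℂ) {x : a} (hx : t₂ x ≠ 0) :
    L ((2 : ℂ) • t₂) (ε • (discFun t₁ t₂ * pullA a F)).1 =ᶠ[𝓝 x]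
      ((ε / 4) • -(16 * halfRadial dFst dSnd (pullA a) (linFun t₂ ^ 2) (linFun t₁ ^ 2) F)).1 :=
  L_eventuallyEq_of_dder (radial_second h.dder_hvec_right.1 h.dder_hvec_right.2 (pullA_cFst h)
    (pullA_cSnd h) (dder_pullA _) dSnd_dFst F) ε hx

/-- The constant `ε` allows the same statement to serve for `δ` and for `I`, each locally a constant
multiple of `v`. -/
theorem IsCoordPair.L_add_L (F : smoothAlg (ℝ × ℝ)) (ε : ℂ) {x : a} (hx₁ : t₁ x ≠ 0)
    (hx₂ : t₂ x ≠ 0) {g : a → ℂ} (hg : g =ᶠ[𝓝 x] (ε • (discFun t₁ t₂ * pullA a F)).1) :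
    L ((2 : ℂ) • t₁) g x + L ((2 : ℂ) • t₂) g x
      = ε * (4 * ((discFun t₁ t₂).1 x * (radialQ F).1 (invMap x))) := by
  rw [((L_eventuallyEq hg).trans (h.L_left F ε hx₁)).eq_of_nhds,
    ((L_eventuallyEq hg).trans (h.L_right F ε hx₂)).eq_of_nhds]
  have := congrArg (fun f : smoothAlg a => f.1 x)
    (halfRadial_sub (p := dFst) (s := dSnd) (pullA_cFst h) (pullA_cSnd h) F)
  change ε / 4 * _ + ε / 4 * _ = _
  rw [← mul_add]
  refine (congrArg (ε / 4 * ·) this).trans ?_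
  change ε / 4 * (16 * ((discFun t₁ t₂).1 x * (radialQ F).1 (invMap x))) = _
  ring

theorem IsCoordPair.L_comp_L (F : smoothAlg (ℝ × ℝ)) (ε : ℂ) {x : a} (hx₁ : t₁ x ≠ 0)
    (hx₂ : t₂ x ≠ 0) {g : a → ℂ} (hg : g =ᶠ[𝓝 x] (ε • (discFun t₁ t₂ * pullA a F)).1) :
    L ((2 : ℂ) • t₁) (L ((2 : ℂ) • t₂) g) x
      = ε * (16 * ((discFun t₁ t₂).1 x * (radialS F).1 (invMap x))) := by
  have h1 := (L_eventuallyEq (α := (2 : ℂ) • t₁)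
    ((L_eventuallyEq hg).trans (h.L_right F ε hx₂))).trans
    (L_eventuallyEq_of_dder (radial_first_halfRadial h.dder_hvec_left.1 h.dder_hvec_left.2
      (pullA_cFst h) (pullA_cSnd h) (dder_pullA _) dSnd_dFst dFst_cFst dFst_cSnd dSnd_cFst
      dSnd_cSnd F) (ε / 4) hx₁)
  rw [h1.eq_of_nhds]
  change ε / 4 / 4 * (256 * ((discFun t₁ t₂).1 x * (radialS F).1 (invMap x))) = _
  ring

end Coordinates

section Uniqueness

variable (h : IsCoordPair t₁ t₂) (ha : IsCartanSubspace a)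

theorem toAlg_symm_pullQ_apply (F : smoothAlg (ℝ × ℝ)) (X : q) :
    (toAlg.symm (pullQ F)).1 X = F.1 (invMap X) := rfl

theorem isHInvariant_pullQ (F : smoothAlg (ℝ × ℝ)) : IsHInvariant (toAlg.symm (pullQ F)).1 := by
  intro k _ X X' hX'
  rw [toAlg_symm_pullQ_apply, toAlg_symm_pullQ_apply, invMap, invMap, hX', Q_conj, S_conj]

include h ha

theorem IsCoordPair.exists_pull {g : a → ℂ} (hg : ContDiffOn ℝ ∞ g (aReg a)) {x : a}
    (hx : x ∈ aReg a) :
    ∃ F : smoothAlg (ℝ × ℝ), g =ᶠ[𝓝 x] fun X : a => F.1 (invMap (X : q)) := by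
  obtain ⟨G, hG, hgG⟩ := exists_contDiff_comp_eq h.finrank_eq (contDiff_invMap_sub a)
    (h.isOpen_aReg ha) (fun x hx => h.injective_fderiv ha hx) hg hx
  exact ⟨⟨G, hG⟩, hgG⟩

/-- Near a regular point any smooth `g` is the restriction of an invariant function `F(Q, S)` smooth
on all of `𝔮`; by locality, compatibility prescribes the value at that point. -/
theorem IsCoordPair.compatible_unique {D : Module.End ℂ (SmoothFun q)}
    {Δ Δ' : (a → ℂ) → (a → ℂ)} (hΔ : IsCompatible a D Δ) (hΔ' : IsCompatible a D Δ') :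
    OpEqOn (aReg a) Δ' Δ := by
  intro g hg x hx
  obtain ⟨F, hF⟩ := h.exists_pull ha hg hx
  have hsm : ContDiffOn ℝ ∞ (fun X : a => F.1 (invMap (X : q))) (aReg a) :=
    ((smoothAlg_contDiff F).comp (contDiff_invMap_sub a)).contDiffOn
  have e : ∀ {Δ : (a → ℂ) → (a → ℂ)}, IsCompatible a D Δ →
      Δ g x = (D (toAlg.symm (pullQ F))).1 (x : q) := fun hΔ =>
    (hΔ.1.eq_of_eventuallyEq hg hsm hx hF).trans (hΔ.2 _ (isHInvariant_pullQ F) hx)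
  rw [e hΔ, e hΔ']

/-- An `H`-invariant smooth function is a smooth function of `(Q, S)` near a regular element. -/
theorem IsCoordPair.exists_pullQ {f : SmoothFun q} (hf : IsHInvariant f.1) {x : a}
    (hx : x ∈ aReg a) : ∃ F : smoothAlg (ℝ × ℝ),
      f.1 =ᶠ[𝓝 (x : q)] (toAlg.symm (pullQ F)).1 := by
  have hfa : ContDiffOn ℝ ∞ (fun X : a => f.1 (X : q)) (aReg a) :=
    ((smoothFun_contDiff f).comp (contDiff_subtype a)).contDiffOn
  obtain ⟨F, hF⟩ := h.exists_pull ha hfa hx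
  refine ⟨F, ?_⟩
  -- The map `(Q, S)` is open at `x` already on `𝔞`. So any `Y ∈ 𝔮` near `x` has the invariants of
  -- some regular `y ∈ 𝔞` near `x`; it is `H`-conjugate to `y`, and `f(Y) = f(y)`.
  have hW : {y : a | f.1 (y : q) = F.1 (invMap (y : q))} ∩ aReg a ∈ 𝓝 x :=
    inter_mem hF ((h.isOpen_aReg ha).mem_nhds hx)
  have himage := image_mem_map (m := fun X : a => invMap (X : q)) hW
  have hmap : map (fun X : a => invMap (X : q)) (𝓝 x) = 𝓝 (invMap (x : q)) :=
    map_nhds_of_injective_fderiv h.finrank_eq (contDiff_invMap_sub a) (h.injective_fderiv ha hx)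
  rw [hmap] at himage
  filter_upwards [contDiff_invMap.continuous.continuousAt himage] with Y hY
  obtain ⟨y, ⟨hy1, hy2⟩, hyY⟩ := hY
  obtain ⟨k, hk, hkY⟩ := exists_H_conj (y : q).2 Y.2 (congrArg Prod.fst hyY)
    (congrArg Prod.snd hyY) (h.S_ne_zero ha hy2) (h.S0_ne_zero ha hy2)
  rw [hf k hk (y : q) Y hkY, hy1, toAlg_symm_pullQ_apply]
  exact congrArg F.1 hyY

end Uniqueness

section Existence

variable (h : IsCoordPair t₁ t₂) (ha : IsCartanSubspace a)

/-- `u` and `u'` are, locally on `𝔞^reg` and up to a constant, `v = t₁² - t₂²` and its inverse. -/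
def IsLocalDisc (t₁ t₂ : a →ₗ[ℝ] ℂ) (u u' : a → ℂ) : Prop :=
  ∀ x ∈ aReg a, ∃ ε : ℂ, ε ≠ 0 ∧ u =ᶠ[𝓝 x] (ε • discFun t₁ t₂).1 ∧
    u' =ᶠ[𝓝 x] fun X => (ε * (discFun t₁ t₂).1 X)⁻¹

variable {u u' : a → ℂ} (hu : IsLocalDisc t₁ t₂ u u')

theorem IsLocalDisc.contDiffOn_left {u u' : a → ℂ} (hu : IsLocalDisc t₁ t₂ u u') :
    ContDiffOn ℝ ∞ u (aReg a) := by
  intro x hx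
  obtain ⟨ε, -, h1, -⟩ := hu x hx
  exact ((smoothAlg_contDiff _).contDiffAt.congr_of_eventuallyEq h1).contDiffWithinAt

include h ha in
theorem IsCoordPair.discFun_ne_zero {x : a} (hx : x ∈ aReg a) : (discFun t₁ t₂).1 x ≠ 0 :=
  sub_ne_zero.2 ((h.mem_aReg_iff ha x).1 hx).2.2

include h ha hu in
theorem IsLocalDisc.contDiffOn_right : ContDiffOn ℝ ∞ u' (aReg a) := by
  intro x hx
  obtain ⟨ε, hε, -, h2⟩ := hu x hx
  refine (ContDiffAt.congr_of_eventuallyEq ?_ h2).contDiffWithinAt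
  exact (contDiffAt_const.mul (smoothAlg_contDiff _).contDiffAt).inv
    (mul_ne_zero hε (h.discFun_ne_zero ha hx))

include h ha hu in
/-- Radial part of `∂(p)`, from the action of the operators on functions of `(Q, S)`. -/
theorem IsLocalDisc.isRadialPart {p : MvPolynomial Coord ℂ} {T : (a → ℂ) → (a → ℂ)}
    {R : smoothAlg (ℝ × ℝ) → smoothAlg (ℝ × ℝ)} {m : ℂ}
    (hp : ∀ F X, (partialOp p (toAlg.symm (pullQ F))).1 X = m * (R F).1 (invMap X))
    (hT : ∀ (F : smoothAlg (ℝ × ℝ)) (ε : ℂ) (g : a → ℂ), ∀ x ∈ aReg a,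
      g =ᶠ[𝓝 x] (ε • (discFun t₁ t₂ * pullA a F)).1 →
        T g x = ε * (m * ((discFun t₁ t₂).1 x * (R F).1 (invMap x))))
    (hTd : IsDiffOp (aReg a) (T ∘ mulOp u)) :
    IsRadialPart a (partialOp p) (mulOp u' ∘ T ∘ mulOp u) := by
  have hc : IsCompatible a (partialOp p) (mulOp u' ∘ T ∘ mulOp u) := by
    refine ⟨hTd.mul (hu.contDiffOn_right h ha), fun f hf x hx => ?_⟩
    obtain ⟨F, hF⟩ := h.exists_pullQ ha hf hx
    obtain ⟨ε, hε, h1, h2⟩ := hu x hx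
    have hv := h.discFun_ne_zero ha hx
    have hFa : ∀ᶠ X : a in 𝓝 x, f.1 (X : q) = (toAlg.symm (pullQ F)).1 (X : q) :=
      (contDiff_subtype a).continuous.continuousAt.eventually hF
    have h3 : mulOp u (fun X : a => f.1 (X : q)) =ᶠ[𝓝 x]
        (ε • (discFun t₁ t₂ * pullA a F)).1 := by
      filter_upwards [h1, hFa] with X hX1 hX2
      rw [mulOp, hX1, hX2]
      change ε * (discFun t₁ t₂).1 X * F.1 (invMap X) = ε * ((discFun t₁ t₂).1 X * F.1 (invMap X))
      ring
    have h4 : (partialOp p f).1 (x : q) = m * (R F).1 (invMap x) :=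
      (constCoeffOp_eventuallyEq dualVec p _ _ hF).eq_of_nhds.trans (hp F x)
    change u' x * T _ x = (partialOp p f).1 (x : q)
    rw [hT F ε _ x hx h3, h4, h2.eq_of_nhds]
    field_simp
  exact ⟨hc, fun Δ' hΔ' => h.compatible_unique ha hc hΔ'⟩

include h ha in
theorem IsCoordPair.two_smul_ne_zero : (∀ X ∈ aReg a, ((2 : ℂ) • t₁) X ≠ 0) ∧
    ∀ X ∈ aReg a, ((2 : ℂ) • t₂) X ≠ 0 :=
  ⟨fun X hX => mul_ne_zero two_ne_zero ((h.mem_aReg_iff ha X).1 hX).1,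
    fun X hX => mul_ne_zero two_ne_zero ((h.mem_aReg_iff ha X).1 hX).2.1⟩

include hu in
theorem IsLocalDisc.isDiffOp_mulOp : IsDiffOp (aReg a) (mulOp u) :=
  isDiffOp_id.mul hu.contDiffOn_left

include h ha hu in
theorem IsLocalDisc.isRadialPart_Q : IsRadialPart a (partialOp (Q genericX))
    (mulOp u' ∘ (fun g => L ((2 : ℂ) • t₁) g + L ((2 : ℂ) • t₂) g) ∘ mulOp u) := by
  refine hu.isRadialPart h ha (R := radialQ) (m := 4) (fun F X => ?_) (fun F ε g x hx hg => ?_) ?_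
  · exact congrArg (fun f : smoothAlg q => f.1 X) (partialOp_Q_pullQ F)
  · obtain ⟨h1, h2, -⟩ := (h.mem_aReg_iff ha x).1 hx
    exact h.L_add_L F ε h1 h2 hg
  · have hd := hu.isDiffOp_mulOp
    exact (hd.comp_L (h.isOpen_aReg ha) (h.two_smul_ne_zero ha).1).add
      (hd.comp_L (h.isOpen_aReg ha) (h.two_smul_ne_zero ha).2)

include h ha hu in
theorem IsLocalDisc.isRadialPart_S : IsRadialPart a (partialOp (S genericX))
    (mulOp u' ∘ (L ((2 : ℂ) • t₁) ∘ L ((2 : ℂ) • t₂)) ∘ mulOp u) := by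
  refine hu.isRadialPart h ha (R := radialS) (m := 16) (fun F X => ?_) (fun F ε g x hx hg => ?_) ?_
  · exact congrArg (fun f : smoothAlg q => f.1 X) (partialOp_S_pullQ F)
  · obtain ⟨h1, h2, -⟩ := (h.mem_aReg_iff ha x).1 hx
    exact h.L_comp_L F ε h1 h2 hg
  · have hd := hu.isDiffOp_mulOp
    exact (hd.comp_L (h.isOpen_aReg ha) (h.two_smul_ne_zero ha).2).comp_L (h.isOpen_aReg ha)
      (h.two_smul_ne_zero ha).1

end Existence

/-! ### The square root `δ` as a local multiple of `t₁² - t₂²`. -/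

section SquareRoot

theorem delta_sq (X : gl4 ℝ) : delta X ^ 2 = (S0 X : ℝ) := by
  rw [delta, mul_pow, ← Complex.ofReal_pow, Real.sq_sqrt (abs_nonneg _)]
  split_ifs with hX
  · rw [abs_of_neg hX, Complex.I_sq]
    push_cast
    ring
  · rw [abs_of_nonneg (not_lt.1 hX), one_pow, one_mul]

theorem continuousAt_delta (h : IsCoordPair t₁ t₂) (ha : IsCartanSubspace a) {x : a}
    (hx : x ∈ aReg a) : ContinuousAt (fun X : a => delta (X : q)) x := by
  have hc : Continuous fun X : a => S0 ((X : q) : gl4 ℝ) :=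
    ((contDiff_Q_sub a).continuous.pow 2).sub (continuous_const.mul (contDiff_S_sub a).continuous)
  have hs : Continuous fun X : a => ((√|S0 ((X : q) : gl4 ℝ)| : ℝ) : ℂ) :=
    Complex.continuous_ofReal.comp (Real.continuous_sqrt.comp hc.abs)
  rcases (h.S0_ne_zero ha hx).lt_or_gt with h0 | h0
  · refine ContinuousAt.congr (continuous_const.mul hs).continuousAt (f := fun X : a =>
      Complex.I * ((√|S0 ((X : q) : gl4 ℝ)| : ℝ) : ℂ)) ?_
    filter_upwards [hc.continuousAt.eventually_lt continuousAt_const h0] with X hX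
    rw [delta, if_pos hX]
  · refine ContinuousAt.congr (continuous_const.mul hs).continuousAt (f := fun X : a =>
      1 * ((√|S0 ((X : q) : gl4 ℝ)| : ℝ) : ℂ)) ?_
    filter_upwards [continuousAt_const.eventually_lt hc.continuousAt h0] with X hX
    rw [delta, if_neg (not_lt.2 hX.le)]

/-- From `δ² = S₀ = v²` follows `(δ - v)(δ + v) = 0`. At a regular point one factor is nonzero; by
continuity it stays nonzero nearby, so the other factor vanishes on a neighbourhood. -/
theorem isLocalDisc_delta (h : IsCoordPair t₁ t₂) (ha : IsCartanSubspace a) :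
    IsLocalDisc t₁ t₂ (fun X => delta (X : q)) (fun X => (delta (X : q))⁻¹) := by
  intro x hx
  have hv := h.discFun_ne_zero ha hx
  have hsq : ∀ X : a, (delta (X : q) - (discFun t₁ t₂).1 X) * (delta (X : q)
      + (discFun t₁ t₂).1 X) = 0 := by
    intro X
    have h1 := delta_sq (X : q)
    rw [h.S0_eq, ← discFun_apply] at h1
    linear_combination h1
  have hvc := (smoothAlg_contDiff (discFun t₁ t₂)).continuous.continuousAt (x := x)
  have hdc := continuousAt_delta h ha hx
  obtain ⟨ε, hε, h1⟩ : ∃ ε : ℂ, ε ≠ 0 ∧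
      (fun X : a => delta (X : q)) =ᶠ[𝓝 x] (ε • discFun t₁ t₂).1 := by
    rcases mul_eq_zero.1 (hsq x) with h0 | h0
    · refine ⟨1, one_ne_zero, ?_⟩
      have h2 : delta (x : q) + (discFun t₁ t₂).1 x ≠ 0 := by
        rw [sub_eq_zero.1 h0, ← two_mul]
        exact mul_ne_zero two_ne_zero hv
      filter_upwards [(hdc.add hvc).eventually_ne h2] with X hX
      rw [one_smul]
      exact sub_eq_zero.1 ((mul_eq_zero.1 (hsq X)).resolve_right hX)
    · refine ⟨-1, neg_ne_zero.2 one_ne_zero, ?_⟩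
      have h2 : delta (x : q) - (discFun t₁ t₂).1 x ≠ 0 := by
        rw [eq_neg_of_add_eq_zero_left h0, ← neg_add', ← two_mul]
        exact neg_ne_zero.2 (mul_ne_zero two_ne_zero hv)
      filter_upwards [(hdc.sub hvc).eventually_ne h2] with X hX
      rw [neg_one_smul]
      exact eq_neg_of_add_eq_zero_left ((mul_eq_zero.1 (hsq X)).resolve_left hX)
  refine ⟨ε, hε, h1, ?_⟩
  filter_upwards [h1] with X hX
  rw [hX]
  rfl

end SquareRoot

end RadialOperators

end SymPair
end

/-! ### The theorem. -/

open SymPair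
theorem proposition4p1p1 (a : Submodule ℝ q) (ha : IsCartanSubspace a)
    (P : Finset (a →ₗ[ℝ] ℂ)) (hP : IsPositiveSystem a P) :
    {α | α ∈ P ∧ mult a α = 1}.ncard = 2 ∧
    ∀ α₁ ∈ P, ∀ α₂ ∈ P, mult a α₁ = 1 → mult a α₂ = 1 → α₁ ≠ α₂ →
      -- the radial part of `∂(Q)`
      IsRadialPart a (partialOp (Q genericX))
        (mulOp (fun X => (delta (X : q))⁻¹) ∘ (fun g => L α₁ g + L α₂ g) ∘
          mulOp (fun X => delta (X : q))) ∧
      IsRadialPart a (partialOp (Q genericX))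
        (mulOp (rootPow P fun α => 1 - (mult a α : ℤ)) ∘ (fun g => L α₁ g + L α₂ g) ∘
          mulOp (rootPow P fun α => (mult a α : ℤ) - 1)) ∧
      -- the radial part of `∂(S)`
      IsRadialPart a (partialOp (S genericX))
        (mulOp (fun X => (delta (X : q))⁻¹) ∘ (L α₁ ∘ L α₂) ∘
          mulOp (fun X => delta (X : q))) ∧
      IsRadialPart a (partialOp (S genericX))
        (mulOp (rootPow P fun α => 1 - (mult a α : ℤ)) ∘ (L α₁ ∘ L α₂) ∘
          mulOp (rootPow P fun α => (mult a α : ℤ) - 1)) := by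
  obtain ⟨hcard, hroots⟩ := ha.simple_roots hP
  refine ⟨hcard, fun α₁ h₁ α₂ h₂ hm₁ hm₂ hne => ?_⟩
  obtain ⟨t₁, t₂, rfl, rfl, h, ε, hε, hu, hu'⟩ := hroots α₁ h₁ α₂ h₂ hm₁ hm₂ hne
  have hI : IsLocalDisc t₁ t₂ (rootPow P fun α => (mult a α : ℤ) - 1)
      (rootPow P fun α => 1 - (mult a α : ℤ)) := by
    -- The two products over the roots carry the same sign `ε`, whereas `IsLocalDisc` asks for
    -- inverse constants.
    have hεinv : ε⁻¹ = ε := inv_eq_of_mul_eq_one_left (by rw [← sq, hε])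
    refine fun x _ => ⟨ε, ?_, .of_forall hu, .of_forall fun X => ?_⟩
    · rintro rfl
      norm_num at hε
    · rw [hu']
      change _ = (ε * (t₁ X ^ 2 - t₂ X ^ 2))⁻¹
      rw [mul_inv, hεinv]
  have hδ := isLocalDisc_delta h ha
  exact ⟨hδ.isRadialPart_Q h ha, hI.isRadialPart_Q h ha, hδ.isRadialPart_S h ha,
    hI.isRadialPart_S h ha⟩
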